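/- Let $(S,\mathfrak A,\mu)$ and $(T,\mathfrak B,\nu)$ be $\sigma$-finite measure spaces. For $h\in L^2(\mu\times\nu)$ let $\mathcal I_h:L^2(\nu)\to L^2(\mu)$ be the integral operator $(\mathcal I_hf)(s)=\int_T h(s,t)f(t)\,d\nu(t)$. Let $\boldsymbol S_1$ be the trace class of operators from $L^2(\nu)$ to $L^2(\mu)$, with norm $\|A\|_{\boldsymbol S_1}=\operatorname{trace}\,(A^*A)^{1/2}$. A function $\Phi:S\times T\to\mathbb C$ is a Schur multiplier with respect to $\mu$ and $\nu$, written $\Phi\in\mathfrak M(\mu,\nu)$, if it is $\mu\times\nu$-measurable and, for every $h\in L^2(\mu\times\nu)$ with $\mathcal I_h\in\boldsymbol S_1$, one has $\Phi h\in L^2(\mu\times\nu)$ and $\mathcal I_{\Phi h}\in\boldsymbol S_1$. Its norm $\|\Phi\|_{\mathfrak M(\mu,\nu)}$ is the least $c\ge0$ such that $\|\mathcal I_{\Phi h}\|_{\boldsymbol S_1}\le c\,\|\mathcal I_h\|_{\boldsymbol S_1}$ for all such $h$. (a) Let $\Phi\in L^\infty(\mu\times\nu)$ and let $C>0$ be a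 real number. The following are equivalent: (i) $\Phi\in\mathfrak M(\mu,\nu)$ and $\|\Phi\|_{\mathfrak M(\mu,\nu)}\le C$; (ii) there exist a complex Hilbert space $\mathscr H$ and (strongly measurable) functions $x\in L^\infty(\mu,\mathscr H)$, $y\in L^\infty(\nu,\mathscr H)$ such that $\Phi(s,t)=\langle x(s),y(t)\rangle$ for $\mu\times\nu$-almost all $(s,t)$ and $\|x\|_{L^\infty(\mu,\mathscr H)}\,\|y\|_{L^\infty(\nu,\mathscr H)}\le C$; (iii) there exist $\varphi_n\in L^\infty(\mu)$ and $\psi_n\in L^\infty(\nu)$, $n\ge1$, such that $\Phi(s,t)=\sum_{n=1}^\infty\varphi_n(s)\psi_n(t)$ for $\mu\times\nu$-almost all $(s,t)$, $\sum_{n=1}^\infty|\varphi_n|^2\le C$ $\mu$-almost everywhere, and $\sum_{n=1}^\infty|\psi_n|^2\le C$ $\nu$-almost everywhere. (b) Let the Haagerup tensor product $L^\infty(\mu)\otimes_{\rm h}L^\infty(\nu)$ be the space of functions $\Phi$ on $S\times T$ that admit a representation $\Phi(s,t)=\sum_{n}\varphi_n(s)\psi_n(t)$ $\mu\times\nu$-almost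 everywhere with $\varphi_n\in L^\infty(\mu)$, $\psi_n\in L^\infty(\nu)$ and $\big\|\sum_n|\varphi_n|^2\big\|_{L^\infty(\mu)}<\infty$, $\big\|\sum_n|\psi_n|^2\big\|_{L^\infty(\nu)}<\infty$, and let its norm be the infimum of $\big\|\sum_n|\varphi_n|^2\big\|_{L^\infty(\mu)}^{1/2}\big\|\sum_n|\psi_n|^2\big\|_{L^\infty(\nu)}^{1/2}$ over all such representations. Then $\mathfrak M(\mu,\nu)=L^\infty(\mu)\otimes_{\rm h}L^\infty(\nu)$, and $\|\Phi\|_{\mathfrak M(\mu,\nu)}=\|\Phi\|_{L^\infty(\mu)\otimes_{\rm h}L^\infty(\nu)}$ for every $\Phi\in\mathfrak M(\mu,\nu)$. -/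

import Mathlib

open MeasureTheory
open scoped ENNReal NNReal

universe u v w

set_option linter.unusedSectionVars false

noncomputable section

/-! ### Trace class operators between Hilbert spaces -/

section TraceClass

variable {E : Type*} [NormedAddCommGroup E] [InnerProductSpace ℂ E] [CompleteSpace E]
  {F : Type*} [NormedAddCommGroup F] [InnerProductSpace ℂ F] [CompleteSpace F]

/-- The modulus `|A| = (A* A)^{1/2}` of a bounded operator between Hilbert spaces. -/
def operatorModulus (A : E →L[ℂ] F) : E →L[ℂ] E :=
  CFC.sqrt ((ContinuousLinearMap.adjoint A) ∘L A)

variable (E) in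
/-- The index set of an orthonormal basis of a Hilbert space. -/
def onbIndex : Set E := (exists_hilbertBasis ℂ E).choose

variable (E) in
/-- An orthonormal basis of a Hilbert space. -/
def onb : HilbertBasis (onbIndex E) ℂ E := (exists_hilbertBasis ℂ E).choose_spec.choose

/-- The trace norm `trace |A| = ∑ ⟨|A| e, e⟩`, the sum being over an orthonormal basis; it takes
the value `∞` when `A` is not of trace class. -/
def traceNorm (A : E →L[ℂ] F) : ℝ≥0∞ :=
  ∑' i, ENNReal.ofReal (RCLike.re (inner ℂ (operatorModulus A (onb E i)) (onb E i)))

/-- `A` belongs to the trace class `S₁`. -/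
def IsTraceClass (A : E →L[ℂ] F) : Prop := traceNorm A < ∞

end TraceClass

/-! ### Integral operators with square integrable kernels -/

section Kernel

variable {S : Type u} {T : Type v} [MeasurableSpace S] [MeasurableSpace T]
  {μ : Measure S} {ν : Measure T} [SigmaFinite μ] [SigmaFinite ν]

/-- The function `s ↦ ∫ h(s,t) f(t) dν(t)`. -/
def kernelIntegral (ν : Measure T) (h : S × T → ℂ) (f : T → ℂ) (s : S) : ℂ :=
  ∫ t, h (s, t) * f t ∂ν

lemma kernel_section_memLp {h : S × T → ℂ} (hh : MemLp h 2 (μ.prod ν)) :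
    ∀ᵐ s ∂μ, MemLp (fun t => h (s, t)) 2 ν := by
  have h1 := (memLp_two_iff_integrable_sq_norm hh.1).1 hh
  filter_upwards [h1.prod_right_ae, hh.1.prodMk_left] with s hs hs'
  exact (memLp_two_iff_integrable_sq_norm hs').2 hs

lemma kernelIntegral_aestronglyMeasurable {h : S × T → ℂ} (hh : MemLp h 2 (μ.prod ν))
    {f : T → ℂ} (hf : MemLp f 2 ν) : AEStronglyMeasurable (kernelIntegral ν h f) μ :=
  (hh.1.mul hf.1.comp_snd).integral_prod_right'

lemma enorm_kernelIntegral_le {h : S × T → ℂ} {f : T → ℂ} (hf : MemLp f 2 ν) {s : S}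
    (hs : MemLp (fun t => h (s, t)) 2 ν) :
    ‖kernelIntegral ν h f s‖ₑ ≤ eLpNorm (fun t => h (s, t)) 2 ν * eLpNorm f 2 ν := by
  refine (enorm_integral_le_lintegral_enorm _).trans ?_
  rw [← eLpNorm_one_eq_lintegral_enorm]
  have key := eLpNorm_smul_le_mul_eLpNorm (p := 2) (q := 2) (r := 1) hf.1 hs.1
  have heq : (fun t => h (s, t)) • f = fun t => h (s, t) * f t := rfl
  rwa [heq] at key

lemma eLpNorm_two_sq {α : Type*} [MeasurableSpace α] (m : Measure α) (g : α → ℂ) :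
    eLpNorm g 2 m ^ 2 = ∫⁻ a, ‖g a‖ₑ ^ 2 ∂m := by
  simpa using eLpNorm_nnreal_pow_eq_lintegral (μ := m) (f := g) (p := 2) two_ne_zero

lemma eLpNorm_kernelIntegral_le {h : S × T → ℂ} (hh : MemLp h 2 (μ.prod ν))
    {f : T → ℂ} (hf : MemLp f 2 ν) :
    eLpNorm (kernelIntegral ν h f) 2 μ ≤ eLpNorm h 2 (μ.prod ν) * eLpNorm f 2 ν := by
  rw [← ENNReal.pow_le_pow_left_iff two_ne_zero, mul_pow, eLpNorm_two_sq, eLpNorm_two_sq,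
    lintegral_prod _ (hh.1.enorm.pow_const 2), ← lintegral_mul_const' _ _ (by
      exact ENNReal.pow_ne_top hf.2.ne)]
  refine lintegral_mono_ae ?_
  filter_upwards [kernel_section_memLp hh] with s hs
  have := pow_le_pow_left' (enorm_kernelIntegral_le hf hs) 2
  rwa [mul_pow, eLpNorm_two_sq ν (fun t => h (s, t))] at this

lemma kernelIntegral_memLp {h : S × T → ℂ} (hh : MemLp h 2 (μ.prod ν))
    {f : T → ℂ} (hf : MemLp f 2 ν) : MemLp (kernelIntegral ν h f) 2 μ :=
  ⟨kernelIntegral_aestronglyMeasurable hh hf,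
    (eLpNorm_kernelIntegral_le hh hf).trans_lt (ENNReal.mul_lt_top hh.2 hf.2)⟩

/-- The integral operator `I_h : L²(ν) → L²(μ)`, `(I_h f)(s) = ∫ h(s,t) f(t) dν(t)`,
with kernel `h ∈ L²(μ × ν)`. -/
def integralOperator (h : S × T → ℂ) (hh : MemLp h 2 (μ.prod ν)) :
    Lp ℂ 2 ν →L[ℂ] Lp ℂ 2 μ :=
  LinearMap.mkContinuous
    { toFun := fun f => (kernelIntegral_memLp hh (Lp.memLp f)).toLp _
      map_add' := by
        intro f g
        rw [← MemLp.toLp_add, MemLp.toLp_eq_toLp_iff]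
        filter_upwards [kernel_section_memLp hh] with s hs
        simp only [kernelIntegral, Pi.add_apply]
        refine Eq.trans (integral_congr_ae ?_)
          (integral_add (hs.integrable_mul (Lp.memLp f)) (hs.integrable_mul (Lp.memLp g)))
        filter_upwards [Lp.coeFn_add f g] with t ht
        simp only [ht, Pi.add_apply]
        ring
      map_smul' := by
        intro c f
        rw [RingHom.id_apply, ← MemLp.toLp_const_smul, MemLp.toLp_eq_toLp_iff]
        refine Filter.Eventually.of_forall fun s => ?_
        simp only [kernelIntegral, Pi.smul_apply, smul_eq_mul]
        rw [← integral_const_mul]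
        refine integral_congr_ae ?_
        filter_upwards [Lp.coeFn_smul c f] with t ht
        rw [ht, Pi.smul_apply, smul_eq_mul]
        ring }
    (eLpNorm h 2 (μ.prod ν)).toReal (by
      intro f
      simp only [LinearMap.coe_mk, AddHom.coe_mk, Lp.norm_toLp]
      rw [Lp.norm_def, ← ENNReal.toReal_mul]
      exact ENNReal.toReal_mono (ENNReal.mul_lt_top hh.2 (Lp.memLp f).2).ne
        (eLpNorm_kernelIntegral_le hh (Lp.memLp f)))

/-! ### Schur multipliers with respect to measures -/

/-- `Φ` is a Schur multiplier with respect to `μ` and `ν`: it is `μ × ν`-measurable, and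
`I_{Φ h}` is of trace class whenever `h ∈ L²(μ × ν)` and `I_h` is of trace class. -/
def IsSchurMultiplier (μ : Measure S) (ν : Measure T) [SigmaFinite μ] [SigmaFinite ν]
    (Φ : S × T → ℂ) : Prop :=
  AEStronglyMeasurable Φ (μ.prod ν) ∧
    ∀ (h : S × T → ℂ) (hh : MemLp h 2 (μ.prod ν)), IsTraceClass (integralOperator h hh) →
      ∃ hΦ : MemLp (fun p => Φ p * h p) 2 (μ.prod ν),
        IsTraceClass (integralOperator (fun p => Φ p * h p) hΦ)

/-- `‖I_{Φ h}‖_{S₁} ≤ c ‖I_h‖_{S₁}` for all `h ∈ L²(μ × ν)` with `I_h` of trace class. -/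
def IsSchurBound (μ : Measure S) (ν : Measure T) [SigmaFinite μ] [SigmaFinite ν]
    (Φ : S × T → ℂ) (c : ℝ≥0) : Prop :=
  ∀ (h : S × T → ℂ) (hh : MemLp h 2 (μ.prod ν)), IsTraceClass (integralOperator h hh) →
    ∃ hΦ : MemLp (fun p => Φ p * h p) 2 (μ.prod ν),
      traceNorm (integralOperator (fun p => Φ p * h p) hΦ)
        ≤ c * traceNorm (integralOperator h hh)

/-- The norm of `Φ` in the space of Schur multipliers with respect to `μ` and `ν`: the least
constant `c ≥ 0` with `‖I_{Φ h}‖_{S₁} ≤ c ‖I_h‖_{S₁}` (`∞` if there is none). -/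
def schurNorm (μ : Measure S) (ν : Measure T) [SigmaFinite μ] [SigmaFinite ν]
    (Φ : S × T → ℂ) : ℝ≥0∞ :=
  ⨅ (c : ℝ≥0) (_ : IsSchurBound μ ν Φ c), (c : ℝ≥0∞)

/-! ### The Haagerup tensor product of `L^∞` spaces -/

/-- The norm of a sequence of functions in `L^∞(μ, ℓ²)`, i.e. `‖∑ |φ_n|²‖_{L^∞(μ)}^{1/2}`. -/
def normLinftyEllTwo (μ : Measure S) (φ : ℕ → S → ℂ) : ℝ≥0∞ :=
  (essSup (fun s => ∑' n, ‖φ n s‖ₑ ^ 2) μ) ^ (1 / 2 : ℝ)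

/-- `Φ(s,t) = ∑ φ_n(s) ψ_n(t)` almost everywhere, with `φ_n ∈ L^∞(μ)`, `ψ_n ∈ L^∞(ν)`,
`{φ_n} ∈ L^∞(μ, ℓ²)` and `{ψ_n} ∈ L^∞(ν, ℓ²)`. -/
structure IsHaagerupRepresentation (μ : Measure S) (ν : Measure T) (Φ : S × T → ℂ)
    (φ : ℕ → S → ℂ) (ψ : ℕ → T → ℂ) : Prop where
  left_memLp : ∀ n, MemLp (φ n) ∞ μ
  right_memLp : ∀ n, MemLp (ψ n) ∞ ν
  left_finite : normLinftyEllTwo μ φ < ∞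
  right_finite : normLinftyEllTwo ν ψ < ∞
  hasSum : ∀ᵐ p ∂(μ.prod ν), HasSum (fun n => φ n p.1 * ψ n p.2) (Φ p)

/-- Membership in the Haagerup tensor product of `L^∞(μ)` and `L^∞(ν)`. -/
def MemHaagerup (μ : Measure S) (ν : Measure T) (Φ : S × T → ℂ) : Prop :=
  ∃ (φ : ℕ → S → ℂ) (ψ : ℕ → T → ℂ), IsHaagerupRepresentation μ ν Φ φ ψ

/-- The norm in the Haagerup tensor product: the infimum of
`‖{φ_n}‖_{L^∞(μ, ℓ²)} ‖{ψ_n}‖_{L^∞(ν, ℓ²)}` over all representations. -/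
def haagerupNorm (μ : Measure S) (ν : Measure T) (Φ : S × T → ℂ) : ℝ≥0∞ :=
  ⨅ (φ : ℕ → S → ℂ) (ψ : ℕ → T → ℂ) (_ : IsHaagerupRepresentation μ ν Φ φ ψ),
    normLinftyEllTwo μ φ * normLinftyEllTwo ν ψ

end Kernel

end

/-! ### Trace norm, polar decomposition and nuclear representations. -/

section TraceNorm

variable {E : Type*} [NormedAddCommGroup E] [InnerProductSpace ℂ E] [CompleteSpace E]
  {F : Type*} [NormedAddCommGroup F] [InnerProductSpace ℂ F] [CompleteSpace F]

/-! From an expansion to a multiplier. A trace class operator is a product of two Hilbert–Schmidt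
operators, so `I_h = ∑ ⟨v_k, ·⟩ u_k` with `∑ ‖u_k‖²` and `∑ ‖v_k‖²` both at most the trace norm
(`exists_nuclear_representation`); conversely `∑ ‖u_k‖ ‖v_k‖` dominates the trace norm
(`traceNorm_le_tsum`). If `Φ = ∑ φ_n ⊗ ψ_n` with both square sums at most `C`, then `I_{Φh}` is
represented by the vectors `φ_n u_k` and `conj ψ_n · v_k`, whose square sums are larger by a factor
of at most `C`. This gives the Schur bound `C`.

From a multiplier to an expansion, the argument is a duality of Grothendieck type. The multiplier is
tested only on rank one kernels `a ⊗ c`, and the result is paired with `contractiveKernels`. The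
averages of `Φ` over a finite grid must then be inner products of vectors with squared norms at most
`C`: otherwise Hahn–Banach separates them from the closed cone of such Gram data, and the separating
functional, after rescaling, yields `a`, `c` and a step kernel that violate the bound
(`exists_finite_factorization`, `HasBilinearBound.exists_step_factorization`). After passing to
equivalent finite measures `m`, `n`, the grids are refined along an ultrafilter. The limiting Gram
kernel gives operators `X`, `Y` into one Hilbert space with `⟨Y 1_B, X 1_A⟩ = ∫_{A×B} Φ`, bounded by
`√C` times the `L¹` norm. Coordinates of `X` and `Y` along a sequence of orthogonal vectors are the
functions `φ_n`, `ψ_n`, and duality of `L¹` and `L^∞` turns the `L¹` bounds into pointwise bounds on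
the square sums (`exists_boundedExpansion_of_factorization`). A sequence suffices even for
nonseparable `L²` spaces, because `X* Y` is Hilbert–Schmidt.

Hilbert space valued representations correspond to expansions by taking coordinates, or by taking
`ℓ²` as the Hilbert space. A multiplier that is not known to be bounded still has some finite
constant, by Banach–Steinhaus. Both directions keep the same `C`, so the norms agree once the two
factors of a representation are balanced by a scalar. -/

lemma exists_sqrt_of_isPositive {A : E →L[ℂ] E} (hA : 0 ≤ A) :
    ∃ R : E →L[ℂ] E, ∀ x y, inner ℂ (R x) (R y) = inner ℂ x (A y) := by
  refine ⟨CFC.sqrt A, fun x y => ?_⟩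
  have h1 : IsSelfAdjoint (CFC.sqrt A) := (CFC.sqrt_nonneg A).isSelfAdjoint
  have h2 := CFC.sqrt_mul_sqrt_self A hA
  rw [← ContinuousLinearMap.adjoint_inner_right, h1.adjoint_eq]
  conv_rhs => rw [← h2]
  rfl

lemma adjoint_comp_self_nonneg (A : E →L[ℂ] F) : 0 ≤ (ContinuousLinearMap.adjoint A) ∘L A :=
  (ContinuousLinearMap.nonneg_iff_isPositive _).2 (ContinuousLinearMap.isPositive_adjoint_comp_self A)

lemma operatorModulus_nonneg (A : E →L[ℂ] F) : 0 ≤ operatorModulus A := CFC.sqrt_nonneg _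

lemma operatorModulus_isSelfAdjoint (A : E →L[ℂ] F) : IsSelfAdjoint (operatorModulus A) :=
  (operatorModulus_nonneg A).isSelfAdjoint

lemma norm_operatorModulus_apply (A : E →L[ℂ] F) (x : E) : ‖operatorModulus A x‖ = ‖A x‖ := by
  have h2 := CFC.sqrt_mul_sqrt_self _ (adjoint_comp_self_nonneg A)
  have h3 : inner ℂ (operatorModulus A x) (operatorModulus A x) = inner ℂ (A x) (A x) := by
    rw [← ContinuousLinearMap.adjoint_inner_right, (operatorModulus_isSelfAdjoint A).adjoint_eq,
      ← ContinuousLinearMap.adjoint_inner_right A]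
    exact congrArg (fun B : E →L[ℂ] E => inner ℂ x (B x)) h2
  rw [inner_self_eq_norm_sq_to_K, inner_self_eq_norm_sq_to_K] at h3
  have : ‖operatorModulus A x‖ ^ 2 = ‖A x‖ ^ 2 := by exact_mod_cast h3
  exact (pow_left_inj₀ (norm_nonneg _) (norm_nonneg _) two_ne_zero).1 this

/-- Polar decomposition. -/
lemma exists_polar_decomposition (A : E →L[ℂ] F) :
    ∃ W : E →L[ℂ] F, (∀ x, ‖W x‖ ≤ ‖x‖) ∧ (∀ x, W (operatorModulus A x) = A x) ∧
      ∀ x, ContinuousLinearMap.adjoint W (A x) = operatorModulus A x := by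
  set R := operatorModulus A
  let K : Submodule ℂ E := (LinearMap.range R.toLinearMap).topologicalClosure
  have : CompleteSpace K := (Submodule.isClosed_topologicalClosure _).completeSpace_coe
  let e : E →ₗ[ℂ] K := R.toLinearMap.codRestrict K fun x =>
    Submodule.le_topologicalClosure _ ⟨x, rfl⟩
  have he : DenseRange e := by
    intro k
    rw [Metric.mem_closure_iff]
    intro ε hε
    obtain ⟨y, ⟨x, rfl⟩, hy⟩ := Metric.mem_closure_iff.1 k.2 ε hε
    exact ⟨e x, ⟨x, rfl⟩, hy⟩
  have hn : ∀ x, ‖A.toLinearMap x‖ ≤ 1 * ‖e x‖ := fun x => by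
    rw [one_mul]; exact (norm_operatorModulus_apply A x).ge
  let W₀ : K →L[ℂ] F := A.toLinearMap.extendOfNorm e
  -- Since `‖A x‖ = ‖|A| x‖`, the map `|A| x ↦ A x` extends isometrically to the closure of the
  -- range of `|A|`; `W` is zero on the orthogonal complement.
  let W : E →L[ℂ] F := W₀ ∘L K.orthogonalProjectionOnto
  have hW : ∀ x, ‖W x‖ ≤ ‖x‖ := fun x => by
    refine (LinearMap.norm_extendOfNorm_apply_le he 1 hn _).trans ?_
    rw [one_mul]
    exact K.norm_orthogonalProjectionOnto_apply_le x
  have hWR : ∀ x, W (R x) = A x := fun x => by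
    have h1 : K.orthogonalProjectionOnto (R x) = e x :=
      K.orthogonalProjectionOnto_mem_subspace_eq_self (e x)
    change W₀ (K.orthogonalProjectionOnto (R x)) = A x
    rw [h1]
    exact LinearMap.extendOfNorm_eq he ⟨1, hn⟩ x
  refine ⟨W, hW, hWR, fun x => ?_⟩
  have hWn : ‖W‖ ≤ 1 := W.opNorm_le_bound zero_le_one fun x => by simpa using hW x
  have h1 : ‖ContinuousLinearMap.adjoint W (A x)‖ ≤ ‖R x‖ := by
    refine ((ContinuousLinearMap.adjoint W).le_opNorm _).trans ?_
    rw [LinearIsometryEquiv.norm_map, norm_operatorModulus_apply]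
    exact mul_le_of_le_one_left (norm_nonneg _) hWn
  -- Equality in Cauchy–Schwarz: `W* A x` is no longer than `|A| x`, and the real part of their
  -- inner product is `‖|A| x‖²`, so the two vectors coincide.
  have h2 : RCLike.re (inner ℂ (ContinuousLinearMap.adjoint W (A x)) (R x)) = ‖R x‖ ^ 2 := by
    rw [ContinuousLinearMap.adjoint_inner_left, hWR, norm_operatorModulus_apply]
    exact inner_self_eq_norm_sq _
  have h3 := norm_sub_sq (𝕜 := ℂ) (ContinuousLinearMap.adjoint W (A x)) (R x)
  rw [h2] at h3
  have h4 : ‖ContinuousLinearMap.adjoint W (A x) - R x‖ ^ 2 ≤ 0 := by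
    have := pow_le_pow_left₀ (norm_nonneg _) h1 2
    linarith
  exact sub_eq_zero.1 (norm_eq_zero.1 (pow_eq_zero_iff two_ne_zero |>.1
    (le_antisymm h4 (sq_nonneg _))))

lemma ENNReal.tsum_mul_le_sqrt_mul_sqrt {ι : Type*} (f g : ι → ℝ≥0∞) :
    ∑' i, f i * g i ≤ (∑' i, f i ^ 2) ^ (1 / 2 : ℝ) * (∑' i, g i ^ 2) ^ (1 / 2 : ℝ) := by
  rw [ENNReal.tsum_eq_iSup_sum]
  refine iSup_le fun s => (ENNReal.inner_le_Lp_mul_Lq s f g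
    Real.HolderConjugate.two_two).trans ?_
  simp only [ENNReal.rpow_two]
  gcongr <;> exact ENNReal.sum_le_tsum s

lemma ENNReal.tsum_mul_le_of_tsum_sq_le {ι : Type*} {f g : ι → ℝ≥0∞} {a b : ℝ≥0∞}
    (hf : ∑' i, f i ^ 2 ≤ a ^ 2) (hg : ∑' i, g i ^ 2 ≤ b ^ 2) : ∑' i, f i * g i ≤ a * b := by
  refine (ENNReal.tsum_mul_le_sqrt_mul_sqrt f g).trans ?_
  have key : ∀ c d : ℝ≥0∞, c ≤ d ^ 2 → c ^ (1 / 2 : ℝ) ≤ d := fun c d h => by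
    refine (ENNReal.rpow_le_rpow h (by norm_num)).trans ?_
    rw [← ENNReal.rpow_natCast, ← ENNReal.rpow_mul]
    norm_num
  exact mul_le_mul' (key _ _ hf) (key _ _ hg)

lemma HilbertBasis.tsum_enorm_inner_sq {ι : Type*} (b : HilbertBasis ι ℂ E) (x : E) :
    ∑' i, ‖inner ℂ (b i) x‖ₑ ^ 2 = ‖x‖ₑ ^ 2 := by
  have h := b.hasSum_inner_mul_inner x x
  have h2 : HasSum (fun i => ‖inner ℂ (b i) x‖ ^ 2) (‖x‖ ^ 2) := by
    have h3 := Complex.hasSum_re h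
    have h4 : (inner ℂ x x).re = ‖x‖ ^ 2 := inner_self_eq_norm_sq (𝕜 := ℂ) x
    rw [h4] at h3
    refine h3.congr_fun ?_
    intro i
    rw [← inner_conj_symm x (b i), ← Complex.normSq_eq_conj_mul_self, Complex.normSq_eq_norm_sq]
    rw [Complex.ofReal_re]
  have h5 : ∀ r : ℝ, 0 ≤ r → ENNReal.ofReal r ^ 2 = ENNReal.ofReal (r ^ 2) := fun r hr =>
    (ENNReal.ofReal_pow hr 2).symm
  simp only [← ofReal_norm, h5 _ (norm_nonneg _)]
  rw [← h2.tsum_eq, ENNReal.ofReal_tsum_of_nonneg (fun _ => sq_nonneg _) h2.summable]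

/-- With `|A| = W* A`, each diagonal entry of `|A|` expands over `k` into coordinates of `v k` and
`W* (u k)`. Summing over the basis first, Cauchy–Schwarz and Parseval bound the `k`-th contribution
by `‖W* (u k)‖ ‖v k‖`. -/
lemma traceNorm_le_tsum {ι : Type*} {A : E →L[ℂ] F} {u : ι → F} {v : ι → E}
    (h : ∀ x y, HasSum (fun k => inner ℂ (v k) x * inner ℂ y (u k)) (inner ℂ y (A x))) :
    traceNorm A ≤ ∑' k, ‖u k‖ₑ * ‖v k‖ₑ := by
  obtain ⟨W, hW, -, hWA⟩ := exists_polar_decomposition A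
  have hWn : ‖ContinuousLinearMap.adjoint W‖ ≤ 1 := by
    rw [LinearIsometryEquiv.norm_map]
    exact W.opNorm_le_bound zero_le_one fun x => by simpa using hW x
  have h1 : ∀ i, ENNReal.ofReal (RCLike.re (inner ℂ (operatorModulus A (onb E i)) (onb E i))) ≤
      ∑' k, ‖inner ℂ (onb E i) (v k)‖ₑ * ‖inner ℂ (onb E i) (ContinuousLinearMap.adjoint W (u k))‖ₑ := by
    intro i
    have h2 : inner ℂ (operatorModulus A (onb E i)) (onb E i)
        = starRingEnd ℂ (inner ℂ (W (onb E i)) (A (onb E i))) := by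
      rw [← hWA, ContinuousLinearMap.adjoint_inner_left, inner_conj_symm]
    rw [h2, ← (h _ _).tsum_eq]
    refine (ENNReal.ofReal_le_ofReal (RCLike.re_le_norm _)).trans ?_
    rw [RCLike.norm_conj, ofReal_norm]
    refine (enorm_tsum_le_tsum_enorm).trans_eq ?_
    congr 1 with k
    rw [enorm_mul, ContinuousLinearMap.adjoint_inner_right, ← inner_conj_symm, RCLike.enorm_conj]
  refine (ENNReal.tsum_le_tsum h1).trans ?_
  rw [ENNReal.tsum_comm]
  refine ENNReal.tsum_le_tsum fun k => ?_
  rw [mul_comm]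
  refine (ENNReal.tsum_mul_le_of_tsum_sq_le ((onb E).tsum_enorm_inner_sq _).le
    ((onb E).tsum_enorm_inner_sq _).le).trans ?_
  gcongr
  refine enorm_le_iff_norm_le.2 (((ContinuousLinearMap.adjoint W).le_opNorm _).trans ?_)
  exact mul_le_of_le_one_left (norm_nonneg _) hWn

/-- A factorization of a trace class operator into two Hilbert–Schmidt operators. -/
lemma exists_nuclear_representation (A : E →L[ℂ] F) :
    ∃ (u : onbIndex E → F) (v : onbIndex E → E),
      (∀ x y, HasSum (fun k => inner ℂ (v k) x * inner ℂ y (u k)) (inner ℂ y (A x))) ∧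
      ∑' k, ‖u k‖ₑ ^ 2 ≤ traceNorm A ∧ ∑' k, ‖v k‖ₑ ^ 2 ≤ traceNorm A := by
  obtain ⟨W, hW, hWA, -⟩ := exists_polar_decomposition A
  let D := CFC.sqrt (operatorModulus A)
  have hD : IsSelfAdjoint D := (CFC.sqrt_nonneg _).isSelfAdjoint
  have hDD : ∀ x, D (D x) = operatorModulus A x := fun x =>
    congrArg (fun B : E →L[ℂ] E => B x)
      (CFC.sqrt_mul_sqrt_self (operatorModulus A) (operatorModulus_nonneg A))
  have hv : ∑' k, ‖D (onb E k)‖ₑ ^ 2 ≤ traceNorm A := by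
    refine ENNReal.tsum_le_tsum fun k => ?_
    rw [← hDD, ← hD.adjoint_eq, ContinuousLinearMap.adjoint_inner_left, hD.adjoint_eq,
      inner_self_eq_norm_sq, ENNReal.ofReal_pow (norm_nonneg _), ofReal_norm]
  -- `A = (W D) D` with `D = |A|^{1/2}`: inserting the basis between the two factors gives these
  -- vectors, and `∑ ‖D e_k‖²` is the trace of `|A|`.
  refine ⟨fun k => W (D (onb E k)), fun k => D (onb E k), fun x y => ?_, ?_, hv⟩
  · have h := (onb E).hasSum_inner_mul_inner
      (ContinuousLinearMap.adjoint D (ContinuousLinearMap.adjoint W y)) (D x)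
    rw [ContinuousLinearMap.adjoint_inner_left, ContinuousLinearMap.adjoint_inner_left, hDD,
      hWA] at h
    refine h.congr_fun fun k => ?_
    rw [ContinuousLinearMap.adjoint_inner_left, ContinuousLinearMap.adjoint_inner_left, mul_comm]
    congr 1
    conv_lhs => rw [← hD.adjoint_eq, ContinuousLinearMap.adjoint_inner_left]
  · refine (ENNReal.tsum_le_tsum fun k => ?_).trans hv
    gcongr
    exact enorm_le_iff_norm_le.2 (hW _)

end TraceNorm

/-! ### Expansions give Schur multipliers. -/

section KernelPairing

variable {S : Type u} {T : Type v} [MeasurableSpace S] [MeasurableSpace T]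
  {μ : Measure S} {ν : Measure T} [SigmaFinite μ] [SigmaFinite ν]

lemma MeasureTheory.MemLp.mul_prod {a : S → ℂ} {c : T → ℂ} (ha : MemLp a 2 μ)
    (hc : MemLp c 2 ν) : MemLp (fun p : S × T => a p.1 * c p.2) 2 (μ.prod ν) := by
  refine (memLp_two_iff_integrable_sq_norm (ha.1.comp_fst.mul hc.1.comp_snd)).2 ?_
  have := ((memLp_two_iff_integrable_sq_norm ha.1).1 ha).mul_prod
    ((memLp_two_iff_integrable_sq_norm hc.1).1 hc)
  simpa [mul_pow] using this

lemma MeasureTheory.MemLp.conj {α : Type*} [MeasurableSpace α] {m : Measure α} {p : ℝ≥0∞}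
    {f : α → ℂ} (hf : MemLp f p m) : MemLp (fun a => starRingEnd ℂ (f a)) p m := hf.star

lemma integrable_kernel_pairing {h : S × T → ℂ} (hh : MemLp h 2 (μ.prod ν)) {y : S → ℂ}
    {x : T → ℂ} (hy : MemLp y 2 μ) (hx : MemLp x 2 ν) :
    Integrable (fun p => h p * (y p.1 * x p.2)) (μ.prod ν) :=
  hh.integrable_mul (hy.mul_prod hx)

lemma inner_integralOperator {h : S × T → ℂ} (hh : MemLp h 2 (μ.prod ν)) (y : Lp ℂ 2 μ)
    (x : Lp ℂ 2 ν) : inner ℂ y (integralOperator h hh x)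
      = ∫ p, h p * (starRingEnd ℂ (y p.1) * x p.2) ∂(μ.prod ν) := by
  rw [integral_prod _ (integrable_kernel_pairing hh (Lp.memLp y).conj (Lp.memLp x)),
    MeasureTheory.L2.inner_def]
  refine integral_congr_ae ?_
  filter_upwards [MemLp.coeFn_toLp (kernelIntegral_memLp hh (Lp.memLp x))] with s hs
  change inner ℂ (y s) ((kernelIntegral_memLp hh (Lp.memLp x)).toLp _ s) = _
  rw [hs, RCLike.inner_apply, kernelIntegral, mul_comm, ← integral_const_mul]
  congr 1 with t
  ring

lemma inner_integralOperator_toLp {h : S × T → ℂ} (hh : MemLp h 2 (μ.prod ν)) {y : S → ℂ}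
    {x : T → ℂ} (hy : MemLp y 2 μ) (hx : MemLp x 2 ν) :
    inner ℂ (hy.toLp y) (integralOperator h hh (hx.toLp x))
      = ∫ p, h p * (starRingEnd ℂ (y p.1) * x p.2) ∂(μ.prod ν) := by
  rw [inner_integralOperator]
  refine integral_congr_ae ?_
  filter_upwards [Measure.quasiMeasurePreserving_fst.ae hy.coeFn_toLp,
    Measure.quasiMeasurePreserving_snd.ae hx.coeFn_toLp] with p h1 h2
  rw [h1, h2]

lemma enorm_toLp_sq {α : Type*} [MeasurableSpace α] {m : Measure α} {f : α → ℂ}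
    (hf : MemLp f 2 m) : ‖hf.toLp f‖ₑ ^ 2 = ∫⁻ a, ‖f a‖ₑ ^ 2 ∂m := by
  rw [Lp.enorm_toLp, eLpNorm_two_sq]

lemma enorm_Lp_sq {α : Type*} [MeasurableSpace α] {m : Measure α} (f : Lp ℂ 2 m) :
    ‖f‖ₑ ^ 2 = ∫⁻ a, ‖f a‖ₑ ^ 2 ∂m := by
  rw [Lp.enorm_def, eLpNorm_two_sq]

/-- `Φ = ∑ φ_n ⊗ ψ_n` almost everywhere, with `∑ |φ_n|² ≤ C` and `∑ |ψ_n|² ≤ C`. -/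
structure IsBoundedExpansion (μ : Measure S) (ν : Measure T) (Φ : S × T → ℂ) (C : ℝ≥0)
    (φ : ℕ → S → ℂ) (ψ : ℕ → T → ℂ) : Prop where
  left_memLp : ∀ n, MemLp (φ n) ∞ μ
  right_memLp : ∀ n, MemLp (ψ n) ∞ ν
  hasSum : ∀ᵐ p ∂(μ.prod ν), HasSum (fun n => φ n p.1 * ψ n p.2) (Φ p)
  left_le : ∀ᵐ s ∂μ, ∑' n, ‖φ n s‖ₑ ^ 2 ≤ C
  right_le : ∀ᵐ t ∂ν, ∑' n, ‖ψ n t‖ₑ ^ 2 ≤ C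

namespace IsBoundedExpansion

variable {Φ : S × T → ℂ} {C : ℝ≥0} {φ : ℕ → S → ℂ} {ψ : ℕ → T → ℂ}

lemma tsum_enorm_le (H : IsBoundedExpansion μ ν Φ C φ ψ) :
    ∀ᵐ p ∂(μ.prod ν), ∑' n, ‖φ n p.1 * ψ n p.2‖ₑ ≤ C := by
  filter_upwards [Measure.quasiMeasurePreserving_fst.ae H.left_le,
    Measure.quasiMeasurePreserving_snd.ae H.right_le] with p h1 h2
  simp only [enorm_mul]
  have key : (C : ℝ≥0∞) = ((NNReal.sqrt C : ℝ≥0) : ℝ≥0∞) ^ 2 := by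
    rw [← ENNReal.coe_pow, NNReal.sq_sqrt]
  refine (ENNReal.tsum_mul_le_of_tsum_sq_le (h1.trans_eq key) (h2.trans_eq key)).trans_eq ?_
  rw [key, sq]

lemma enorm_le (H : IsBoundedExpansion μ ν Φ C φ ψ) : ∀ᵐ p ∂(μ.prod ν), ‖Φ p‖ₑ ≤ C := by
  filter_upwards [H.tsum_enorm_le, H.hasSum] with p h1 h2
  rw [← h2.tsum_eq]
  exact enorm_tsum_le_tsum_enorm.trans h1

lemma aestronglyMeasurable (H : IsBoundedExpansion μ ν Φ C φ ψ) :
    AEStronglyMeasurable Φ (μ.prod ν) := by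
  refine aestronglyMeasurable_of_tendsto_ae Filter.atTop
    (f := fun N p => ∑ n ∈ Finset.range N, φ n p.1 * ψ n p.2) (fun N => ?_) ?_
  · exact Finset.aestronglyMeasurable_fun_sum _ fun n _ =>
      (H.left_memLp n).1.comp_fst.mul (H.right_memLp n).1.comp_snd
  · filter_upwards [H.hasSum] with p hp using hp.tendsto_sum_nat

lemma memLp_top (H : IsBoundedExpansion μ ν Φ C φ ψ) : MemLp Φ ∞ (μ.prod ν) := by
  refine memLp_top_of_bound H.aestronglyMeasurable C ?_
  filter_upwards [H.enorm_le] with p hp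
  rw [← ofReal_norm, ENNReal.ofReal_le_iff_le_toReal ENNReal.coe_ne_top] at hp
  exact hp

lemma memLp_mul (H : IsBoundedExpansion μ ν Φ C φ ψ) {h : S × T → ℂ}
    (hh : MemLp h 2 (μ.prod ν)) : MemLp (fun p => Φ p * h p) 2 (μ.prod ν) :=
  hh.mul (p := ∞) (q := 2) H.memLp_top

/-- Termwise integration of an expansion against an integrable function. -/
lemma hasSum_integral (H : IsBoundedExpansion μ ν Φ C φ ψ) {g : S × T → ℂ}
    (hg : Integrable g (μ.prod ν)) :
    HasSum (fun n => ∫ p, φ n p.1 * ψ n p.2 * g p ∂(μ.prod ν)) (∫ p, Φ p * g p ∂(μ.prod ν)) := by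
  have h0 : ∀ n, AEStronglyMeasurable (fun p : S × T => φ n p.1 * ψ n p.2 * g p) (μ.prod ν) :=
    fun n => ((H.left_memLp n).1.comp_fst.mul (H.right_memLp n).1.comp_snd).mul hg.1
  have h1 : ∑' n, ∫⁻ p, ‖φ n p.1 * ψ n p.2 * g p‖ₑ ∂(μ.prod ν) ≠ ∞ := by
    rw [← lintegral_tsum fun n => (h0 n).enorm]
    refine ((lintegral_mono_ae (g := fun p => C * ‖g p‖ₑ) ?_).trans_lt ?_).ne
    · filter_upwards [H.tsum_enorm_le] with p hp
      simp only [enorm_mul] at hp ⊢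
      rw [ENNReal.tsum_mul_right]
      gcongr
    · rw [lintegral_const_mul' _ _ ENNReal.coe_ne_top]
      exact ENNReal.mul_lt_top ENNReal.coe_lt_top hg.2
  have h2 : ∫ p, Φ p * g p ∂(μ.prod ν) = ∑' n, ∫ p, φ n p.1 * ψ n p.2 * g p ∂(μ.prod ν) := by
    rw [← integral_tsum h0 h1]
    refine integral_congr_ae ?_
    filter_upwards [H.hasSum] with p hp
    exact (hp.mul_right (g p)).tsum_eq.symm
  rw [h2]
  refine Summable.hasSum (Summable.of_norm ?_)
  refine Summable.of_nonneg_of_le (fun _ => norm_nonneg _) (fun n => ?_)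
    (ENNReal.summable_toReal h1)
  rw [← toReal_enorm]
  exact ENNReal.toReal_mono (ENNReal.ne_top_of_tsum_ne_top h1 n)
    (enorm_integral_le_lintegral_enorm _)

end IsBoundedExpansion

/-- The column of multiplications by `φ n` has norm at most `√C`: `∑ ‖φ_n u‖² = ∫ (∑ |φ_n|²) |u|²`.
-/
lemma tsum_tsum_enorm_mul_sq_le {ι : Type*} {φ : ℕ → S → ℂ} (hφ : ∀ n, MemLp (φ n) ∞ μ)
    {C : ℝ≥0} (h : ∀ᵐ s ∂μ, ∑' n, ‖φ n s‖ₑ ^ 2 ≤ C) (u : ι → Lp ℂ 2 μ) :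
    ∑' q : ℕ × ι, ‖((Lp.memLp (u q.2)).mul (p := ∞) (q := 2) (r := 2) (hφ q.1)).toLp _‖ₑ ^ 2
      ≤ C * ∑' k, ‖u k‖ₑ ^ 2 := by
  rw [ENNReal.tsum_prod', ENNReal.tsum_comm, ← ENNReal.tsum_mul_left]
  refine ENNReal.tsum_le_tsum fun k => ?_
  simp only [enorm_toLp_sq]
  rw [← lintegral_tsum fun n =>
      (((Lp.memLp (u k)).mul (p := ∞) (q := 2) (r := 2) (hφ n)).1.enorm.pow_const 2),
    enorm_Lp_sq, ← lintegral_const_mul' _ _ ENNReal.coe_ne_top]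
  refine lintegral_mono_ae ?_
  filter_upwards [h] with s hs
  simp only [Pi.mul_apply, enorm_mul, mul_pow]
  rw [ENNReal.tsum_mul_right]
  gcongr

/-- Formally `I_{Φh} = ∑ M_{φ_n} I_h M_{ψ_n}` with `M` denoting multiplication. Multiplying a
nuclear representation of `I_h` by the factors keeps the square sums under control on each side. -/
lemma IsBoundedExpansion.traceNorm_le {Φ : S × T → ℂ} {C : ℝ≥0} {φ : ℕ → S → ℂ}
    {ψ : ℕ → T → ℂ} (H : IsBoundedExpansion μ ν Φ C φ ψ) {h : S × T → ℂ}
    (hh : MemLp h 2 (μ.prod ν)) (ht : IsTraceClass (integralOperator h hh)) :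
    traceNorm (integralOperator (fun p => Φ p * h p) (H.memLp_mul hh))
      ≤ C * traceNorm (integralOperator h hh) := by
  obtain ⟨u, v, hrep, hu, hv⟩ := exists_nuclear_representation (integralOperator h hh)
  let hψ := fun n => (H.right_memLp n).conj
  have hψle : ∀ᵐ t ∂ν, ∑' n, ‖starRingEnd ℂ (ψ n t)‖ₑ ^ 2 ≤ C := by
    simpa only [RCLike.enorm_conj] using H.right_le
  let u' : ℕ × onbIndex (Lp ℂ 2 ν) → Lp ℂ 2 μ := fun q =>
    ((Lp.memLp (u q.2)).mul (p := ∞) (q := 2) (r := 2) (H.left_memLp q.1)).toLp _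
  let v' : ℕ × onbIndex (Lp ℂ 2 ν) → Lp ℂ 2 ν := fun q =>
    ((Lp.memLp (v q.2)).mul (p := ∞) (q := 2) (r := 2) (hψ q.1)).toLp _
  have hu' : ∑' q, ‖u' q‖ₑ ^ 2 ≤ C * traceNorm (integralOperator h hh) :=
    (tsum_tsum_enorm_mul_sq_le H.left_memLp H.left_le u).trans (by gcongr)
  have hv' : ∑' q, ‖v' q‖ₑ ^ 2 ≤ C * traceNorm (integralOperator h hh) :=
    (tsum_tsum_enorm_mul_sq_le hψ hψle v).trans (by gcongr)
  set τ := C * traceNorm (integralOperator h hh) with hτ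
  have hτsq : τ = (τ ^ (1 / 2 : ℝ)) ^ 2 := by
    rw [← ENNReal.rpow_natCast, ← ENNReal.rpow_mul]; norm_num
  have hle : ∑' q, ‖u' q‖ₑ * ‖v' q‖ₑ ≤ τ := by
    refine (ENNReal.tsum_mul_le_of_tsum_sq_le (hu'.trans_eq hτsq) (hv'.trans_eq hτsq)).trans_eq ?_
    rw [← sq, ← hτsq]
  have hτfin : τ ≠ ∞ := ENNReal.mul_ne_top ENNReal.coe_ne_top ht.ne
  refine (traceNorm_le_tsum (u := u') (v := v') fun x y => ?_).trans hle
  -- Absolute convergence of the double series allows summation over `k` first, for fixed `n`, and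
  -- then over `n` by termwise integration.
  have hsum : Summable fun q => inner ℂ (v' q) x * inner ℂ y (u' q) := by
    refine Summable.of_norm (Summable.of_nonneg_of_le (fun _ => norm_nonneg _) (fun q => ?_)
      ((ENNReal.summable_toReal (ne_top_of_le_ne_top hτfin hle)).mul_left (‖x‖ * ‖y‖)))
    rw [norm_mul, ENNReal.toReal_mul, toReal_enorm, toReal_enorm]
    calc ‖inner ℂ (v' q) x‖ * ‖inner ℂ y (u' q)‖
        ≤ (‖v' q‖ * ‖x‖) * (‖y‖ * ‖u' q‖) := by
          gcongr <;> exact norm_inner_le_norm _ _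
      _ = _ := by ring
  -- For fixed `n` the multipliers move onto the test functions, so the representation of `I_h`
  -- applies to `ψ_n x` and `conj φ_n · y`.
  have hfib : ∀ n, HasSum (fun k => inner ℂ (v' (n, k)) x * inner ℂ y (u' (n, k)))
      (∫ p, φ n p.1 * ψ n p.2 * (h p * (starRingEnd ℂ (y p.1) * x p.2)) ∂(μ.prod ν)) := by
    intro n
    have hx' := (Lp.memLp x).mul (p := ∞) (q := 2) (r := 2) (H.right_memLp n)
    have hy' := (Lp.memLp y).mul (p := ∞) (q := 2) (r := 2) (H.left_memLp n).conj
    have h1 := hrep (hx'.toLp _) (hy'.toLp _)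
    rw [inner_integralOperator_toLp] at h1
    convert h1 using 1
    · ext k
      congr 1
      · rw [L2.inner_def, L2.inner_def]
        refine integral_congr_ae ?_
        filter_upwards [hx'.coeFn_toLp, MemLp.coeFn_toLp
          ((Lp.memLp (v k)).mul (p := ∞) (q := 2) (r := 2) (hψ n))] with t h2 h3
        change inner ℂ (MemLp.toLp _ _ t) _ = _
        rw [h2, h3]
        simp only [RCLike.inner_apply, Pi.mul_apply, map_mul, RCLike.conj_conj]
        ring
      · rw [L2.inner_def, L2.inner_def]
        refine integral_congr_ae ?_
        filter_upwards [hy'.coeFn_toLp, MemLp.coeFn_toLp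
          ((Lp.memLp (u k)).mul (p := ∞) (q := 2) (r := 2) (H.left_memLp n))] with t h2 h3
        change inner ℂ _ (MemLp.toLp _ _ t) = _
        rw [h2, h3]
        simp only [RCLike.inner_apply, Pi.mul_apply, map_mul, RCLike.conj_conj]
        ring
    · congr 1 with p
      simp only [Pi.mul_apply, map_mul, RCLike.conj_conj]
      ring
  have h1 := hsum.hasSum.prod_fiberwise hfib
  have h2 := H.hasSum_integral
    (integrable_kernel_pairing hh (Lp.memLp y).conj (Lp.memLp x))
  have h3 : inner ℂ y (integralOperator (fun p => Φ p * h p) (H.memLp_mul hh) x)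
      = ∫ p, Φ p * (h p * (starRingEnd ℂ (y p.1) * x p.2)) ∂(μ.prod ν) := by
    rw [inner_integralOperator]
    simp only [mul_assoc]
  rw [h3, h2.unique h1]
  exact hsum.hasSum

lemma IsBoundedExpansion.isSchurBound {Φ : S × T → ℂ} {C : ℝ≥0} {φ : ℕ → S → ℂ}
    {ψ : ℕ → T → ℂ} (H : IsBoundedExpansion μ ν Φ C φ ψ) : IsSchurBound μ ν Φ C :=
  fun _ hh ht => ⟨H.memLp_mul hh, H.traceNorm_le hh ht⟩

lemma IsBoundedExpansion.isSchurMultiplier {Φ : S × T → ℂ} {C : ℝ≥0} {φ : ℕ → S → ℂ}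
    {ψ : ℕ → T → ℂ} (H : IsBoundedExpansion μ ν Φ C φ ψ) : IsSchurMultiplier μ ν Φ :=
  ⟨H.aestronglyMeasurable, fun _ hh ht => ⟨H.memLp_mul hh,
    (H.traceNorm_le hh ht).trans_lt (ENNReal.mul_lt_top ENNReal.coe_lt_top ht)⟩⟩

end KernelPairing

/-! ### Factorization of finite matrices by Hahn–Banach. -/

section FiniteFactorization

open scoped MatrixOrder ComplexOrder in
-- A Gram matrix is positive semidefinite, hence of the form `B* B`, and the columns of `B` serve.
-- Vectors from any Hilbert space can thus be moved to one fixed finite-dimensional space, where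
-- compactness is available.
lemma exists_euclidean_gram {n : Type*} [Fintype n] {H : Type*} [NormedAddCommGroup H]
    [InnerProductSpace ℂ H] (z : n → H) :
    ∃ w : n → EuclideanSpace ℂ n, ∀ p q, inner ℂ (w p) (w q) = inner ℂ (z p) (z q) := by
  classical
  obtain ⟨B, hB⟩ := CStarAlgebra.nonneg_iff_eq_star_mul_self.mp
    (Matrix.posSemidef_gram ℂ z).nonneg
  refine ⟨fun p => WithLp.toLp 2 fun r => B r p, fun p q => ?_⟩
  rw [← Matrix.gram_apply (𝕜 := ℂ) z, hB, PiLp.inner_apply, Matrix.mul_apply]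
  refine Finset.sum_congr rfl fun r _ => ?_
  simp [mul_comm]

variable {ι κ : Type*} [Fintype ι] [Fintype κ]

variable (ι κ) in
/-- The cone of pairs `(u, Ψ)` such that `Ψ i j = ⟪w j, w i⟫` for vectors with `‖w p‖² ≤ u p`. -/
def gramCone : Set ((ι ⊕ κ → ℝ) × (ι → κ → ℂ)) :=
  {z | ∃ w : ι ⊕ κ → EuclideanSpace ℂ (ι ⊕ κ), (∀ p, ‖w p‖ ^ 2 ≤ z.1 p) ∧
    ∀ i j, inner ℂ (w (.inr j)) (w (.inl i)) = z.2 i j}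

lemma mem_gramCone {H : Type*} [NormedAddCommGroup H] [InnerProductSpace ℂ H]
    {z : (ι ⊕ κ → ℝ) × (ι → κ → ℂ)} (w : ι ⊕ κ → H) (h1 : ∀ p, ‖w p‖ ^ 2 ≤ z.1 p)
    (h2 : ∀ i j, inner ℂ (w (.inr j)) (w (.inl i)) = z.2 i j) : z ∈ gramCone ι κ := by
  obtain ⟨w', hw'⟩ := exists_euclidean_gram w
  refine ⟨w', fun p => ?_, fun i j => by rw [hw', h2]⟩
  rw [← inner_self_eq_norm_sq (𝕜 := ℂ), hw', inner_self_eq_norm_sq]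
  exact h1 p

lemma add_mem_gramCone {z z' : (ι ⊕ κ → ℝ) × (ι → κ → ℂ)} (hz : z ∈ gramCone ι κ)
    (hz' : z' ∈ gramCone ι κ) : z + z' ∈ gramCone ι κ := by
  obtain ⟨w, h1, h2⟩ := hz
  obtain ⟨w', h1', h2'⟩ := hz'
  refine mem_gramCone (fun p => WithLp.toLp 2 (w p, w' p)) (fun p => ?_) fun i j => ?_
  · rw [WithLp.prod_norm_sq_eq_of_L2]
    exact add_le_add (h1 p) (h1' p)
  · rw [WithLp.prod_inner_apply]
    exact congrArg₂ (· + ·) (h2 i j) (h2' i j)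

lemma smul_mem_gramCone {z : (ι ⊕ κ → ℝ) × (ι → κ → ℂ)} (hz : z ∈ gramCone ι κ) {t : ℝ}
    (ht : 0 ≤ t) : t • z ∈ gramCone ι κ := by
  obtain ⟨w, h1, h2⟩ := hz
  refine ⟨fun p => ((√t : ℝ) : ℂ) • w p, fun p => ?_, fun i j => ?_⟩
  · rw [norm_smul, mul_pow, Complex.norm_real, Real.norm_eq_abs, sq_abs, Real.sq_sqrt ht]
    exact mul_le_mul_of_nonneg_left (h1 p) ht
  · rw [inner_smul_left, inner_smul_right, h2, Complex.conj_ofReal, ← mul_assoc,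
      ← Complex.ofReal_mul, Real.mul_self_sqrt ht]
    simp

lemma convex_gramCone : Convex ℝ (gramCone ι κ) := fun _ hz _ hz' _ _ ha hb _ =>
  add_mem_gramCone (smul_mem_gramCone hz ha) (smul_mem_gramCone hz' hb)

/-- The first component bounds the lengths of the vectors, so along a convergent sequence they have
a convergent subsequence. -/
lemma isClosed_gramCone : IsClosed (gramCone ι κ) := by
  refine IsSeqClosed.isClosed fun z z₀ hz hlim => ?_
  choose w h1 h2 using hz
  have hlim1 := (Prod.tendsto_iff _ _).1 hlim |>.1
  have hlim2 := (Prod.tendsto_iff _ _).1 hlim |>.2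
  obtain ⟨K, hK⟩ := (Metric.isBounded_range_of_tendsto _ hlim1).exists_norm_le
  have hb : ∀ n, w n ∈ Metric.closedBall (0 : ι ⊕ κ → EuclideanSpace ℂ (ι ⊕ κ)) √K := by
    intro n
    rw [mem_closedBall_zero_iff, pi_norm_le_iff_of_nonneg (Real.sqrt_nonneg _)]
    intro p
    refine Real.le_sqrt_of_sq_le ((h1 n p).trans ((le_abs_self _).trans ?_))
    exact (norm_le_pi_norm (z n).1 p).trans (hK _ ⟨n, rfl⟩)
  obtain ⟨w₀, -, σ, hσ, hw₀⟩ := (isCompact_closedBall _ _).tendsto_subseq hb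
  have hp : ∀ p, Filter.Tendsto (fun n => w (σ n) p) Filter.atTop (nhds (w₀ p)) :=
    tendsto_pi_nhds.1 hw₀
  refine ⟨w₀, fun p => ?_, fun i j => ?_⟩
  · exact le_of_tendsto_of_tendsto' ((hp p).norm.pow 2)
      ((tendsto_pi_nhds.1 hlim1 p).comp hσ.tendsto_atTop) fun n => h1 (σ n) p
  · refine tendsto_nhds_unique ((hp (.inr j)).inner (hp (.inl i))) ?_
    simp only [h2]
    exact (tendsto_pi_nhds.1 (tendsto_pi_nhds.1 hlim2 i) j).comp hσ.tendsto_atTop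

/-- The minus sign is chosen so that nonnegativity on the cone reads as an upper bound for the
bilinear form of `k` by the quadratic form of `d`. -/
lemma exists_dual_coefficients [DecidableEq ι] [DecidableEq κ]
    (f : StrongDual ℝ ((ι ⊕ κ → ℝ) × (ι → κ → ℂ))) :
    ∃ (d : ι ⊕ κ → ℝ) (k : ι → κ → ℂ), ∀ z, f z = ∑ p, d p * z.1 p
      - (∑ i, ∑ j, k i j * z.2 i j).re := by
  let E : ι → κ → ℂ → (ι → κ → ℂ) := fun i j a => Pi.single i (Pi.single j a)
  refine ⟨fun p => f (Pi.single p 1, 0),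
    fun i j => -(f (0, E i j 1) - Complex.I * f (0, E i j Complex.I)), fun z => ?_⟩
  have h1 : z = ∑ p, z.1 p • ((Pi.single p 1 : ι ⊕ κ → ℝ), (0 : ι → κ → ℂ)) +
      ∑ i, ∑ j, ((z.2 i j).re • ((0 : ι ⊕ κ → ℝ), E i j 1) +
        (z.2 i j).im • ((0 : ι ⊕ κ → ℝ), E i j Complex.I)) := by
    refine Prod.ext ?_ ?_
    · ext p
      simp [Prod.fst_sum, Finset.sum_apply, Pi.single_apply, -Fintype.sum_sum_type]
    · ext i j
      simp only [Prod.snd_add, Prod.snd_sum, Prod.smul_snd, smul_zero, Finset.sum_const_zero,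
        Finset.sum_apply, Pi.add_apply, Pi.smul_apply, E]
      rw [Finset.sum_eq_single i (fun b _ hb => by simp [hb.symm]) (by simp),
        Finset.sum_eq_single j (fun b _ hb => by simp [hb.symm]) (by simp)]
      simp [Complex.re_add_im]
  conv_lhs => rw [h1]
  simp only [map_add, map_sum, map_smul, smul_eq_mul, Complex.re_sum]
  rw [sub_eq_add_neg, ← Finset.sum_neg_distrib]
  congr 1
  · exact Finset.sum_congr rfl fun p _ => mul_comm _ _
  · refine Finset.sum_congr rfl fun i _ => ?_
    rw [← Finset.sum_neg_distrib]
    refine Finset.sum_congr rfl fun j _ => ?_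
    simp
    ring

/-- Factorization of a finite matrix through a Hilbert space, by duality. -/
lemma exists_finite_factorization (Φ : ι → κ → ℂ) {C : ℝ}
    (hyp : ∀ (d : ι ⊕ κ → ℝ) (k : ι → κ → ℂ), (∀ p, 0 < d p) →
      (∀ (ξ : ι → ℂ) (η : κ → ℂ), (∑ i, ∑ j, k i j * (ξ i * η j)).re
        ≤ ∑ i, d (.inl i) * ‖ξ i‖ ^ 2 + ∑ j, d (.inr j) * ‖η j‖ ^ 2) →
      (∑ i, ∑ j, k i j * Φ i j).re ≤ C * ∑ p, d p) :
    ∃ w : ι ⊕ κ → EuclideanSpace ℂ (ι ⊕ κ), (∀ p, ‖w p‖ ^ 2 ≤ C) ∧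
      ∀ i j, inner ℂ (w (.inr j)) (w (.inl i)) = Φ i j := by
  classical
  by_contra hcon
  have hnot : ((fun _ => C, Φ) : (ι ⊕ κ → ℝ) × (ι → κ → ℂ)) ∉ gramCone ι κ := hcon
  obtain ⟨f, r, hr, hf⟩ := geometric_hahn_banach_point_closed convex_gramCone isClosed_gramCone hnot
  have h0 : r < 0 := by
    have := hf 0 (mem_gramCone (fun _ => (0 : ℂ)) (by simp) (by simp))
    simpa using this
  -- A functional bounded below on a cone is nonnegative there: a negative value could be rescaled
  -- to equal `r`.
  have hpos : ∀ z ∈ gramCone ι κ, 0 ≤ f z := by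
    intro z hz
    by_contra! hneg
    have := hf _ (smul_mem_gramCone hz (t := r / f z) (div_nonneg_of_nonpos h0.le hneg.le))
    rw [map_smul, smul_eq_mul, div_mul_cancel₀ _ hneg.ne] at this
    exact lt_irrefl _ this
  obtain ⟨d, k, hdk⟩ := exists_dual_coefficients f
  have hd : ∀ p, 0 ≤ d p := by
    intro p
    have := hpos (Pi.single p 1, 0) (mem_gramCone (fun _ => (0 : ℂ))
      (fun q => by simp only [norm_zero]; rw [Pi.single_apply]; split_ifs <;> simp) (by simp))
    rw [hdk] at this
    simpa [Pi.single_apply] using this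
  have hk : ∀ (ξ : ι → ℂ) (η : κ → ℂ), (∑ i, ∑ j, k i j * (ξ i * η j)).re
        ≤ ∑ i, d (.inl i) * ‖ξ i‖ ^ 2 + ∑ j, d (.inr j) * ‖η j‖ ^ 2 := by
    -- Scalar vectors, that is rank one elements of the cone, already give the inequality required
    -- of `k` and `d`.
    intro ξ η
    have := hpos (Sum.elim (fun i => ‖ξ i‖ ^ 2) (fun j => ‖η j‖ ^ 2), fun i j => ξ i * η j)
      (mem_gramCone (Sum.elim ξ fun j => starRingEnd ℂ (η j)) (by rintro (i | j) <;> simp)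
        (fun i j => by simp))
    rw [hdk] at this
    simpa [Fintype.sum_sum_type] using this
  have hstrict : C * ∑ p, d p < (∑ i, ∑ j, k i j * Φ i j).re := by
    rw [hdk] at hr
    have h1 : ∑ p, d p * C = C * ∑ p, d p := by rw [← Finset.sum_mul, mul_comm]
    simp only [h1] at hr
    linarith
  -- Separation yields only `d ≥ 0`, while `hyp` needs strict positivity because its users divide by
  -- `√(d p)`; hence the perturbation by `ε`.
  have hε : ∀ ε > 0, (∑ i, ∑ j, k i j * Φ i j).re ≤ C * ∑ p, (d p + ε) := by
    intro ε hε
    refine hyp (fun p => d p + ε) k (fun p => by have := hd p; positivity) fun ξ η => ?_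
    refine (hk ξ η).trans ?_
    gcongr <;> linarith
  have hlim : Filter.Tendsto (fun ε : ℝ => C * ∑ p, (d p + ε)) (nhdsWithin 0 (Set.Ioi 0))
      (nhds (C * ∑ p, d p)) := by
    have : Continuous fun ε : ℝ => C * ∑ p, (d p + ε) := by fun_prop
    have h2 := this.tendsto 0
    simp only [add_zero] at h2
    exact h2.mono_left nhdsWithin_le_nhds
  exact hstrict.not_ge (ge_of_tendsto hlim (eventually_mem_nhdsWithin.mono hε))

end FiniteFactorization

/-! ### Testing on rank one kernels, and automatic boundedness. -/

section BilinearBound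

lemma exists_bilinear_bound_of_pointwise {ι E F : Type*} [NormedAddCommGroup E] [NormedSpace ℂ E]
    [CompleteSpace E] [NormedAddCommGroup F] [NormedSpace ℂ F] [CompleteSpace F]
    (g : ι → E →L[ℂ] F →L[ℂ] ℂ) (h : ∀ x y, ∃ C, ∀ i, ‖g i x y‖ ≤ C) :
    ∃ C : ℝ≥0, ∀ i x y, ‖g i x y‖ ≤ C * ‖x‖ * ‖y‖ := by
  obtain ⟨C, hC⟩ := banach_steinhaus (g := g) fun x => banach_steinhaus (h x)
  refine ⟨C.toNNReal, fun i x y => ((g i).le_opNorm₂ x y).trans ?_⟩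
  gcongr
  exact (hC i).trans (Real.le_coe_toNNReal C)

variable {S : Type u} {T : Type v} [MeasurableSpace S] [MeasurableSpace T]
  {μ : Measure S} {ν : Measure T} [SigmaFinite μ] [SigmaFinite ν]

lemma exists_bilinear_of_kernel {k : S × T → ℂ} {K : ℝ}
    (hint : ∀ (a : Lp ℂ 2 μ) (c : Lp ℂ 2 ν),
      Integrable (fun p => k p * (a p.1 * c p.2)) (μ.prod ν))
    (hK : ∀ (a : Lp ℂ 2 μ) (c : Lp ℂ 2 ν),
      ‖∫ p, k p * (a p.1 * c p.2) ∂(μ.prod ν)‖ ≤ K * ‖a‖ * ‖c‖) :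
    ∃ B : Lp ℂ 2 μ →L[ℂ] Lp ℂ 2 ν →L[ℂ] ℂ, ∀ a c,
      B a c = ∫ p, k p * (a p.1 * c p.2) ∂(μ.prod ν) := by
  refine ⟨LinearMap.mkContinuous₂ (LinearMap.mk₂ ℂ
    (fun a c => ∫ p, k p * (a p.1 * c p.2) ∂(μ.prod ν)) ?_ ?_ ?_ ?_) K hK, fun a c => rfl⟩
  · intro a a' c
    rw [← integral_add (hint a c) (hint a' c)]
    refine integral_congr_ae ?_
    filter_upwards [Measure.quasiMeasurePreserving_fst.ae (Lp.coeFn_add a a')] with p hp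
    rw [hp, Pi.add_apply]
    ring
  · intro r a c
    rw [smul_eq_mul, ← integral_const_mul]
    refine integral_congr_ae ?_
    filter_upwards [Measure.quasiMeasurePreserving_fst.ae (Lp.coeFn_smul r a)] with p hp
    rw [hp, Pi.smul_apply, smul_eq_mul]
    ring
  · intro a c c'
    rw [← integral_add (hint a c) (hint a c')]
    refine integral_congr_ae ?_
    filter_upwards [Measure.quasiMeasurePreserving_snd.ae (Lp.coeFn_add c c')] with p hp
    rw [hp, Pi.add_apply]
    ring
  · intro r a c
    rw [smul_eq_mul, ← integral_const_mul]
    refine integral_congr_ae ?_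
    filter_upwards [Measure.quasiMeasurePreserving_snd.ae (Lp.coeFn_smul r c)] with p hp
    rw [hp, Pi.smul_apply, smul_eq_mul]
    ring

lemma norm_integral_mul_le {α : Type*} [MeasurableSpace α] {m : Measure α} {f g : α → ℂ}
    (hf : MemLp f 2 m) (hg : MemLp g 2 m) :
    ‖∫ a, f a * g a ∂m‖ ≤ (eLpNorm f 2 m).toReal * (eLpNorm g 2 m).toReal := by
  have h : inner ℂ (hf.conj.toLp _) (hg.toLp g) = ∫ a, f a * g a ∂m := by
    rw [L2.inner_def]
    refine integral_congr_ae ?_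
    filter_upwards [hf.conj.coeFn_toLp, hg.coeFn_toLp] with a h1 h2
    rw [h1, h2, RCLike.inner_apply, RCLike.conj_conj, mul_comm]
  rw [← h]
  refine (norm_inner_le_norm _ _).trans_eq ?_
  rw [Lp.norm_toLp, Lp.norm_toLp, show eLpNorm (fun a => starRingEnd ℂ (f a)) 2 m = eLpNorm f 2 m
    from eLpNorm_congr_norm_ae (.of_forall fun a => RCLike.norm_conj _)]

lemma eLpNorm_mul_prod {a : S → ℂ} {c : T → ℂ} (ha : MemLp a 2 μ) (hc : MemLp c 2 ν) :
    eLpNorm (fun p : S × T => a p.1 * c p.2) 2 (μ.prod ν) = eLpNorm a 2 μ * eLpNorm c 2 ν := by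
  refine (ENNReal.pow_right_strictMono two_ne_zero).injective ?_
  rw [mul_pow, eLpNorm_two_sq, eLpNorm_two_sq,
    eLpNorm_two_sq]
  simp only [enorm_mul, mul_pow]
  exact lintegral_prod_mul (ha.1.enorm.pow_const 2) (hc.1.enorm.pow_const 2)

lemma traceNorm_mul_prod_le {a : S → ℂ} {c : T → ℂ} (ha : MemLp a 2 μ) (hc : MemLp c 2 ν) :
    traceNorm (integralOperator (fun p : S × T => a p.1 * c p.2) (ha.mul_prod hc))
      ≤ eLpNorm a 2 μ * eLpNorm c 2 ν := by
  have h := traceNorm_le_tsum (ι := Unit) (u := fun _ => ha.toLp a)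
    (v := fun _ => hc.conj.toLp _)
    (A := integralOperator (fun p : S × T => a p.1 * c p.2) (ha.mul_prod hc)) fun x y => by
      convert hasSum_fintype _ using 1
      rw [inner_integralOperator, Fintype.sum_unique, L2.inner_def, L2.inner_def, mul_comm,
        ← integral_prod_mul]
      refine integral_congr_ae ?_
      filter_upwards [Measure.quasiMeasurePreserving_fst.ae ha.coeFn_toLp,
        Measure.quasiMeasurePreserving_snd.ae hc.conj.coeFn_toLp] with p h1 h2
      rw [h1, h2, RCLike.inner_apply, RCLike.inner_apply, RCLike.conj_conj]
      ring
  refine h.trans_eq ?_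
  rw [tsum_fintype, Fintype.sum_unique, Lp.enorm_toLp, Lp.enorm_toLp]
  congr 1
  exact eLpNorm_congr_norm_ae (.of_forall fun t => RCLike.norm_conj _)

/-- Square integrable kernels whose pairing with trace class integral operators is bounded by
the trace norm. -/
def contractiveKernels (μ : Measure S) (ν : Measure T) [SigmaFinite μ] [SigmaFinite ν] :
    Set (S × T → ℂ) :=
  {b | MemLp b 2 (μ.prod ν) ∧ ∀ (g : S × T → ℂ) (hg : MemLp g 2 (μ.prod ν)),
    ‖∫ p, g p * b p ∂(μ.prod ν)‖ₑ ≤ traceNorm (integralOperator g hg)}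

/-- The restriction of the Schur multiplier inequality to rank one kernels, in dual form. -/
def HasBilinearBound (μ : Measure S) (ν : Measure T) [SigmaFinite μ] [SigmaFinite ν]
    (Φ : S × T → ℂ) (C : ℝ≥0) : Prop :=
  ∀ (a : S → ℂ) (c : T → ℂ), MemLp a 2 μ → MemLp c 2 ν →
    MemLp (fun p => Φ p * (a p.1 * c p.2)) 2 (μ.prod ν) ∧
    ∀ b ∈ contractiveKernels μ ν, ‖∫ p, Φ p * (a p.1 * c p.2) * b p ∂(μ.prod ν)‖ₑ
      ≤ C * (eLpNorm a 2 μ * eLpNorm c 2 ν)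

lemma IsSchurBound.hasBilinearBound {Φ : S × T → ℂ} {C : ℝ≥0} (h : IsSchurBound μ ν Φ C) :
    HasBilinearBound μ ν Φ C := by
  intro a c ha hc
  have h1 := traceNorm_mul_prod_le ha hc
  obtain ⟨hΦ, hle⟩ := h _ (ha.mul_prod hc) (h1.trans_lt (ENNReal.mul_lt_top ha.2 hc.2))
  refine ⟨hΦ, fun b hb => (hb.2 _ hΦ).trans (hle.trans ?_)⟩
  gcongr

lemma IsSchurMultiplier.memLp_mul_prod {Φ : S × T → ℂ} (h : IsSchurMultiplier μ ν Φ)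
    {a : S → ℂ} {c : T → ℂ} (ha : MemLp a 2 μ) (hc : MemLp c 2 ν) :
    ∃ hΦ : MemLp (fun p => Φ p * (a p.1 * c p.2)) 2 (μ.prod ν),
      IsTraceClass (integralOperator _ hΦ) :=
  h.2 _ (ha.mul_prod hc)
    ((traceNorm_mul_prod_le ha hc).trans_lt (ENNReal.mul_lt_top ha.2 hc.2))

/-- A bounded continuous approximation of the identity function. -/
noncomputable def truncation (n : ℕ) (z : ℂ) : ℂ := z * (((1 + ‖z‖ / (n + 1))⁻¹ : ℝ) : ℂ)

lemma continuous_truncation (n : ℕ) : Continuous (truncation n) := by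
  unfold truncation
  refine continuous_id.mul (Complex.continuous_ofReal.comp (Continuous.inv₀ (by fun_prop) ?_))
  intro z
  positivity

lemma norm_truncation (n : ℕ) (z : ℂ) : ‖truncation n z‖ = ‖z‖ * (1 + ‖z‖ / (n + 1))⁻¹ := by
  rw [truncation, norm_mul, Complex.norm_real, Real.norm_of_nonneg (by positivity)]

lemma norm_truncation_le_norm (n : ℕ) (z : ℂ) : ‖truncation n z‖ ≤ ‖z‖ := by
  rw [norm_truncation]
  refine mul_le_of_le_one_right (norm_nonneg _) (inv_le_one_of_one_le₀ ?_)
  have : 0 ≤ ‖z‖ / (n + 1) := by positivity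
  linarith

lemma norm_truncation_le (n : ℕ) (z : ℂ) : ‖truncation n z‖ ≤ n + 1 := by
  rw [norm_truncation, ← div_eq_mul_inv, div_le_iff₀ (by positivity)]
  have : (n + 1 : ℝ) * (‖z‖ / (n + 1)) = ‖z‖ := by field_simp
  have h2 : (0 : ℝ) ≤ n := n.cast_nonneg
  linarith

lemma tendsto_truncation (z : ℂ) :
    Filter.Tendsto (fun n => truncation n z) Filter.atTop (nhds z) := by
  have h1 : Filter.Tendsto (fun n : ℕ => (1 + ‖z‖ / ((n : ℝ) + 1))⁻¹) Filter.atTop (nhds 1) := by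
    have := (tendsto_one_div_add_atTop_nhds_zero_nat (𝕜 := ℝ)).const_mul ‖z‖ |>.const_add 1
    simpa [div_eq_mul_inv] using this.inv₀ (by simp)
  simpa [truncation, Function.comp_def] using ((Complex.continuous_ofReal.tendsto _).comp h1).const_mul z

/-- `Φ` may be unbounded a priori, so continuity of the form is not immediate. Truncating `Φ` gives
continuous forms that are pointwise bounded by `∫ |Φ b (a ⊗ c)|`; Banach–Steinhaus makes the bound
uniform, and dominated convergence removes the truncation. -/
lemma IsSchurMultiplier.exists_bilinear {Φ : S × T → ℂ} (h : IsSchurMultiplier μ ν Φ)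
    {b : S × T → ℂ} (hb : MemLp b 2 (μ.prod ν)) :
    ∃ B : Lp ℂ 2 μ →L[ℂ] Lp ℂ 2 ν →L[ℂ] ℂ, ∀ a c,
      B a c = ∫ p, Φ p * b p * (a p.1 * c p.2) ∂(μ.prod ν) := by
  have hint : ∀ (a : Lp ℂ 2 μ) (c : Lp ℂ 2 ν),
      Integrable (fun p => Φ p * b p * (a p.1 * c p.2)) (μ.prod ν) := by
    intro a c
    obtain ⟨h1, -⟩ := h.memLp_mul_prod (Lp.memLp a) (Lp.memLp c)
    refine (h1.integrable_mul hb).congr (.of_forall fun p => ?_)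
    simp only [Pi.mul_apply]
    ring
  have hmeas : ∀ n, AEStronglyMeasurable (fun p => truncation n (Φ p) * b p) (μ.prod ν) :=
    fun n => ((continuous_truncation n).comp_aestronglyMeasurable h.1).mul hb.1
  have hk : ∀ n, MemLp (fun p => truncation n (Φ p) * b p) 2 (μ.prod ν) := fun n =>
    hb.of_le_mul (hmeas n) (.of_forall fun p => by
      rw [norm_mul]; gcongr; exact norm_truncation_le n (Φ p))
  have hint' : ∀ n (a : Lp ℂ 2 μ) (c : Lp ℂ 2 ν),
      Integrable (fun p => truncation n (Φ p) * b p * (a p.1 * c p.2)) (μ.prod ν) := fun n a c =>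
    integrable_kernel_pairing (hk n) (Lp.memLp a) (Lp.memLp c)
  choose B hB using fun n => exists_bilinear_of_kernel (hint' n) (fun a c => by
    refine (norm_integral_mul_le (hk n) ((Lp.memLp a).mul_prod (Lp.memLp c))).trans_eq ?_
    rw [eLpNorm_mul_prod (Lp.memLp a) (Lp.memLp c), ENNReal.toReal_mul, ← Lp.norm_def,
      ← Lp.norm_def, ← mul_assoc])
  obtain ⟨C, hC⟩ := exists_bilinear_bound_of_pointwise B fun a c => by
    refine ⟨∫ p, ‖Φ p * b p * (a p.1 * c p.2)‖ ∂(μ.prod ν), fun n => ?_⟩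
    rw [hB]
    refine (norm_integral_le_integral_norm _).trans
      (integral_mono (hint' n a c).norm (hint a c).norm fun p => ?_)
    simp only [norm_mul]
    gcongr
    exact norm_truncation_le_norm n (Φ p)
  refine exists_bilinear_of_kernel (K := C) hint fun a c => ?_
  refine le_of_tendsto (f := fun n => ‖B n a c‖) (x := Filter.atTop) ?_
    (.of_forall fun n => hC n a c)
  simp only [hB]
  refine (tendsto_integral_of_dominated_convergence
    (fun p => ‖Φ p * b p * (a p.1 * c p.2)‖) (fun n => (hint' n a c).1) (hint a c).norm
    (fun n => .of_forall fun p => ?_) (.of_forall fun p => ?_)).norm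
  · simp only [norm_mul]
    gcongr
    exact norm_truncation_le_norm n (Φ p)
  · exact ((tendsto_truncation (Φ p)).mul_const (b p)).mul_const _

/-- A Schur multiplier is automatically bounded on rank one kernels. -/
lemma IsSchurMultiplier.exists_hasBilinearBound {Φ : S × T → ℂ} (h : IsSchurMultiplier μ ν Φ) :
    ∃ C : ℝ≥0, HasBilinearBound μ ν Φ C := by
  choose B hB using fun b : contractiveKernels μ ν => h.exists_bilinear b.2.1
  have hB' : ∀ (b : contractiveKernels μ ν) (a : Lp ℂ 2 μ) (c : Lp ℂ 2 ν),
      B b a c = ∫ p, Φ p * (a p.1 * c p.2) * b.1 p ∂(μ.prod ν) := fun b a c => by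
    rw [hB]
    congr 1 with p
    ring
  -- A second use of Banach–Steinhaus, now over all contractive kernels `b`: for fixed `a`, `c` the
  -- trace norm of `I_{Φ(a⊗c)}` bounds every pairing.
  obtain ⟨C, hC⟩ := exists_bilinear_bound_of_pointwise B fun a c => by
    obtain ⟨hΦ, ht⟩ := h.memLp_mul_prod (Lp.memLp a) (Lp.memLp c)
    refine ⟨(traceNorm (integralOperator _ hΦ)).toReal, fun b => ?_⟩
    rw [hB', ← toReal_enorm]
    exact ENNReal.toReal_mono ht.ne (b.2.2 _ hΦ)
  refine ⟨C, fun a c ha hc => ⟨(h.memLp_mul_prod ha hc).1, fun b hb => ?_⟩⟩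
  have h1 := hC ⟨b, hb⟩ (ha.toLp a) (hc.toLp c)
  have h2 : ∫ p, Φ p * (ha.toLp a p.1 * hc.toLp c p.2) * b p ∂(μ.prod ν)
      = ∫ p, Φ p * (a p.1 * c p.2) * b p ∂(μ.prod ν) := by
    refine integral_congr_ae ?_
    filter_upwards [Measure.quasiMeasurePreserving_fst.ae ha.coeFn_toLp,
      Measure.quasiMeasurePreserving_snd.ae hc.coeFn_toLp] with p h1 h2
    rw [h1, h2]
  rw [hB', h2, Lp.norm_toLp, Lp.norm_toLp] at h1
  rw [← ofReal_norm, ENNReal.ofReal_le_iff_le_toReal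
    (ENNReal.mul_ne_top ENNReal.coe_ne_top (ENNReal.mul_ne_top ha.2.ne hc.2.ne))]
  rwa [ENNReal.toReal_mul, ENNReal.toReal_mul, ENNReal.coe_toReal, ← mul_assoc]

end BilinearBound

/-! ### Averages over finite grids. -/

section StepFactorization

section Orthogonal

variable {E : Type*} [NormedAddCommGroup E] [InnerProductSpace ℂ E] {ι : Type*} [Fintype ι]
  {e : ι → E}

/-- Norms at most one, rather than equal to one, leave room for the zero vectors coming from null
cells of a grid. -/
lemma norm_sum_smul_sq_le (horth : Pairwise fun i j => inner ℂ (e i) (e j) = 0)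
    (hnorm : ∀ i, ‖e i‖ ≤ 1) (z : ι → ℂ) : ‖∑ i, z i • e i‖ ^ 2 ≤ ∑ i, ‖z i‖ ^ 2 := by
  rw [← inner_self_eq_norm_sq (𝕜 := ℂ), inner_sum, map_sum]
  refine Finset.sum_le_sum fun i _ => ?_
  rw [sum_inner, Finset.sum_eq_single i (fun j _ hj => by
    rw [inner_smul_left, inner_smul_right, horth hj]; simp) (by simp), inner_self_eq_norm_sq,
    norm_smul, mul_pow]
  exact mul_le_of_le_one_right (sq_nonneg _) (pow_le_one₀ (norm_nonneg _) (hnorm i))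

lemma sum_norm_inner_sq_le (horth : Pairwise fun i j => inner ℂ (e i) (e j) = 0)
    (hnorm : ∀ i, ‖e i‖ ≤ 1) (x : E) : ∑ i, ‖inner ℂ (e i) x‖ ^ 2 ≤ ‖x‖ ^ 2 := by
  set s := ∑ i, ‖inner ℂ (e i) x‖ ^ 2 with hs
  have h1 := norm_sum_smul_sq_le horth hnorm fun i => inner ℂ (e i) x
  have h2 : inner ℂ (∑ i, (inner ℂ (e i) x : ℂ) • e i) x = (s : ℂ) := by
    rw [sum_inner, hs, Complex.ofReal_sum]
    refine Finset.sum_congr rfl fun i _ => ?_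
    rw [inner_smul_left, Complex.conj_mul']
    simp
  have h3 : s ≤ ‖∑ i, (inner ℂ (e i) x : ℂ) • e i‖ * ‖x‖ := by
    have := norm_inner_le_norm (𝕜 := ℂ) (∑ i, (inner ℂ (e i) x : ℂ) • e i) x
    rw [h2, Complex.norm_real] at this
    exact (le_abs_self s).trans this
  have h4 : s ^ 2 ≤ s * ‖x‖ ^ 2 := by
    have h0 : 0 ≤ s := Finset.sum_nonneg fun _ _ => sq_nonneg _
    calc s ^ 2 ≤ (‖∑ i, (inner ℂ (e i) x : ℂ) • e i‖ * ‖x‖) ^ 2 := by gcongr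
      _ = ‖∑ i, (inner ℂ (e i) x : ℂ) • e i‖ ^ 2 * ‖x‖ ^ 2 := mul_pow _ _ _
      _ ≤ s * ‖x‖ ^ 2 := by gcongr
  by_contra! hlt
  have h5 : 0 < s := (sq_nonneg _).trans_lt hlt
  nlinarith

end Orthogonal

/-- Replacing `ξ` by `t θ ξ`, with `θ` a phase making the form real, gives `t ‖z‖ ≤ t² a + b` for
all real `t`. The discriminant is therefore nonpositive, so `‖z‖² ≤ 4 a b`. -/
lemma norm_bilinear_le_two_mul {ι κ : Type*} [Fintype ι] [Fintype κ] {k : ι → κ → ℂ}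
    (h : ∀ (ξ : ι → ℂ) (η : κ → ℂ), (∑ i, ∑ j, k i j * (ξ i * η j)).re
      ≤ ∑ i, ‖ξ i‖ ^ 2 + ∑ j, ‖η j‖ ^ 2) (ξ : ι → ℂ) (η : κ → ℂ) :
    ‖∑ i, ∑ j, k i j * (ξ i * η j)‖ ≤ 2 * (√(∑ i, ‖ξ i‖ ^ 2) * √(∑ j, ‖η j‖ ^ 2)) := by
  set a := ∑ i, ‖ξ i‖ ^ 2
  set b := ∑ j, ‖η j‖ ^ 2
  set z := ∑ i, ∑ j, k i j * (ξ i * η j) with hz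
  have ha : 0 ≤ a := Finset.sum_nonneg fun _ _ => sq_nonneg _
  have hb : 0 ≤ b := Finset.sum_nonneg fun _ _ => sq_nonneg _
  obtain ⟨θ, hθ, hθz⟩ : ∃ θ : ℂ, ‖θ‖ = 1 ∧ θ * z = ‖z‖ := RCLike.exists_norm_eq_mul_self z |>.imp
    fun θ h => ⟨h.1, h.2.symm⟩
  have key : ∀ t : ℝ, t * ‖z‖ ≤ t ^ 2 * a + b := by
    intro t
    have h1 := h (fun i => (t : ℂ) * θ * ξ i) η
    have h2 : ∑ i, ∑ j, k i j * ((t : ℂ) * θ * ξ i * η j) = ((t * ‖z‖ : ℝ) : ℂ) := by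
      rw [Complex.ofReal_mul, ← hθz, hz, Finset.mul_sum, Finset.mul_sum]
      refine Finset.sum_congr rfl fun i _ => ?_
      rw [Finset.mul_sum, Finset.mul_sum]
      exact Finset.sum_congr rfl fun j _ => by ring
    rw [h2, Complex.ofReal_re] at h1
    simpa [norm_mul, mul_pow, hθ, ← Finset.mul_sum] using h1
  have hdisc := discrim_le_zero (a := a) (b := -‖z‖) (c := b) fun t => by
    have := key t
    linarith
  rw [discrim, neg_sq] at hdisc
  rw [← Real.sqrt_mul ha]
  refine le_of_sq_le_sq ?_ (by positivity)
  rw [mul_pow, Real.sq_sqrt (mul_nonneg ha hb)]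
  linarith

variable {S : Type u} {T : Type v} [MeasurableSpace S] [MeasurableSpace T]
  {μ : Measure S} {ν : Measure T} [SigmaFinite μ] [SigmaFinite ν]

/-- A finite family of square integrable functions with disjoint supports and norm at most one. -/
structure IsDisjointFamily {α ι : Type*} [MeasurableSpace α] (m : Measure α) (e : ι → α → ℝ) :
    Prop where
  memLp : ∀ i, MemLp (fun a => (e i a : ℂ)) 2 m
  disjoint : ∀ i j, i ≠ j → ∀ a, e i a * e j a = 0
  norm_le : ∀ i, eLpNorm (fun a => (e i a : ℂ)) 2 m ≤ 1

namespace IsDisjointFamily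

variable {α ι : Type*} [MeasurableSpace α] {m : Measure α} {e : ι → α → ℝ}

lemma pairwise_inner (he : IsDisjointFamily m e) :
    Pairwise fun i j => inner ℂ ((he.memLp i).toLp _) ((he.memLp j).toLp _) = 0 := by
  intro i j hij
  rw [L2.inner_def]
  refine integral_eq_zero_of_ae ?_
  filter_upwards [(he.memLp i).coeFn_toLp, (he.memLp j).coeFn_toLp] with a h1 h2
  rw [h1, h2, RCLike.inner_apply, Complex.conj_ofReal, ← Complex.ofReal_mul,
    he.disjoint j i hij.symm]
  simp

lemma norm_toLp_le (he : IsDisjointFamily m e) (i : ι) : ‖(he.memLp i).toLp _‖ ≤ 1 := by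
  rw [Lp.norm_toLp]
  exact ENNReal.toReal_mono ENNReal.one_ne_top (he.norm_le i)

variable [Fintype ι]

lemma memLp_sum (he : IsDisjointFamily m e) (z : ι → ℂ) :
    MemLp (fun a => ∑ i, z i * (e i a : ℂ)) 2 m :=
  memLp_finsetSum _ fun i _ => (he.memLp i).const_mul (z i)

lemma eLpNorm_sum_le (he : IsDisjointFamily m e) (z : ι → ℂ) :
    (eLpNorm (fun a => ∑ i, z i * (e i a : ℂ)) 2 m).toReal ≤ √(∑ i, ‖z i‖ ^ 2) := by
  refine Real.le_sqrt_of_sq_le ?_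
  rw [← Lp.norm_toLp _ (he.memLp_sum z)]
  refine le_trans (le_of_eq ?_) (norm_sum_smul_sq_le he.pairwise_inner he.norm_toLp_le z)
  congr 2
  rw [Lp.ext_iff]
  refine (he.memLp_sum z).coeFn_toLp.trans ?_
  have h1 : ∀ᵐ a ∂m, ∀ i, (z i • (he.memLp i).toLp _ : Lp ℂ 2 m) a = z i * (e i a : ℂ) := by
    rw [ae_all_iff]
    intro i
    filter_upwards [Lp.coeFn_smul (z i) ((he.memLp i).toLp _), (he.memLp i).coeFn_toLp]
      with a h1 h2
    rw [h1, Pi.smul_apply, h2, smul_eq_mul]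
  filter_upwards [h1, Lp.coeFn_finsetSum Finset.univ fun i => z i • (he.memLp i).toLp _]
    with a h2 h3
  rw [h3, Finset.sum_apply]
  exact Finset.sum_congr rfl fun i _ => (h2 i).symm

end IsDisjointFamily

variable {ι : Type*} {κ : Type*} [Fintype ι] [Fintype κ] {e : ι → S → ℝ} {f : κ → T → ℝ}

/-- Pairing with `I_g = ∑ ⟨v_k, ·⟩ u_k` evaluates the form `β` at the coordinates of `u_k` and `v_k`
along the two families; Bessel bounds each value by `‖u_k‖ ‖v_k‖`, and these products sum to at most
the trace norm. -/
lemma sum_kernel_mem_contractiveKernels (he : IsDisjointFamily μ e) (hf : IsDisjointFamily ν f)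
    {β : ι → κ → ℂ} (hβ : ∀ (ξ : ι → ℂ) (η : κ → ℂ), ‖∑ i, ∑ j, β i j * (ξ i * η j)‖
      ≤ √(∑ i, ‖ξ i‖ ^ 2) * √(∑ j, ‖η j‖ ^ 2)) :
    (fun p : S × T => ∑ i, ∑ j, β i j * ((e i p.1 : ℂ) * (f j p.2 : ℂ)))
      ∈ contractiveKernels μ ν := by
  refine ⟨memLp_finsetSum _ fun i _ => memLp_finsetSum _ fun j _ =>
    ((he.memLp i).mul_prod (hf.memLp j)).const_mul _, fun g hg => ?_⟩
  by_cases htop : traceNorm (integralOperator g hg) = ∞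
  · rw [htop]; exact le_top
  obtain ⟨u, v, hrep, hu, hv⟩ := exists_nuclear_representation (integralOperator g hg)
  let e' := fun i => (he.memLp i).toLp _
  let f' := fun j => (hf.memLp j).toLp _
  have hint : ∀ i j, Integrable (fun p : S × T => β i j * (g p * ((e i p.1 : ℂ) * (f j p.2 : ℂ))))
      (μ.prod ν) := fun i j =>
    (integrable_kernel_pairing hg (he.memLp i) (hf.memLp j)).const_mul _
  have h1 : ∫ p, g p * ∑ i, ∑ j, β i j * ((e i p.1 : ℂ) * (f j p.2 : ℂ)) ∂(μ.prod ν)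
      = ∑ i, ∑ j, β i j * inner ℂ (e' i) (integralOperator g hg (f' j)) := by
    have h2 : ∀ p : S × T, g p * ∑ i, ∑ j, β i j * ((e i p.1 : ℂ) * (f j p.2 : ℂ))
        = ∑ i, ∑ j, β i j * (g p * ((e i p.1 : ℂ) * (f j p.2 : ℂ))) := fun p => by
      simp only [Finset.mul_sum]
      exact Finset.sum_congr rfl fun i _ => Finset.sum_congr rfl fun j _ => by ring
    simp only [h2]
    rw [integral_finsetSum _ fun i _ => integrable_finsetSum _ fun j _ => hint i j]
    refine Finset.sum_congr rfl fun i _ => ?_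
    rw [integral_finsetSum _ fun j _ => hint i j]
    refine Finset.sum_congr rfl fun j _ => ?_
    rw [integral_const_mul, inner_integralOperator_toLp hg (he.memLp i) (hf.memLp j)]
    simp only [Complex.conj_ofReal]
  have h2 : HasSum (fun k => ∑ i, ∑ j, β i j * (inner ℂ (v k) (f' j) * inner ℂ (e' i) (u k)))
      (∑ i, ∑ j, β i j * inner ℂ (e' i) (integralOperator g hg (f' j))) :=
    hasSum_sum fun i _ => hasSum_sum fun j _ => (hrep (f' j) (e' i)).mul_left _
  rw [h1, ← h2.tsum_eq]
  have h3 : ∀ k, ‖∑ i, ∑ j, β i j * (inner ℂ (v k) (f' j) * inner ℂ (e' i) (u k))‖ₑ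
      ≤ ‖u k‖ₑ * ‖v k‖ₑ := by
    intro k
    have h4 := hβ (fun i => inner ℂ (e' i) (u k)) (fun j => inner ℂ (v k) (f' j))
    have h5 : ‖∑ i, ∑ j, β i j * (inner ℂ (v k) (f' j) * inner ℂ (e' i) (u k))‖
        ≤ ‖u k‖ * ‖v k‖ := by
      simp only [mul_comm (inner ℂ (v k) _)]
      refine h4.trans ?_
      gcongr
      · exact Real.sqrt_le_iff.2 ⟨norm_nonneg _,
          sum_norm_inner_sq_le he.pairwise_inner he.norm_toLp_le (u k)⟩
      · refine Real.sqrt_le_iff.2 ⟨norm_nonneg _, ?_⟩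
        simp only [norm_inner_symm (v k)]
        exact sum_norm_inner_sq_le hf.pairwise_inner hf.norm_toLp_le (v k)
    rw [← ofReal_norm, ← ofReal_norm, ← ofReal_norm, ← ENNReal.ofReal_mul (norm_nonneg _)]
    exact ENNReal.ofReal_le_ofReal h5
  refine enorm_tsum_le_tsum_enorm.trans ((ENNReal.tsum_le_tsum h3).trans ?_)
  set τ := traceNorm (integralOperator g hg)
  have hτsq : τ = (τ ^ (1 / 2 : ℝ)) ^ 2 := by
    rw [← ENNReal.rpow_natCast, ← ENNReal.rpow_mul]; norm_num
  refine (ENNReal.tsum_mul_le_of_tsum_sq_le (hu.trans_eq hτsq) (hv.trans_eq hτsq)).trans_eq ?_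
  rw [← sq, ← hτsq]

/-- The averages of a function with a bilinear bound over a grid factor through a Hilbert space. -/
lemma HasBilinearBound.exists_step_factorization {Φ : S × T → ℂ} {C : ℝ≥0}
    (h : HasBilinearBound μ ν Φ C) (he : IsDisjointFamily μ e) (hf : IsDisjointFamily ν f) :
    ∃ w : ι ⊕ κ → EuclideanSpace ℂ (ι ⊕ κ), (∀ p, ‖w p‖ ^ 2 ≤ C) ∧
      ∀ i j, inner ℂ (w (.inr j)) (w (.inl i))
        = ∫ p, Φ p * ((e i p.1 : ℂ) ^ 2 * (f j p.2 : ℂ) ^ 2) ∂(μ.prod ν) := by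
  refine exists_finite_factorization _ fun d k hd hk => ?_
  have hint : ∀ i j, Integrable
      (fun p : S × T => k i j * (Φ p * ((e i p.1 : ℂ) ^ 2 * (f j p.2 : ℂ) ^ 2))) (μ.prod ν) := by
    intro i j
    refine (((h _ _ (he.memLp i) (hf.memLp j)).1.integrable_mul
      ((he.memLp i).mul_prod (hf.memLp j))).const_mul (k i j)).congr (.of_forall fun p => ?_)
    simp only [Pi.mul_apply]
    ring
  let r : ι ⊕ κ → ℂ := fun p => ((√(d p) : ℝ) : ℂ)
  have hr0 : ∀ p, r p ≠ 0 := fun p => Complex.ofReal_ne_zero.2 (Real.sqrt_pos.2 (hd p)).ne'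
  have hrn : ∀ p, ‖r p‖ ^ 2 = d p := fun p => by
    rw [Complex.norm_real, Real.norm_eq_abs, sq_abs, Real.sq_sqrt (hd p).le]
  -- The weights `√d` are divided out of `k` here and put back through the test functions `∑ √d_i
  -- e_i` and `∑ √d_j f_j`. The `2` absorbs the constant of `norm_bilinear_le_two_mul`.
  let β : ι → κ → ℂ := fun i j => k i j / (2 * (r (.inl i) * r (.inr j)))
  have hβ : ∀ (ξ : ι → ℂ) (η : κ → ℂ), ‖∑ i, ∑ j, β i j * (ξ i * η j)‖
      ≤ √(∑ i, ‖ξ i‖ ^ 2) * √(∑ j, ‖η j‖ ^ 2) := by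
    intro ξ η
    have h1 := norm_bilinear_le_two_mul
      (k := fun i j => k i j / (r (.inl i) * r (.inr j))) (fun ξ η => by
        have := hk (fun i => ξ i / r (.inl i)) (fun j => η j / r (.inr j))
        simp only [norm_div, div_pow, hrn] at this
        convert! this using 2
        · refine Finset.sum_congr rfl fun i _ => Finset.sum_congr rfl fun j _ => ?_
          have := hr0 (.inl i)
          have := hr0 (.inr j)
          field_simp
        · refine Finset.sum_congr rfl fun i _ => ?_
          have := (hd (.inl i)).ne'
          field_simp
        · refine Finset.sum_congr rfl fun j _ => ?_
          have := (hd (.inr j)).ne'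
          field_simp) ξ η
    have h2 : ∑ i, ∑ j, k i j / (r (.inl i) * r (.inr j)) * (ξ i * η j)
        = 2 * ∑ i, ∑ j, β i j * (ξ i * η j) := by
      simp only [Finset.mul_sum]
      refine Finset.sum_congr rfl fun i _ => Finset.sum_congr rfl fun j _ => ?_
      have := hr0 (.inl i)
      have := hr0 (.inr j)
      simp only [β]
      field_simp
    rw [h2, norm_mul] at h1
    simpa using h1
  have ha := he.memLp_sum fun i => r (.inl i)
  have hc := hf.memLp_sum fun j => r (.inr j)
  have h1 := (h _ _ ha hc).2 _ (sum_kernel_mem_contractiveKernels he hf hβ)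
  have hea : ∀ i s, (∑ i', r (.inl i') * (e i' s : ℂ)) * (e i s : ℂ)
      = r (.inl i) * (e i s : ℂ) ^ 2 := by
    intro i s
    rw [Finset.sum_mul, Finset.sum_eq_single i (fun b _ hb => ?_) (by simp)]
    · ring
    · rw [mul_assoc, ← Complex.ofReal_mul, he.disjoint b i hb]; simp
  have hfc : ∀ j t, (∑ j', r (.inr j') * (f j' t : ℂ)) * (f j t : ℂ)
      = r (.inr j) * (f j t : ℂ) ^ 2 := by
    intro j t
    rw [Finset.sum_mul, Finset.sum_eq_single j (fun b _ hb => ?_) (by simp)]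
    · ring
    · rw [mul_assoc, ← Complex.ofReal_mul, hf.disjoint b j hb]; simp
  -- Disjointness of supports kills all cross terms, so only the squares `e_i² f_j²` survive and the
  -- weights cancel.
  have h2 : ∀ p : S × T, Φ p * ((∑ i, r (.inl i) * (e i p.1 : ℂ)) * ∑ j, r (.inr j) * (f j p.2 : ℂ))
      * (∑ i, ∑ j, β i j * ((e i p.1 : ℂ) * (f j p.2 : ℂ)))
      = 2⁻¹ * ∑ i, ∑ j, k i j * (Φ p * ((e i p.1 : ℂ) ^ 2 * (f j p.2 : ℂ) ^ 2)) := by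
    intro p
    obtain ⟨X, hX⟩ : ∃ X, X = Φ p * ((∑ i, r (.inl i) * (e i p.1 : ℂ))
      * ∑ j, r (.inr j) * (f j p.2 : ℂ)) := ⟨_, rfl⟩
    rw [← hX, Finset.mul_sum, Finset.mul_sum]
    refine Finset.sum_congr rfl fun i _ => ?_
    rw [Finset.mul_sum, Finset.mul_sum]
    refine Finset.sum_congr rfl fun j _ => ?_
    have h3 := hr0 (.inl i)
    have h4 := hr0 (.inr j)
    rw [hX]
    calc _ = β i j * Φ p * ((∑ i', r (.inl i') * (e i' p.1 : ℂ)) * (e i p.1 : ℂ))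
          * ((∑ j', r (.inr j') * (f j' p.2 : ℂ)) * (f j p.2 : ℂ)) := by ring
      _ = _ := by
        rw [hea, hfc]
        simp only [β]
        field_simp
  simp only [h2] at h1
  rw [integral_const_mul, integral_finsetSum _ fun i _ => integrable_finsetSum _ fun j _ =>
    hint i j] at h1
  simp only [integral_finsetSum _ fun j _ => hint _ j, integral_const_mul] at h1
  set z := ∑ i, ∑ j, k i j * ∫ p, Φ p * ((e i p.1 : ℂ) ^ 2 * (f j p.2 : ℂ) ^ 2) ∂(μ.prod ν)
  rw [← ofReal_norm, ENNReal.ofReal_le_iff_le_toReal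
    (ENNReal.mul_ne_top ENNReal.coe_ne_top (ENNReal.mul_ne_top ha.2.ne hc.2.ne)),
    ENNReal.toReal_mul, ENNReal.toReal_mul, ENNReal.coe_toReal] at h1
  have h3 := he.eLpNorm_sum_le fun i => r (.inl i)
  have h4 := hf.eLpNorm_sum_le fun j => r (.inr j)
  simp only [hrn] at h3 h4
  have h5 : ‖2⁻¹ * z‖ ≤ C * (√(∑ i, d (.inl i)) * √(∑ j, d (.inr j))) := h1.trans (by gcongr)
  -- The arithmetic–geometric mean inequality returns the factor `1/2` lost in `β`, so the constant
  -- `C` is preserved exactly.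
  have h6 : √(∑ i, d (.inl i)) * √(∑ j, d (.inr j)) ≤ 2⁻¹ * ∑ p, d p := by
    rw [Fintype.sum_sum_type]
    have e1 := Real.sq_sqrt (Finset.sum_nonneg fun i (_ : i ∈ Finset.univ) => (hd (.inl i)).le)
    have e2 := Real.sq_sqrt (Finset.sum_nonneg fun j (_ : j ∈ Finset.univ) => (hd (.inr j)).le)
    nlinarith [sq_nonneg (√(∑ i, d (.inl i)) - √(∑ j, d (.inr j)))]
  have h7 : ‖z‖ ≤ C * ∑ p, d p := by
    have h8 : ‖2⁻¹ * z‖ = 2⁻¹ * ‖z‖ := by simp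
    have h9 := mul_le_mul_of_nonneg_left h6 C.coe_nonneg
    rw [h8] at h5
    linarith
  exact (Complex.re_le_norm z).trans h7

end StepFactorization

/-! ### Limits of Gram kernels. -/

section GramLimit

/-- A limit of uniformly bounded Gram kernels is the Gram kernel of a bounded operator. -/
lemma exists_gram_limit {V : Type*} [NormedAddCommGroup V] [InnerProductSpace ℂ V]
    [CompleteSpace V] {J : Type*} (l : Filter J) [l.NeBot] {H : J → Type*}
    [∀ j, NormedAddCommGroup (H j)] [∀ j, InnerProductSpace ℂ (H j)] (z : ∀ j, V →ₗ[ℂ] H j) {K : ℝ}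
    (hK : 0 ≤ K) (hz : ∀ j v, ‖z j v‖ ≤ K * ‖v‖) :
    ∃ (U : Filter J) (Z : V →L[ℂ] V), U.NeBot ∧ U ≤ l ∧ ∀ v w,
      Filter.Tendsto (fun j => inner ℂ (z j v) (z j w)) U (nhds (inner ℂ (Z v) (Z w))) := by
  -- Along an ultrafilter every bounded family of scalars converges, so all entries of the Gram
  -- kernel converge simultaneously.
  let U : Ultrafilter J := Ultrafilter.of l
  have hex : ∀ v w, ∃ N : ℂ, N ∈ Metric.closedBall (0 : ℂ) (K ^ 2 * ‖v‖ * ‖w‖) ∧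
      Filter.Tendsto (fun j => inner ℂ (z j v) (z j w)) U (nhds N) := by
    intro v w
    refine (isCompact_closedBall (0 : ℂ) (K ^ 2 * ‖v‖ * ‖w‖)).ultrafilter_le_nhds
      (U.map fun j => inner ℂ (z j v) (z j w)) ?_
    refine Filter.le_principal_iff.2 (Filter.mem_map.2 (Filter.univ_mem' fun j => ?_))
    rw [Set.mem_preimage, mem_closedBall_zero_iff]
    calc ‖inner ℂ (z j v) (z j w)‖ ≤ ‖z j v‖ * ‖z j w‖ := norm_inner_le_norm _ _
      _ ≤ (K * ‖v‖) * (K * ‖w‖) := by gcongr <;> apply hz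
      _ = _ := by ring
  choose N hNball hN using hex
  let B : V →L⋆[ℂ] V →L[ℂ] ℂ := LinearMap.mkContinuous₂ (LinearMap.mk₂'ₛₗ _ _ N
    (fun v v' w => tendsto_nhds_unique (hN _ _) (by
      simpa only [map_add, inner_add_left] using (hN v w).add (hN v' w)))
    (fun c v w => tendsto_nhds_unique (hN _ _) (by
      simpa only [map_smul, inner_smul_left, smul_eq_mul] using
        (hN v w).const_mul (starRingEnd ℂ c)))
    (fun v w w' => tendsto_nhds_unique (hN _ _) (by
      simpa only [map_add, inner_add_right] using (hN v w).add (hN v w')))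
    (fun c v w => tendsto_nhds_unique (hN _ _) (by
      simpa only [map_smul, inner_smul_right, smul_eq_mul, RingHom.id_apply] using
        (hN v w).const_mul c))) (K ^ 2) fun v w => mem_closedBall_zero_iff.1 (hNball v w)
  let A : V →L[ℂ] V := InnerProductSpace.continuousLinearMapOfBilin B
  have hA : ∀ v w, inner ℂ (A v) w = N v w := fun v w =>
    InnerProductSpace.continuousLinearMapOfBilin_apply B v w
  have hself : ∀ v, Filter.Tendsto (fun j => ((‖z j v‖ ^ 2 : ℝ) : ℂ)) U (nhds (N v v)) := by
    intro v
    have := hN v v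
    simp only [inner_self_eq_norm_sq_to_K] at this
    simpa using this
  have hre : ∀ v, Filter.Tendsto (fun j => ‖z j v‖ ^ 2) U (nhds (N v v).re) := fun v => by
    simpa only [Function.comp_def, Complex.ofReal_re] using
      (Complex.continuous_re.tendsto _).comp (hself v)
  have hpos : A.IsPositive := by
    rw [ContinuousLinearMap.isPositive_iff_complex]
    intro v
    rw [hA]
    exact ⟨tendsto_nhds_unique ((Complex.continuous_ofReal.tendsto _).comp (hre v)) (hself v),
      ge_of_tendsto' (hre v) fun j => sq_nonneg _⟩
  -- The limit form is represented by the positive operator `A`, and its square root realizes it as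
  -- a Gram kernel on `V` itself.
  obtain ⟨Z, hZ⟩ := exists_sqrt_of_isPositive ((ContinuousLinearMap.nonneg_iff_isPositive A).2 hpos)
  refine ⟨U, Z, inferInstance, Ultrafilter.of_le l, fun v w => ?_⟩
  have h1 : inner ℂ (Z v) (Z w) = N v w := by
    rw [hZ, ← hA, ← ContinuousLinearMap.adjoint_inner_left, hpos.isSelfAdjoint.adjoint_eq]
  rw [h1]
  exact hN v w

end GramLimit

/-! ### Reduction to finite measures. -/

section GridFactorization

variable {S : Type u} {T : Type v} [MeasurableSpace S] [MeasurableSpace T]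

/-- The averages of `Φ` over any finite measurable grid factor through a Hilbert space. -/
def HasGridFactorization (m : Measure S) (n : Measure T) (Φ : S × T → ℂ) (C : ℝ≥0) : Prop :=
  ∀ (ι : Type u) (κ : Type v) [Fintype ι] [Fintype κ] (σ : S → ι) (τ : T → κ),
    (∀ i, MeasurableSet (σ ⁻¹' {i})) → (∀ j, MeasurableSet (τ ⁻¹' {j})) →
    ∃ w : ι ⊕ κ → EuclideanSpace ℂ (ι ⊕ κ), (∀ p, ‖w p‖ ^ 2 ≤ C) ∧
      ∀ i j, ∫ p in (σ ⁻¹' {i}) ×ˢ (τ ⁻¹' {j}), Φ p ∂(m.prod n)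
        = m.real (σ ⁻¹' {i}) * n.real (τ ⁻¹' {j}) * inner ℂ (w (.inr j)) (w (.inl i))

section

variable {α : Type*} [MeasurableSpace α] {μ : Measure α}

/-- The part of `ρ` on a cell of a partition, normalized in `L²`. -/
noncomputable def normalizedPiece {ι : Type*} (μ : Measure α) (ρ : α → ℝ≥0) (σ : α → ι) (i : ι)
    (a : α) : ℝ :=
  (σ ⁻¹' {i}).indicator (fun a => (ρ a : ℝ) / √((μ.withDensity fun a => (ρ a : ℝ≥0∞) ^ 2).real
    (σ ⁻¹' {i}))) a

lemma isDisjointFamily_normalizedPiece {ι : Type*} {ρ : α → ℝ≥0} (hρ : Measurable ρ)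
    [IsFiniteMeasure (μ.withDensity fun a => (ρ a : ℝ≥0∞) ^ 2)] {σ : α → ι}
    (hσ : ∀ i, MeasurableSet (σ ⁻¹' {i})) : IsDisjointFamily μ (normalizedPiece μ ρ σ) := by
  have hmeas : ∀ i, Measurable (normalizedPiece μ ρ σ i) := fun i =>
    (hρ.coe_nnreal_real.div_const _).indicator (hσ i)
  have hle : ∀ i, eLpNorm (fun a => (normalizedPiece μ ρ σ i a : ℂ)) 2 μ ≤ 1 := by
    intro i
    set c := (μ.withDensity fun a => (ρ a : ℝ≥0∞) ^ 2).real (σ ⁻¹' {i}) with hc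
    have h1 : ∀ a, ‖(normalizedPiece μ ρ σ i a : ℂ)‖ₑ ^ 2
        = (σ ⁻¹' {i}).indicator (fun a => ENNReal.ofReal c⁻¹ * (ρ a : ℝ≥0∞) ^ 2) a := by
      intro a
      rw [normalizedPiece, ← hc]
      by_cases ha : a ∈ σ ⁻¹' {i}
      · rw [Set.indicator_of_mem ha, Set.indicator_of_mem ha, ← ofReal_norm, Complex.norm_real,
          Real.norm_of_nonneg (by positivity), ← ENNReal.ofReal_pow (by positivity), div_pow,
          Real.sq_sqrt (by positivity), div_eq_inv_mul, ENNReal.ofReal_mul (by positivity),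
          ENNReal.ofReal_pow (by positivity), ENNReal.ofReal_coe_nnreal]
      · rw [Set.indicator_of_notMem ha, Set.indicator_of_notMem ha]
        simp
    rw [← ENNReal.pow_le_pow_left_iff two_ne_zero, eLpNorm_two_sq]
    simp only [h1]
    rw [lintegral_indicator (hσ i), lintegral_const_mul' _ _ ENNReal.ofReal_ne_top,
      ← withDensity_apply _ (hσ i), ← ofReal_measureReal (measure_ne_top _ _), ← hc,
      ← ENNReal.ofReal_mul (by positivity), one_pow]
    exact ENNReal.ofReal_le_one.2 (inv_mul_le_one)
  refine ⟨fun i => ⟨(Complex.measurable_ofReal.comp (hmeas i)).aestronglyMeasurable,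
    (hle i).trans_lt ENNReal.one_lt_top⟩, fun i j hij a => ?_, hle⟩
  by_cases ha : σ a = i
  · have : a ∉ σ ⁻¹' {j} := fun h => hij (ha.symm.trans h)
    rw [normalizedPiece, normalizedPiece, Set.indicator_of_notMem this, mul_zero]
  · have : a ∉ σ ⁻¹' {i} := ha
    rw [normalizedPiece, Set.indicator_of_notMem this, zero_mul]

end

variable {μ : Measure S} {ν : Measure T} [SigmaFinite μ] [SigmaFinite ν]

lemma integral_prod_withDensity_sq {ρ : S → ℝ≥0} {θ : T → ℝ≥0} (hρ : Measurable ρ)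
    (hθ : Measurable θ) (Φ : S × T → ℂ) :
    ∫ p, Φ p ∂((μ.withDensity fun s => (ρ s : ℝ≥0∞) ^ 2).prod
        (ν.withDensity fun t => (θ t : ℝ≥0∞) ^ 2))
      = ∫ p, (ρ p.1 : ℂ) ^ 2 * (θ p.2 : ℂ) ^ 2 * Φ p ∂(μ.prod ν) := by
  rw [prod_withDensity (hρ.coe_nnreal_ennreal.pow_const 2) (hθ.coe_nnreal_ennreal.pow_const 2)]
  have h1 : (fun p : S × T => (ρ p.1 : ℝ≥0∞) ^ 2 * (θ p.2 : ℝ≥0∞) ^ 2)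
      = fun p => ((ρ p.1 ^ 2 * θ p.2 ^ 2 : ℝ≥0) : ℝ≥0∞) := by
    ext p; push_cast; rfl
  have h2 : Measurable fun p : S × T => ρ p.1 ^ 2 * θ p.2 ^ 2 := by fun_prop
  rw [h1, integral_withDensity_eq_integral_smul h2]
  congr 1 with p
  rw [NNReal.smul_def, Complex.real_smul]
  push_cast
  rfl

/-- For the finite measure `m = ρ² μ`, the squared normalized piece times `μ` is `m` restricted to a
cell and divided by its mass. The numbers produced by `exists_step_factorization` are thus averages
of `Φ` over the cells for `m × n`. -/
lemma HasBilinearBound.hasGridFactorization {Φ : S × T → ℂ} {C : ℝ≥0}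
    (h : HasBilinearBound μ ν Φ C) {ρ : S → ℝ≥0} {θ : T → ℝ≥0} (hρ : Measurable ρ)
    (hθ : Measurable θ) [IsFiniteMeasure (μ.withDensity fun s => (ρ s : ℝ≥0∞) ^ 2)]
    [IsFiniteMeasure (ν.withDensity fun t => (θ t : ℝ≥0∞) ^ 2)] :
    HasGridFactorization (μ.withDensity fun s => (ρ s : ℝ≥0∞) ^ 2)
      (ν.withDensity fun t => (θ t : ℝ≥0∞) ^ 2) Φ C := by
  intro ι κ _ _ σ τ hσ hτ
  obtain ⟨w, hw, hwΦ⟩ := h.exists_step_factorization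
    (isDisjointFamily_normalizedPiece (μ := μ) hρ hσ)
    (isDisjointFamily_normalizedPiece (μ := ν) hθ hτ)
  refine ⟨w, hw, fun i j => ?_⟩
  rw [hwΦ]
  set m := μ.withDensity fun s => (ρ s : ℝ≥0∞) ^ 2 with hm
  set n := ν.withDensity fun t => (θ t : ℝ≥0∞) ^ 2 with hn
  -- On null cells the normalization divides by zero, but there both sides of the identity vanish.
  by_cases hi : m (σ ⁻¹' {i}) = 0
  · rw [Measure.restrict_eq_zero.2 (by rw [Measure.prod_prod, hi, zero_mul]), integral_zero_measure,
      Measure.real, hi]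
    simp
  by_cases hj : n (τ ⁻¹' {j}) = 0
  · rw [Measure.restrict_eq_zero.2 (by rw [Measure.prod_prod, hj, mul_zero]), integral_zero_measure,
      Measure.real, Measure.real, hj]
    simp
  have hi' : (m.real (σ ⁻¹' {i}) : ℂ) ≠ 0 :=
    Complex.ofReal_ne_zero.2 (ENNReal.toReal_ne_zero.2 ⟨hi, measure_ne_top _ _⟩)
  have hj' : (n.real (τ ⁻¹' {j}) : ℂ) ≠ 0 :=
    Complex.ofReal_ne_zero.2 (ENNReal.toReal_ne_zero.2 ⟨hj, measure_ne_top _ _⟩)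
  rw [← integral_indicator ((hσ i).prod (hτ j)), hm, hn, integral_prod_withDensity_sq hρ hθ, ← hm,
    ← hn, ← integral_const_mul]
  congr 1 with p
  have hsq : ∀ r : ℝ, 0 ≤ r → ((√r : ℝ) : ℂ) ^ 2 = r := fun r hr => by
    rw [← Complex.ofReal_pow, Real.sq_sqrt hr]
  by_cases h1 : p.1 ∈ σ ⁻¹' {i}
  · by_cases h2 : p.2 ∈ τ ⁻¹' {j}
    · rw [Set.indicator_of_mem (Set.mk_mem_prod h1 h2), normalizedPiece, normalizedPiece,
        Set.indicator_of_mem h1, Set.indicator_of_mem h2, ← hm, ← hn, Complex.ofReal_div,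
        Complex.ofReal_div, div_pow, div_pow, hsq _ measureReal_nonneg, hsq _ measureReal_nonneg]
      field_simp
    · rw [Set.indicator_of_notMem (fun hp => h2 hp.2), normalizedPiece, normalizedPiece,
        Set.indicator_of_notMem h2]
      simp
  · rw [Set.indicator_of_notMem (fun hp => h1 hp.1), normalizedPiece,
      Set.indicator_of_notMem h1]
    simp

end GridFactorization

/-! ### Passage from grids to operators on `L²`. -/

section BilinearFactorization

lemma setIntegral_preimage_finset {Ω κ E : Type*} [MeasurableSpace Ω] [NormedAddCommGroup E]
    [NormedSpace ℝ E] {m : Measure Ω} {γ : Ω → κ} (hγ : ∀ k, MeasurableSet (γ ⁻¹' {k}))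
    {f : Ω → E} (hf : Integrable f m) (K : Finset κ) :
    ∫ a in γ ⁻¹' K, f a ∂m = ∑ k ∈ K, ∫ a in γ ⁻¹' {k}, f a ∂m := by
  rw [← integral_biUnion_finset K (fun k _ => hγ k) (fun k _ l _ hkl =>
    (Set.disjoint_singleton.2 hkl).preimage γ) fun k _ => hf.integrableOn]
  congr 2
  ext a
  simp

lemma integral_norm_le_mul_norm {α : Type*} [MeasurableSpace α] (m : Measure α)
    [IsFiniteMeasure m] (f : Lp ℂ 2 m) : ∫ a, ‖f a‖ ∂m ≤ √(m.real Set.univ) * ‖f‖ := by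
  have h1 := integral_mul_le_Lp_mul_Lq_of_nonneg (μ := m) Real.HolderConjugate.two_two
    (f := fun _ => (1 : ℝ)) (g := fun a => ‖f a‖) (.of_forall fun _ => zero_le_one)
    (.of_forall fun _ => norm_nonneg _) (memLp_const 1) (by simpa using (Lp.memLp f).norm)
  have h2 : ‖f‖ = (∫ a, ‖f a‖ ^ (2 : ℝ) ∂m) ^ (1 / 2 : ℝ) := by
    rw [Lp.norm_def, (Lp.memLp f).eLpNorm_eq_integral_rpow_norm two_ne_zero ENNReal.ofNat_ne_top,
      ENNReal.toReal_ofReal (by positivity)]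
    norm_num
  rw [h2, Real.sqrt_eq_rpow]
  simpa using h1

section GridMap

variable {α ι H : Type*} [MeasurableSpace α] {m : Measure α} [IsFiniteMeasure m] [Fintype ι]
  [NormedAddCommGroup H] [InnerProductSpace ℂ H]

/-- The linear map `f ↦ ∑ i, (∫_{σ = i} f) • w i`. -/
noncomputable def gridMap {σ : α → ι} (hσ : ∀ i, MeasurableSet (σ ⁻¹' {i})) (w : ι → H) :
    Lp ℂ 2 m →ₗ[ℂ] H :=
  ∑ i, (innerSL ℂ (indicatorConstLp 2 (hσ i) (measure_ne_top m _) (1 : ℂ))).toLinearMap.smulRight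
    (w i)

lemma gridMap_apply {σ : α → ι} (hσ : ∀ i, MeasurableSet (σ ⁻¹' {i})) (w : ι → H)
    (f : Lp ℂ 2 m) : gridMap hσ w f = ∑ i, (∫ a in σ ⁻¹' {i}, f a ∂m) • w i := by
  rw [gridMap, LinearMap.sum_apply]
  refine Finset.sum_congr rfl fun i _ => ?_
  rw [← L2.inner_indicatorConstLp_one (hσ i) (measure_ne_top m _)]
  rfl

/-- The bound is by the `L¹` norm and does not depend on the grid, so it survives the limit and
later yields essential boundedness. -/
lemma norm_gridMap_le {σ : α → ι} (hσ : ∀ i, MeasurableSet (σ ⁻¹' {i})) {w : ι → H} {C : ℝ}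
    (hw : ∀ i, ‖w i‖ ^ 2 ≤ C) (f : Lp ℂ 2 m) : ‖gridMap hσ w f‖ ≤ √C * ∫ a, ‖f a‖ ∂m := by
  have hint : Integrable f m := (Lp.memLp f).integrable one_le_two
  have h1 := setIntegral_preimage_finset hσ hint.norm Finset.univ
  rw [Finset.coe_univ, Set.preimage_univ, setIntegral_univ] at h1
  rw [gridMap_apply, h1, Finset.mul_sum]
  refine (norm_sum_le _ _).trans (Finset.sum_le_sum fun i _ => ?_)
  rw [norm_smul, mul_comm]
  exact mul_le_mul (Real.le_sqrt_of_sq_le (hw i)) (norm_integral_le_integral_norm _)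
    (norm_nonneg _) (Real.sqrt_nonneg _)

lemma gridMap_indicator {σ : α → ι} (hσ : ∀ i, MeasurableSet (σ ⁻¹' {i})) (w : ι → H)
    (I : Finset ι) (hI : MeasurableSet (σ ⁻¹' I)) :
    gridMap hσ w (indicatorConstLp 2 hI (measure_ne_top m _) (1 : ℂ))
      = ∑ i ∈ I, (m.real (σ ⁻¹' {i}) : ℂ) • w i := by
  classical
  have hterm : ∀ i (f : Lp ℂ 2 m), (innerSL ℂ (indicatorConstLp 2 (hσ i) (measure_ne_top m _)
      (1 : ℂ))).toLinearMap.smulRight (w i) f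
        = (inner ℂ (indicatorConstLp 2 (hσ i) (measure_ne_top m _) (1 : ℂ)) f : ℂ) • w i :=
    fun _ _ => rfl
  rw [gridMap, LinearMap.sum_apply, ← Finset.sum_subset (Finset.subset_univ I)]
  · refine Finset.sum_congr rfl fun i hi => ?_
    rw [hterm, L2.inner_indicatorConstLp_one_indicatorConstLp_one (hσ i) hI, Set.inter_eq_left.2]
    · rfl
    · rintro a rfl
      exact hi
  · intro i _ hi
    rw [hterm, L2.inner_indicatorConstLp_one_indicatorConstLp_one (hσ i) hI]
    have : σ ⁻¹' {i} ∩ σ ⁻¹' I = ∅ := by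
      ext a
      simp only [Set.mem_inter_iff, Set.mem_preimage, Set.mem_singleton_iff, Finset.mem_coe,
        Set.mem_empty_iff_false, iff_false, not_and]
      rintro rfl
      exact hi
    simp [this]

end GridMap

section Coding

variable {α : Type*} [MeasurableSpace α]

open Classical in
/-- The code of a point with respect to a finite family of measurable sets. -/
noncomputable def setCode (F : Finset {A : Set α // MeasurableSet A}) (a : α) (A : F) : Bool :=
  decide (a ∈ A.1.1)

lemma measurableSet_setCode_preimage (F : Finset {A : Set α // MeasurableSet A})
    (K : Set (F → Bool)) : MeasurableSet (setCode F ⁻¹' K) := by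
  have h : Measurable (setCode F) := by
    refine measurable_pi_iff.2 fun A => measurable_to_bool ?_
    have : (fun a => setCode F a A) ⁻¹' {true} = A.1.1 := by
      ext a; simp [setCode]
    rw [this]
    exact A.1.2
  exact h K.toFinite.measurableSet

/-- The fibres of `setCode F` are the atoms of the finite algebra generated by `F`, and each member
of `F` is a union of atoms. -/
lemma exists_preimage_setCode_eq (F : Finset {A : Set α // MeasurableSet A})
    {A : {A : Set α // MeasurableSet A}} (hA : A ∈ F) :
    ∃ I : Finset (F → Bool), setCode F ⁻¹' I = A.1 := by
  classical
  refine ⟨Finset.univ.filter fun i => i ⟨A, hA⟩ = true, ?_⟩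
  ext a
  simp [setCode]

end Coding

variable {S : Type u} {T : Type v} [MeasurableSpace S] [MeasurableSpace T]
  {m : Measure S} {n : Measure T} [IsFiniteMeasure m] [IsFiniteMeasure n]

/-- A bilinear integral form with grid factorizations factors through a Hilbert space. -/
lemma HasGridFactorization.exists_bilinear_factorization {Φ : S × T → ℂ} {C : ℝ≥0}
    (h : HasGridFactorization m n Φ C) (hΦ : Integrable Φ (m.prod n)) :
    ∃ (X : Lp ℂ 2 m →L[ℂ] WithLp 2 (Lp ℂ 2 m × Lp ℂ 2 n))
      (Y : Lp ℂ 2 n →L[ℂ] WithLp 2 (Lp ℂ 2 m × Lp ℂ 2 n)),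
      (∀ f, ‖X f‖ ≤ √C * ∫ s, ‖f s‖ ∂m) ∧ (∀ g, ‖Y g‖ ≤ √C * ∫ t, ‖g t‖ ∂n) ∧
      ∀ A (hA : MeasurableSet A) B (hB : MeasurableSet B),
        inner ℂ (Y (indicatorConstLp 2 hB (measure_ne_top n _) 1))
          (X (indicatorConstLp 2 hA (measure_ne_top m _) 1)) = ∫ p in A ×ˢ B, Φ p ∂(m.prod n) := by
  classical
  let V := WithLp 2 (Lp ℂ 2 m × Lp ℂ 2 n)
  let J := Finset {A : Set S // MeasurableSet A} × Finset {B : Set T // MeasurableSet B}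
  choose w hwC hwΦ using fun π : J => h (π.1 → Bool) (π.2 → Bool) (setCode π.1) (setCode π.2)
    (fun i => measurableSet_setCode_preimage _ _) (fun j => measurableSet_setCode_preimage _ _)
  let x := fun π : J => gridMap (m := m) (σ := setCode π.1)
    (fun i => measurableSet_setCode_preimage _ _) fun i => w π (.inl i)
  let y := fun π : J => gridMap (m := n) (σ := setCode π.2)
    (fun i => measurableSet_setCode_preimage _ _) fun j => w π (.inr j)
  have hx : ∀ π f, ‖x π f‖ ≤ √C * ∫ s, ‖f s‖ ∂m := fun π f =>
    norm_gridMap_le _ (fun i => hwC π _) f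
  have hy : ∀ π g, ‖y π g‖ ≤ √C * ∫ t, ‖g t‖ ∂n := fun π g =>
    norm_gridMap_le _ (fun i => hwC π _) g
  -- Once the two families contain `A` and `B`, the grid resolves `A ×ˢ B` and the pairing equals
  -- the integral exactly; no approximation of `Φ` is involved.
  have hxy : ∀ A (hA : MeasurableSet A) B (hB : MeasurableSet B),
      ∀ᶠ π : J in Filter.atTop, inner ℂ (y π (indicatorConstLp 2 hB (measure_ne_top n _) 1))
          (x π (indicatorConstLp 2 hA (measure_ne_top m _) 1))
        = ∫ p in A ×ˢ B, Φ p ∂(m.prod n) := by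
    intro A hA B hB
    filter_upwards [Filter.eventually_ge_atTop (({⟨A, hA⟩}, {⟨B, hB⟩}) : J)] with π hπ
    obtain ⟨I, hI⟩ := exists_preimage_setCode_eq π.1 (A := ⟨A, hA⟩) (hπ.1 (by simp))
    obtain ⟨K, hK⟩ := exists_preimage_setCode_eq π.2 (A := ⟨B, hB⟩) (hπ.2 (by simp))
    simp only at hI hK
    subst hI hK
    have h1 : (setCode π.1 ⁻¹' I) ×ˢ (setCode π.2 ⁻¹' K)
        = Prod.map (setCode π.1) (setCode π.2) ⁻¹' ((I ×ˢ K : Finset _) : Set _) := by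
      ext p; simp
    have h2 : ∀ k : (π.1 → Bool) × (π.2 → Bool), Prod.map (setCode π.1) (setCode π.2) ⁻¹' {k}
        = (setCode π.1 ⁻¹' {k.1}) ×ˢ (setCode π.2 ⁻¹' {k.2}) := by
      intro k; ext p; simp [Prod.ext_iff]
    rw [gridMap_indicator, gridMap_indicator, h1, setIntegral_preimage_finset (fun k => by
      rw [h2]
      exact (measurableSet_setCode_preimage _ _).prod (measurableSet_setCode_preimage _ _)) hΦ,
      Finset.sum_product, inner_sum]
    refine Finset.sum_congr rfl fun i _ => ?_
    rw [sum_inner]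
    refine Finset.sum_congr rfl fun j _ => ?_
    rw [h2, hwΦ, inner_smul_left, inner_smul_right, Complex.conj_ofReal]
    ring
  -- Joining `x` and `y` on the direct sum lets a single Gram limit produce both operators together
  -- with their mixed inner products.
  let z := fun π : J => (x π).coprod (y π) ∘ₗ
    (WithLp.linearEquiv 2 ℂ (Lp ℂ 2 m × Lp ℂ 2 n)).toLinearMap
  have hzx : ∀ π f, z π (WithLp.toLp 2 (f, 0)) = x π f := fun π f => by simp [z]
  have hzy : ∀ π g, z π (WithLp.toLp 2 (0, g)) = y π g := fun π g => by simp [z]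
  obtain ⟨U, Z, hU, hUle, hZ⟩ := exists_gram_limit (V := V) (Filter.atTop : Filter J) z
    (K := √C * (√(m.real Set.univ) + √(n.real Set.univ))) (by positivity) fun π v => by
      have h1 : z π v = x π v.fst + y π v.snd := rfl
      rw [h1]
      calc ‖x π v.fst + y π v.snd‖ ≤ ‖x π v.fst‖ + ‖y π v.snd‖ := norm_add_le _ _
        _ ≤ √C * (√(m.real Set.univ) * ‖v‖) + √C * (√(n.real Set.univ) * ‖v‖) := by
          refine add_le_add ((hx π _).trans ?_) ((hy π _).trans ?_)
          · refine mul_le_mul_of_nonneg_left ((integral_norm_le_mul_norm m _).trans ?_)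
              (Real.sqrt_nonneg _)
            exact mul_le_mul_of_nonneg_left (WithLp.norm_fst_le _ v) (Real.sqrt_nonneg _)
          · refine mul_le_mul_of_nonneg_left ((integral_norm_le_mul_norm n _).trans ?_)
              (Real.sqrt_nonneg _)
            exact mul_le_mul_of_nonneg_left (WithLp.norm_snd_le _ v) (Real.sqrt_nonneg _)
        _ = _ := by ring
  -- The limit of the diagonal entries transfers any bound uniform in the grid, in particular the
  -- `L¹` bounds, which are sharper than the operator bound used for the limit.
  have hnorm : ∀ (v : V) (c : ℝ), (∀ π, ‖z π v‖ ≤ c) → 0 ≤ c → ‖Z v‖ ≤ c := by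
    intro v c hc hc0
    have h1 : Filter.Tendsto (fun π => ‖z π v‖ ^ 2) U (nhds (‖Z v‖ ^ 2)) := by
      have h2 := (Complex.continuous_re.tendsto _).comp (hZ v v)
      have h3 : ∀ {G : Type _} [NormedAddCommGroup G] [InnerProductSpace ℂ G] (g : G),
          (inner ℂ g g).re = ‖g‖ ^ 2 := fun g => inner_self_eq_norm_sq (𝕜 := ℂ) g
      have h4 : (inner ℂ (Z v) (Z v)).re = ‖Z v‖ ^ 2 := h3 _
      rw [h4] at h2
      refine h2.congr fun π => ?_
      exact h3 _
    refine le_of_sq_le_sq (le_of_tendsto' h1 fun π => ?_) hc0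
    exact pow_le_pow_left₀ (norm_nonneg _) (hc π) 2
  let L := (WithLp.prodContinuousLinearEquiv 2 ℂ (Lp ℂ 2 m) (Lp ℂ 2 n)).symm.toContinuousLinearMap
  refine ⟨Z ∘L L ∘L ContinuousLinearMap.inl ℂ _ _, Z ∘L L ∘L ContinuousLinearMap.inr ℂ _ _,
    fun f => ?_, fun g => ?_, fun A hA B hB => ?_⟩
  · exact hnorm (WithLp.toLp 2 (f, 0)) _ (fun π => by rw [hzx]; exact hx π f)
      (mul_nonneg (Real.sqrt_nonneg _) (integral_nonneg fun _ => norm_nonneg _))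
  · exact hnorm (WithLp.toLp 2 (0, g)) _ (fun π => by rw [hzy]; exact hy π g)
      (mul_nonneg (Real.sqrt_nonneg _) (integral_nonneg fun _ => norm_nonneg _))
  · refine tendsto_nhds_unique (hZ (WithLp.toLp 2 (0, indicatorConstLp 2 hB (measure_ne_top n _) 1))
      (WithLp.toLp 2 (indicatorConstLp 2 hA (measure_ne_top m _) 1, 0))) ?_
    refine tendsto_const_nhds.congr' ?_
    filter_upwards [hUle (hxy A hA B hB)] with π hπ
    rw [hzx, hzy, hπ]

end BilinearFactorization

/-! ### Orthogonal sequences for separable subspaces. -/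

section OrthonormalSequence

variable {H : Type*} [NormedAddCommGroup H] [InnerProductSpace ℂ H] [CompleteSpace H]

/-- Gram–Schmidt on an enumeration of `c`; redundant vectors become zero and are kept, so that the
index set stays `ℕ`. Parseval needs only one of the two vectors in the closed span. -/
lemma exists_orthogonal_sequence {c : Set H} (hc : c.Countable) :
    ∃ u : ℕ → H, (Pairwise fun i j => inner ℂ (u i) (u j) = 0) ∧ (∀ i, ‖u i‖ ≤ 1) ∧
      ∀ a ∈ (Submodule.span ℂ c).topologicalClosure, ∀ b,
        HasSum (fun n => inner ℂ a (u n) * inner ℂ (u n) b) (inner ℂ a b) := by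
  -- Adding `0` makes the set nonempty, hence the range of a sequence, without changing the span.
  obtain ⟨v, hv⟩ := (hc.insert 0).exists_eq_range (Set.insert_nonempty _ _)
  let u : ℕ → H := InnerProductSpace.gramSchmidtNormed ℂ v
  have hspan : Submodule.span ℂ c = Submodule.span ℂ (Set.range u) := by
    rw [InnerProductSpace.span_gramSchmidtNormed_range, InnerProductSpace.span_gramSchmidt, ← hv,
      Submodule.span_insert_zero]
  have horth : Pairwise fun i j => inner ℂ (u i) (u j) = 0 := by
    intro i j hij
    simp only [u, InnerProductSpace.gramSchmidtNormed, inner_smul_left, inner_smul_right,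
      InnerProductSpace.gramSchmidt_orthogonal ℂ v hij, mul_zero]
  have hnorm : ∀ i, u i ≠ 0 → ‖u i‖ = 1 := fun i hi =>
    InnerProductSpace.gramSchmidtNormed_unit_length' hi
  have hon : Orthonormal ℂ fun i : {i | u i ≠ 0} => u i :=
    InnerProductSpace.gramSchmidtNormed_orthonormal' v
  refine ⟨u, horth, fun i => ?_, fun a ha b => ?_⟩
  · by_cases hi : u i = 0
    · rw [hi, norm_zero]; exact zero_le_one
    · exact (hnorm i hi).le
  obtain ⟨w, B, hw, hB⟩ := hon.toSubtypeRange.exists_hilbertBasis_extension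
  have h1 := B.hasSum_inner_mul_inner a b
  let g : {i | u i ≠ 0} → w := fun i => ⟨u i, hw ⟨i, rfl⟩⟩
  have hg : Function.Injective g := fun i j hij =>
    hon.linearIndependent.injective (congrArg Subtype.val hij)
  -- The nonzero `u i` extend to a Hilbert basis, and every further basis vector is orthogonal to
  -- the closed span, so to `a`.
  have hzero : ∀ e ∉ Set.range g, inner ℂ a (B e) * inner ℂ (B e) b = 0 := by
    intro e he
    have h2 : ∀ i, inner ℂ (B e) (u i) = 0 := by
      intro i
      by_cases hi : u i = 0
      · rw [hi, inner_zero_right]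
      · have h3 := B.orthonormal.2 (i := e) (j := g ⟨i, hi⟩) fun h => he ⟨_, h.symm⟩
        rw [hB] at h3 ⊢
        exact h3
    have h3 : (Submodule.span ℂ c).topologicalClosure ≤ LinearMap.ker (innerSL ℂ (B e)).toLinearMap := by
      refine Submodule.topologicalClosure_minimal _ ?_ (innerSL ℂ (B e)).isClosed_ker
      rw [hspan, Submodule.span_le]
      rintro _ ⟨i, rfl⟩
      exact h2 i
    have h4 : inner ℂ (B e) a = 0 := h3 ha
    rw [inner_eq_zero_symm.1 h4, zero_mul]
  have h5 := (hg.hasSum_iff hzero).2 h1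
  have h6 : (fun e => inner ℂ a (B e) * inner ℂ (B e) b) ∘ g
      = (fun n => inner ℂ a (u n) * inner ℂ (u n) b) ∘ ((↑) : {i | u i ≠ 0} → ℕ) := by
    ext i
    simp only [Function.comp_apply, hB, g]
  rw [h6] at h5
  refine (hasSum_subtype_iff_of_support_subset fun n hn => ?_).1 h5
  intro h0
  apply hn
  simp only [h0, inner_zero_right, zero_mul]

lemma tsum_enorm_inner_sq_le {u : ℕ → H} (horth : Pairwise fun i j => inner ℂ (u i) (u j) = 0)
    (hnorm : ∀ i, ‖u i‖ ≤ 1) (x : H) : ∑' n, ‖inner ℂ (u n) x‖ₑ ^ 2 ≤ ‖x‖ₑ ^ 2 := by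
  rw [ENNReal.tsum_eq_iSup_nat]
  refine iSup_le fun N => ?_
  have h1 := sum_norm_inner_sq_le (e := fun i : Fin N => u i)
    (fun i j hij => horth fun h => hij (Fin.ext h)) (fun i => hnorm i) x
  rw [Fin.sum_univ_eq_sum_range (fun n => ‖inner ℂ (u n) x‖ ^ 2)] at h1
  simp only [← ofReal_norm, ← ENNReal.ofReal_pow (norm_nonneg _)]
  rw [← ENNReal.ofReal_sum_of_nonneg fun _ _ => sq_nonneg _]
  exact ENNReal.ofReal_le_ofReal h1

end OrthonormalSequence

/-! ### Pointwise bounds from integral bounds. -/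

section SetIntegral

variable {α : Type*} [MeasurableSpace α] {m : Measure α} [IsFiniteMeasure m]

lemma eq_zero_of_inner_indicator_eq_zero {f : Lp ℂ 2 m} (h : ∀ A (hA : MeasurableSet A),
    inner ℂ (indicatorConstLp 2 hA (measure_ne_top m _) 1) f = 0) : f = 0 := by
  rw [Lp.eq_zero_iff_ae_eq_zero]
  refine Lp.ae_eq_zero_of_forall_setIntegral_eq_zero f two_ne_zero ENNReal.ofNat_ne_top
    (fun s _ _ => ((Lp.memLp f).integrable one_le_two).integrableOn) fun s hs _ => ?_
  rw [← L2.inner_indicatorConstLp_one hs (measure_ne_top m _)]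
  exact h s hs

/-- Testing against the phase `g / ‖g‖` on `A`, set to zero where `g` vanishes, gives `∫_A ‖g‖ ≤ K
m(A)` for every measurable `A`. -/
lemma ae_norm_le_of_norm_inner_le {g : Lp ℂ 2 m} {K : ℝ} (hK : 0 ≤ K)
    (h : ∀ f : Lp ℂ 2 m, ‖inner ℂ g f‖ ≤ K * ∫ a, ‖f a‖ ∂m) : ∀ᵐ a ∂m, ‖g a‖ ≤ K := by
  refine ae_le_of_forall_setIntegral_le ((Lp.memLp g).integrable one_le_two).norm
    (integrable_const K) fun A hA _ => ?_
  let θ : α → ℂ := A.indicator fun a => g a / ‖g a‖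
  have hθm : AEStronglyMeasurable θ m :=
    ((Lp.aestronglyMeasurable g).aemeasurable.div (Complex.continuous_ofReal.comp_aestronglyMeasurable
      (Lp.aestronglyMeasurable g).norm).aemeasurable).aestronglyMeasurable.indicator hA
  have hθn : ∀ a, ‖θ a‖ ≤ A.indicator (fun _ => (1 : ℝ)) a := by
    intro a
    by_cases ha : a ∈ A
    · simp only [θ, Set.indicator_of_mem ha, norm_div, Complex.norm_real, norm_norm]
      exact div_self_le_one _
    · simp only [θ, Set.indicator_of_notMem ha, norm_zero, le_refl]
  have hθ : MemLp θ 2 m := by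
    refine MemLp.of_bound hθm 1 (.of_forall fun a => (hθn a).trans ?_)
    exact Set.indicator_le_self' (fun _ _ => zero_le_one) a
  have h1 : inner ℂ g (hθ.toLp θ) = ((∫ a in A, ‖g a‖ ∂m : ℝ) : ℂ) := by
    rw [L2.inner_def, ← integral_indicator hA, ← integral_complex_ofReal]
    refine integral_congr_ae ?_
    filter_upwards [hθ.coeFn_toLp] with a ha
    rw [ha, RCLike.inner_apply]
    by_cases haA : a ∈ A
    · simp only [θ, Set.indicator_of_mem haA]
      by_cases h0 : g a = 0
      · simp [h0]
      · have h2 : (‖g a‖ : ℂ) ≠ 0 := by simpa using h0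
        rw [div_mul_eq_mul_div, Complex.mul_conj', sq, mul_div_assoc, div_self h2, mul_one]
    · simp only [θ, Set.indicator_of_notMem haA]
      simp
  have h2 : ∫ a, ‖hθ.toLp θ a‖ ∂m ≤ m.real A := by
    rw [← integral_indicator_one hA]
    refine integral_mono_ae ((Lp.memLp _).integrable one_le_two).norm
      ((integrable_const (1 : ℝ)).indicator hA) ?_
    filter_upwards [hθ.coeFn_toLp] with a ha
    rw [ha]
    exact hθn a
  have h3 := h (hθ.toLp θ)
  rw [h1, Complex.norm_real, Real.norm_of_nonneg (integral_nonneg fun _ => norm_nonneg _)] at h3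
  rw [setIntegral_const, smul_eq_mul, mul_comm]
  exact h3.trans (mul_le_mul_of_nonneg_left h2 hK)

/-- The exceptional null set depends on `c`, so the bound is first taken for a countable dense set
of coefficients and extended by continuity. -/
lemma ae_tsum_enorm_sq_le {m : Measure α} {φ : ℕ → α → ℂ} {C : ℝ≥0}
    (h : ∀ (N : ℕ) (c : Fin N → ℂ), ∀ᵐ a ∂m,
      ‖∑ i, c i * φ i a‖ ≤ √C * √(∑ i, ‖c i‖ ^ 2)) :
    ∀ᵐ a ∂m, ∑' n, ‖φ n a‖ₑ ^ 2 ≤ C := by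
  have h1 : ∀ᵐ a ∂m, ∀ N k : ℕ, ‖∑ i, TopologicalSpace.denseSeq (Fin N → ℂ) k i * φ i a‖
      ≤ √C * √(∑ i, ‖TopologicalSpace.denseSeq (Fin N → ℂ) k i‖ ^ 2) := by
    rw [ae_all_iff]
    intro N
    rw [ae_all_iff]
    exact fun k => h N _
  filter_upwards [h1] with a ha
  rw [ENNReal.tsum_eq_iSup_nat]
  refine iSup_le fun N => ?_
  have h2 : ∀ c : Fin N → ℂ, ‖∑ i, c i * φ i a‖ ≤ √C * √(∑ i, ‖c i‖ ^ 2) := by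
    intro c
    have hcl : IsClosed {c : Fin N → ℂ | ‖∑ i, c i * φ i a‖ ≤ √C * √(∑ i, ‖c i‖ ^ 2)} :=
      isClosed_le (by fun_prop) (by fun_prop)
    have hsub : closure (Set.range (TopologicalSpace.denseSeq (Fin N → ℂ)))
        ⊆ {c : Fin N → ℂ | ‖∑ i, c i * φ i a‖ ≤ √C * √(∑ i, ‖c i‖ ^ 2)} :=
      hcl.closure_subset_iff.2 (by rintro _ ⟨k, rfl⟩; exact ha N k)
    exact hsub (TopologicalSpace.denseRange_denseSeq _ c)
  -- The extremal coefficients: with `s = ∑ |φ_i(a)|²` the bound becomes `s ≤ √C √s`, that is `s ≤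
  -- C`.
  have h3 := h2 fun i => starRingEnd ℂ (φ i a)
  set s := ∑ i : Fin N, ‖φ i a‖ ^ 2 with hs
  have hs0 : 0 ≤ s := Finset.sum_nonneg fun _ _ => sq_nonneg _
  have h4 : ∑ i : Fin N, starRingEnd ℂ (φ i a) * φ i a = (s : ℂ) := by
    rw [hs, Complex.ofReal_sum]
    exact Finset.sum_congr rfl fun i _ => by rw [Complex.conj_mul']; simp
  simp only [h4, RCLike.norm_conj, Complex.norm_real, Real.norm_of_nonneg hs0] at h3
  have h5 : s ≤ C := by
    have h6 : √s * √s ≤ √C * √s := by rwa [Real.mul_self_sqrt hs0]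
    rcases eq_or_lt_of_le (Real.sqrt_nonneg s) with h7 | h7
    · have : s = 0 := (Real.sqrt_eq_zero hs0).1 h7.symm
      rw [this]; exact C.coe_nonneg
    · exact (Real.sqrt_le_sqrt_iff C.coe_nonneg).1 (le_of_mul_le_mul_right h6 h7)
  rw [hs, Fin.sum_univ_eq_sum_range (fun n => ‖φ n a‖ ^ 2)] at h5
  simp only [← ofReal_norm, ← ENNReal.ofReal_pow (norm_nonneg _)]
  rw [← ENNReal.ofReal_sum_of_nonneg fun _ _ => sq_nonneg _]
  exact (ENNReal.ofReal_le_ofReal h5).trans_eq ENNReal.ofReal_coe_nnreal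

end SetIntegral

/-! ### Rectangles determine a function; Hilbert–Schmidt kernels. -/

section ProductMeasure

variable {S : Type u} {T : Type v} [MeasurableSpace S] [MeasurableSpace T]

lemma ae_eq_of_forall_setIntegral_prod_eq {m : Measure S} {n : Measure T} [SFinite n]
    {Φ Ψ : S × T → ℂ} (hΦ : Integrable Φ (m.prod n))
    (hΨ : Integrable Ψ (m.prod n)) (h : ∀ A B, MeasurableSet A → MeasurableSet B →
      ∫ p in A ×ˢ B, Φ p ∂(m.prod n) = ∫ p in A ×ˢ B, Ψ p ∂(m.prod n)) :
    Φ =ᵐ[m.prod n] Ψ := by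
  refine hΦ.ae_eq_of_forall_setIntegral_eq _ _ hΨ fun E hE hlt => ?_
  clear hlt
  induction E, hE using MeasurableSpace.induction_on_inter generateFrom_prod.symm
    isPiSystem_prod with
  | empty => simp
  | basic E hE =>
    obtain ⟨A, hA, B, hB, rfl⟩ := hE
    exact h A B hA hB
  | compl E hE ih =>
    have h1 := h Set.univ Set.univ .univ .univ
    rw [Set.univ_prod_univ, setIntegral_univ, setIntegral_univ] at h1
    rw [setIntegral_compl hE hΦ, setIntegral_compl hE hΨ, ih, h1]
  | iUnion f hd hf ih =>
    rw [integral_iUnion hf hd hΦ.integrableOn, integral_iUnion hf hd hΨ.integrableOn]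
    exact tsum_congr ih

variable {μ : Measure S} {ν : Measure T} [SigmaFinite μ] [SigmaFinite ν]

/-- An integral operator with square integrable kernel vanishes on all but countably many
elements of an orthonormal basis. -/
lemma countable_integralOperator_ne_zero {h : S × T → ℂ} (hh : MemLp h 2 (μ.prod ν)) {ι : Type*}
    (b : HilbertBasis ι ℂ (Lp ℂ 2 ν)) : {i | integralOperator h hh (b i) ≠ 0}.Countable := by
  have h1 : ∑' i, ‖integralOperator h hh (b i)‖ₑ ^ 2 ≤ eLpNorm h 2 (μ.prod ν) ^ 2 := by
    rw [ENNReal.tsum_eq_iSup_sum]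
    refine iSup_le fun F => ?_
    have h2 : ∀ i, ‖integralOperator h hh (b i)‖ₑ ^ 2
        = ∫⁻ s, ‖kernelIntegral ν h (b i) s‖ₑ ^ 2 ∂μ := fun i =>
      enorm_toLp_sq (kernelIntegral_memLp hh (Lp.memLp (b i)))
    simp only [h2]
    rw [← lintegral_finsetSum' _ fun i _ =>
      (kernelIntegral_aestronglyMeasurable hh (Lp.memLp (b i))).enorm.pow_const 2,
      eLpNorm_two_sq, lintegral_prod _ (hh.1.enorm.pow_const 2)]
    refine lintegral_mono_ae ?_
    filter_upwards [kernel_section_memLp hh] with s hs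
    -- For almost every `s`, the values `(I_h b_i)(s)` are, up to conjugation, the coordinates of
    -- the conjugate of `h(s, ·)`, so Parseval in each section gives the Hilbert–Schmidt bound.
    have h3 : ∀ i, ‖kernelIntegral ν h (b i) s‖ₑ = ‖inner ℂ (b i) (hs.conj.toLp _)‖ₑ := by
      intro i
      rw [← RCLike.enorm_conj (inner ℂ _ _), inner_conj_symm, L2.inner_def, kernelIntegral]
      congr 1
      refine integral_congr_ae ?_
      filter_upwards [hs.conj.coeFn_toLp] with t ht
      rw [ht, RCLike.inner_apply, RCLike.conj_conj, mul_comm]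
    simp only [h3]
    refine (ENNReal.sum_le_tsum F).trans ?_
    rw [b.tsum_enorm_inner_sq, enorm_toLp_sq]
    simp only [RCLike.enorm_conj, le_refl]
  refine (Summable.countable_support_ennreal
    (ne_top_of_le_ne_top (ENNReal.pow_ne_top hh.2.ne) h1)).mono fun i hi => ?_
  simpa using hi

end ProductMeasure

/-! ### Expansions from Hilbert space factorizations. -/

section Expansion

variable {S : Type u} {T : Type v} [MeasurableSpace S] [MeasurableSpace T]

lemma coeFn_sum_smul {α ι : Type*} [MeasurableSpace α] {l : Measure α} [Fintype ι] (c : ι → ℂ)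
    (f : ι → Lp ℂ 2 l) : ∀ᵐ a ∂l, (∑ i, c i • f i : Lp ℂ 2 l) a = ∑ i, c i * f i a := by
  have h1 : ∀ᵐ a ∂l, ∀ i, (c i • f i : Lp ℂ 2 l) a = c i * f i a := by
    rw [ae_all_iff]
    intro i
    filter_upwards [Lp.coeFn_smul (c i) (f i)] with a ha
    rw [ha, Pi.smul_apply, smul_eq_mul]
  filter_upwards [h1, Lp.coeFn_finsetSum Finset.univ fun i => c i • f i] with a h2 h3
  rw [h3, Finset.sum_apply]
  exact Finset.sum_congr rfl fun i _ => h2 i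

lemma memLp_two_of_lintegral_sq_lt_top {α : Type*} [MeasurableSpace α] {m : Measure α}
    {r : α → ℝ≥0} (hr : Measurable r) (hri : ∫⁻ a, (r a : ℝ≥0∞) ^ 2 ∂m < ∞) :
    MemLp (fun a => ((r a : ℝ) : ℂ)) 2 m := by
  refine ⟨(Complex.measurable_ofReal.comp hr.coe_nnreal_real).aestronglyMeasurable, ?_⟩
  have h1 : eLpNorm (fun a => ((r a : ℝ) : ℂ)) 2 m ^ 2 < ∞ := by
    rw [eLpNorm_two_sq]
    simpa [enorm] using hri
  exact (ENNReal.pow_lt_top_iff.1 h1).resolve_right two_ne_zero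

lemma IsBoundedExpansion.of_ae_le {m : Measure S} {n : Measure T} [SigmaFinite m]
    [SigmaFinite n] {φ : ℕ → S → ℂ} {ψ : ℕ → T → ℂ} {C : ℝ≥0}
    (hφm : ∀ k, AEStronglyMeasurable (φ k) m) (hψm : ∀ k, AEStronglyMeasurable (ψ k) n)
    (hφ : ∀ᵐ s ∂m, ∑' k, ‖φ k s‖ₑ ^ 2 ≤ C) (hψ : ∀ᵐ t ∂n, ∑' k, ‖ψ k t‖ₑ ^ 2 ≤ C) :
    IsBoundedExpansion m n (fun p => ∑' k, φ k p.1 * ψ k p.2) C φ ψ := by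
  have hC : (C : ℝ≥0∞) = ((NNReal.sqrt C : ℝ≥0) : ℝ≥0∞) ^ 2 := by
    rw [← ENNReal.coe_pow, NNReal.sq_sqrt]
  have key : ∀ {z : ℕ → ℂ}, ∑' k, ‖z k‖ₑ ^ 2 ≤ C → ∀ k, ‖z k‖ ≤ NNReal.sqrt C := by
    intro z hz k
    have h1 := (ENNReal.le_tsum k).trans hz
    rw [hC, ENNReal.pow_le_pow_left_iff two_ne_zero] at h1
    exact enorm_le_coe.1 h1
  refine ⟨fun k => memLp_top_of_bound (hφm k) (NNReal.sqrt C) (hφ.mono fun s hs => key hs k),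
    fun k => memLp_top_of_bound (hψm k) (NNReal.sqrt C) (hψ.mono fun t ht => key ht k), ?_, hφ, hψ⟩
  filter_upwards [Measure.quasiMeasurePreserving_fst.ae hφ,
    Measure.quasiMeasurePreserving_snd.ae hψ] with p h1 h2
  refine (Summable.of_enorm ?_).hasSum
  simp only [enorm_mul]
  exact ((ENNReal.tsum_mul_le_of_tsum_sq_le (h1.trans_eq hC) (h2.trans_eq hC)).trans_lt
    (by finiteness)).ne

section Finite

variable {m : Measure S} {n : Measure T} [IsFiniteMeasure m] [IsFiniteMeasure n]

lemma inner_indicator_integralOperator_indicator {h : S × T → ℂ} (hh : MemLp h 2 (m.prod n))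
    {A : Set S} (hA : MeasurableSet A) {B : Set T} (hB : MeasurableSet B) :
    inner ℂ (indicatorConstLp 2 hA (measure_ne_top m _) 1)
      (integralOperator h hh (indicatorConstLp 2 hB (measure_ne_top n _) 1))
      = ∫ p in A ×ˢ B, h p ∂(m.prod n) := by
  rw [inner_integralOperator, ← integral_indicator (hA.prod hB)]
  refine integral_congr_ae ?_
  filter_upwards [Measure.quasiMeasurePreserving_fst.ae
      (indicatorConstLp_coeFn (p := 2) (hs := hA) (hμs := measure_ne_top m _) (c := (1 : ℂ))),
    Measure.quasiMeasurePreserving_snd.ae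
      (indicatorConstLp_coeFn (p := 2) (hs := hB) (hμs := measure_ne_top n _) (c := (1 : ℂ)))]
    with p h1 h2
  rw [h1, h2]
  by_cases ha : p.1 ∈ A
  · by_cases hb : p.2 ∈ B
    · have hp : p ∈ A ×ˢ B := ⟨ha, hb⟩
      rw [Set.indicator_of_mem ha, Set.indicator_of_mem hb, Set.indicator_of_mem hp]
      simp
    · have hp : p ∉ A ×ˢ B := fun hp => hb hp.2
      rw [Set.indicator_of_notMem hb, Set.indicator_of_notMem hp]
      simp
  · have hp : p ∉ A ×ˢ B := fun hp => ha hp.1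
    rw [Set.indicator_of_notMem ha, Set.indicator_of_notMem hp]
    simp

/-- `X` and `Y` need not have separable range, so a countable family of coordinates is not available
at once. However, `X* Y` has the square integrable kernel `conj Φ`, hence kills all but countably
many basis vectors, and only the part of `Y` inside the closed range of `X` matters for `⟨Y g, X
f⟩`. -/
lemma exists_boundedExpansion_of_factorization {Φ : S × T → ℂ} {C : ℝ≥0}
    (hΦ : MemLp Φ 2 (m.prod n)) {H : Type*} [NormedAddCommGroup H] [InnerProductSpace ℂ H]
    [CompleteSpace H] {X : Lp ℂ 2 m →L[ℂ] H} {Y : Lp ℂ 2 n →L[ℂ] H}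
    (hX : ∀ f, ‖X f‖ ≤ √C * ∫ s, ‖f s‖ ∂m) (hY : ∀ g, ‖Y g‖ ≤ √C * ∫ t, ‖g t‖ ∂n)
    (hXY : ∀ A (hA : MeasurableSet A) B (hB : MeasurableSet B),
      inner ℂ (Y (indicatorConstLp 2 hB (measure_ne_top n _) 1))
        (X (indicatorConstLp 2 hA (measure_ne_top m _) 1)) = ∫ p in A ×ˢ B, Φ p ∂(m.prod n)) :
    ∃ φ ψ, IsBoundedExpansion m n Φ C φ ψ := by
  have hΦint : Integrable Φ (m.prod n) := hΦ.integrable one_le_two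
  -- The mixed Gram operator is an integral operator.
  have hop : ContinuousLinearMap.adjoint X ∘L Y = integralOperator _ hΦ.conj := by
    refine sub_eq_zero.1 ?_
    set D := ContinuousLinearMap.adjoint X ∘L Y - integralOperator _ hΦ.conj with hD
    have hD0 : ∀ A (hA : MeasurableSet A) B (hB : MeasurableSet B),
        inner ℂ (indicatorConstLp 2 hA (measure_ne_top m _) 1)
          (D (indicatorConstLp 2 hB (measure_ne_top n _) 1)) = 0 := by
      intro A hA B hB
      have h1 : D (indicatorConstLp 2 hB (measure_ne_top n _) 1)
          = ContinuousLinearMap.adjoint X (Y (indicatorConstLp 2 hB (measure_ne_top n _) 1))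
            - integralOperator _ hΦ.conj (indicatorConstLp 2 hB (measure_ne_top n _) 1) := rfl
      rw [h1, inner_sub_right, ContinuousLinearMap.adjoint_inner_right,
        inner_indicator_integralOperator_indicator, ← inner_conj_symm, hXY A hA B hB, integral_conj,
        sub_self]
    have hD1 : ContinuousLinearMap.adjoint D = 0 := by
      ext1 v
      refine eq_zero_of_inner_indicator_eq_zero fun B hB => ?_
      rw [ContinuousLinearMap.adjoint_inner_right]
      have h2 : D (indicatorConstLp 2 hB (measure_ne_top n _) 1) = 0 :=
        eq_zero_of_inner_indicator_eq_zero fun A hA => hD0 A hA B hB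
      rw [h2, inner_zero_left]
    have h3 := congrArg ContinuousLinearMap.adjoint hD1
    rwa [ContinuousLinearMap.adjoint_adjoint, map_zero] at h3
  -- Compression to the closure of the range of `X` gives an operator with separable range.
  let M : Submodule ℂ H := (LinearMap.range X.toLinearMap).topologicalClosure
  have : CompleteSpace M := (Submodule.isClosed_topologicalClosure _).completeSpace_coe
  let q : H →L[ℂ] H := M.subtypeL ∘L M.orthogonalProjectionOnto
  have hq_inner : ∀ a f, inner ℂ (q a) (X f) = inner ℂ a (X f) := by
    intro a f
    have hmem : X f ∈ M := Submodule.le_topologicalClosure _ ⟨f, rfl⟩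
    exact Submodule.inner_orthogonalProjectionOnto_eq_of_mem_left (⟨X f, hmem⟩ : M) a |> fun h => by
      have h' := congrArg (starRingEnd ℂ) h
      rw [inner_conj_symm, inner_conj_symm] at h'
      exact h'
  have hq_norm : ∀ a, ‖q a‖ ≤ ‖a‖ := fun a => M.norm_orthogonalProjectionOnto_apply_le a
  have hq_zero : ∀ a, ContinuousLinearMap.adjoint X a = 0 → q a = 0 := by
    intro a ha
    have hperp : a ∈ Mᗮ := by
      rw [Submodule.orthogonal_closure, Submodule.mem_orthogonal]
      rintro _ ⟨f, rfl⟩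
      change inner ℂ (X f) a = 0
      rw [← ContinuousLinearMap.adjoint_inner_right, ha, inner_zero_right]
    change ((M.orthogonalProjectionOnto a : M) : H) = 0
    rw [Submodule.orthogonalProjectionOnto_eq_zero_iff.2 hperp]
    rfl
  let b := onb (Lp ℂ 2 n)
  -- For `i ∉ I` the vector `Y (b i)` is orthogonal to the range of `X`, so `q (Y (b i)) = 0`; thus
  -- the countable family indexed by `I` spans a dense part of the range of `q ∘L Y`.
  let I := {i | integralOperator _ hΦ.conj (b i) ≠ 0}
  have hI : I.Countable := countable_integralOperator_ne_zero hΦ.conj b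
  obtain ⟨u, horth, hnorm, hu⟩ := exists_orthogonal_sequence
    (hI.image fun i => q (Y (b i)))
  have hmem : ∀ g, q (Y g) ∈ (Submodule.span ℂ ((fun i => q (Y (b i))) '' I)).topologicalClosure := by
    let K := (Submodule.span ℂ ((fun i => q (Y (b i))) '' I)).topologicalClosure
    have h1 : ∀ i, q (Y (b i)) ∈ K := by
      intro i
      by_cases hi : i ∈ I
      · exact Submodule.le_topologicalClosure _ (Submodule.subset_span ⟨i, hi, rfl⟩)
      · have h2 : integralOperator _ hΦ.conj (b i) = 0 := not_not.1 hi
        rw [← hop] at h2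
        rw [hq_zero (Y (b i)) h2]
        exact K.zero_mem
    intro g
    have h2 : (Submodule.span ℂ (Set.range b)).topologicalClosure
        ≤ K.comap (q ∘L Y).toLinearMap := by
      refine Submodule.topologicalClosure_minimal _ ?_
        ((Submodule.isClosed_topologicalClosure _).preimage (q ∘L Y).continuous)
      rw [Submodule.span_le]
      rintro _ ⟨i, rfl⟩
      exact h1 i
    rw [b.dense_span] at h2
    exact h2 (Submodule.mem_top (x := g))
  -- The coordinate functionals `f ↦ ⟨u_k, X f⟩` and `g ↦ ⟨q (Y g), u_k⟩` are represented by these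
  -- functions up to conjugation; the conjugate of `φ₀ k` and `ψ₀ k` are the factors of the
  -- expansion.
  let φ₀ := fun k => ContinuousLinearMap.adjoint X (u k)
  let ψ₀ := fun k => ContinuousLinearMap.adjoint (q ∘L Y) (u k)
  have hsumle : ∀ (N : ℕ) (c : Fin N → ℂ), ‖∑ i, c i • u i‖ ≤ √(∑ i, ‖c i‖ ^ 2) := fun N c =>
    Real.le_sqrt_of_sq_le (norm_sum_smul_sq_le (e := fun i : Fin N => u i)
      (fun i j hij => horth fun h => hij (Fin.ext h)) (fun i => hnorm i) c)
  have hφle : ∀ᵐ s ∂m, ∑' k, ‖starRingEnd ℂ (φ₀ k s)‖ₑ ^ 2 ≤ C := by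
    simp only [RCLike.enorm_conj]
    refine ae_tsum_enorm_sq_le fun N c => ?_
    have h1 : ∑ i : Fin N, c i • φ₀ i = ContinuousLinearMap.adjoint X (∑ i, c i • u i) := by
      simp only [map_sum, map_smul, φ₀]
    have h2 := ae_norm_le_of_norm_inner_le (g := ∑ i : Fin N, c i • φ₀ i)
      (K := √C * √(∑ i, ‖c i‖ ^ 2)) (by positivity) fun f => by
        rw [h1, ContinuousLinearMap.adjoint_inner_left]
        calc _ ≤ ‖∑ i, c i • u i‖ * ‖X f‖ := norm_inner_le_norm _ _
          _ ≤ √(∑ i, ‖c i‖ ^ 2) * (√C * ∫ s, ‖f s‖ ∂m) := by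
            gcongr
            exacts [hsumle N c, hX f]
          _ = _ := by ring
    filter_upwards [h2, coeFn_sum_smul c fun i : Fin N => φ₀ i] with s h3 h4
    rwa [h4] at h3
  have hψle : ∀ᵐ t ∂n, ∑' k, ‖ψ₀ k t‖ₑ ^ 2 ≤ C := by
    refine ae_tsum_enorm_sq_le fun N c => ?_
    have h1 : ∑ i : Fin N, c i • ψ₀ i
        = ContinuousLinearMap.adjoint (q ∘L Y) (∑ i, c i • u i) := by
      simp only [map_sum, map_smul, ψ₀]
    have h2 := ae_norm_le_of_norm_inner_le (g := ∑ i : Fin N, c i • ψ₀ i)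
      (K := √C * √(∑ i, ‖c i‖ ^ 2)) (by positivity) fun g => by
        rw [h1, ContinuousLinearMap.adjoint_inner_left]
        calc _ ≤ ‖∑ i, c i • u i‖ * ‖q (Y g)‖ := norm_inner_le_norm _ _
          _ ≤ √(∑ i, ‖c i‖ ^ 2) * (√C * ∫ t, ‖g t‖ ∂n) := by
            gcongr
            exacts [hsumle N c, (hq_norm _).trans (hY g)]
          _ = _ := by ring
    filter_upwards [h2, coeFn_sum_smul c fun i : Fin N => ψ₀ i] with t h3 h4
    rwa [h4] at h3
  have hexp := IsBoundedExpansion.of_ae_le (m := m) (n := n)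
    (fun k => (Lp.memLp (φ₀ k)).conj.1) (fun k => (Lp.memLp (ψ₀ k)).1) hφle hψle
  have hae := ae_eq_of_forall_setIntegral_prod_eq hΦint
    (hexp.memLp_top.integrable le_top) fun A B hA hB => by
      have h1 := hexp.hasSum_integral (g := (A ×ˢ B).indicator 1)
        ((integrable_const (1 : ℂ)).indicator (hA.prod hB))
      have h2 := hu _ (hmem (indicatorConstLp 2 hB (measure_ne_top n _) 1))
        (X (indicatorConstLp 2 hA (measure_ne_top m _) 1))
      rw [hq_inner, hXY A hA B hB] at h2
      have h3 : ∀ F : S × T → ℂ, ∫ p, F p * (A ×ˢ B).indicator 1 p ∂(m.prod n)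
          = ∫ p in A ×ˢ B, F p ∂(m.prod n) := fun F => by
        rw [← integral_indicator (hA.prod hB)]
        congr 1 with p
        by_cases hp : p ∈ A ×ˢ B
        · rw [Set.indicator_of_mem hp, Set.indicator_of_mem hp, Pi.one_apply, mul_one]
        · rw [Set.indicator_of_notMem hp, Set.indicator_of_notMem hp, mul_zero]
      rw [h3] at h1
      refine h2.unique ?_
      convert h1 using 2 with k
      rw [h3, setIntegral_prod_mul (fun s => starRingEnd ℂ (φ₀ k s)) (fun t => ψ₀ k t), mul_comm,
        integral_conj, ← L2.inner_indicatorConstLp_one hA (measure_ne_top m _),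
        ← L2.inner_indicatorConstLp_one hB (measure_ne_top n _),
        ContinuousLinearMap.adjoint_inner_right, ContinuousLinearMap.adjoint_inner_right,
        inner_conj_symm]
      rfl
  refine ⟨_, _, hexp.left_memLp, hexp.right_memLp, ?_, hexp.left_le, hexp.right_le⟩
  filter_upwards [hexp.hasSum, hae] with p h1 h2
  rwa [h2]

end Finite

lemma exists_finite_density {α : Type*} [MeasurableSpace α] (m : Measure α) [SigmaFinite m] :
    ∃ ρ : α → ℝ≥0, Measurable ρ ∧ (∀ a, 0 < ρ a) ∧ ∫⁻ a, (ρ a : ℝ≥0∞) ^ 2 ∂m < ∞ := by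
  obtain ⟨g, hg, hgm, hgi⟩ := exists_pos_lintegral_lt_of_sigmaFinite m one_ne_zero
  refine ⟨fun a => NNReal.sqrt (g a), NNReal.continuous_sqrt.measurable.comp hgm,
    fun a => NNReal.sqrt_pos.2 (hg a), ?_⟩
  simp only [← ENNReal.coe_pow, NNReal.sq_sqrt]
  exact hgi.trans ENNReal.one_lt_top

lemma memLp_top_of_absolutelyContinuous {α : Type*} [MeasurableSpace α] {m m' : Measure α}
    (h : m ≪ m') {f : α → ℂ} (hf : MemLp f ∞ m') : MemLp f ∞ m :=
  ⟨hf.1.mono_ac h, (by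
    rw [eLpNorm_exponent_top]
    exact (eLpNormEssSup_mono_measure f h).trans_lt (eLpNorm_exponent_top (f := f) ▸ hf.2))⟩

variable {μ : Measure S} {ν : Measure T} [SigmaFinite μ] [SigmaFinite ν]

/-- Positive densities turn `μ` and `ν` into finite measures with the same null sets. Every
condition in a bounded expansion is an almost everywhere statement, so it carries back unchanged. -/
lemma HasBilinearBound.exists_boundedExpansion {Φ : S × T → ℂ} {C : ℝ≥0}
    (hm : AEStronglyMeasurable Φ (μ.prod ν)) (h : HasBilinearBound μ ν Φ C) :
    ∃ φ ψ, IsBoundedExpansion μ ν Φ C φ ψ := by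
  obtain ⟨ρ, hρ, hρ0, hρi⟩ := exists_finite_density μ
  obtain ⟨θ, hθ, hθ0, hθi⟩ := exists_finite_density ν
  have : IsFiniteMeasure (μ.withDensity fun s => (ρ s : ℝ≥0∞) ^ 2) :=
    isFiniteMeasure_withDensity hρi.ne
  have : IsFiniteMeasure (ν.withDensity fun t => (θ t : ℝ≥0∞) ^ 2) :=
    isFiniteMeasure_withDensity hθi.ne
  have hgrid := h.hasGridFactorization hρ hθ
  have hμ : μ ≪ μ.withDensity fun s => (ρ s : ℝ≥0∞) ^ 2 :=
    withDensity_absolutelyContinuous' (hρ.coe_nnreal_ennreal.pow_const 2).aemeasurable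
      (.of_forall fun s => pow_ne_zero 2 (ENNReal.coe_ne_zero.2 (hρ0 s).ne'))
  have hν : ν ≪ ν.withDensity fun t => (θ t : ℝ≥0∞) ^ 2 :=
    withDensity_absolutelyContinuous' (hθ.coe_nnreal_ennreal.pow_const 2).aemeasurable
      (.of_forall fun t => pow_ne_zero 2 (ENNReal.coe_ne_zero.2 (hθ0 t).ne'))
  -- Square integrability for the new measures says that `Φ (ρ ⊗ θ)` is in `L²(μ × ν)`, which is the
  -- first clause of the bilinear bound at `a = ρ`, `c = θ`.
  have hΦ2 : MemLp Φ 2 ((μ.withDensity fun s => (ρ s : ℝ≥0∞) ^ 2).prod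
      (ν.withDensity fun t => (θ t : ℝ≥0∞) ^ 2)) := by
    refine ⟨hm.mono_ac ((withDensity_absolutelyContinuous _ _).prod
      (withDensity_absolutelyContinuous _ _)), ?_⟩
    have h1 := ENNReal.pow_lt_top (n := 2) (h _ _ (memLp_two_of_lintegral_sq_lt_top hρ hρi)
      (memLp_two_of_lintegral_sq_lt_top hθ hθi)).1.2
    refine (ENNReal.pow_lt_top_iff (n := 2).1 ?_).resolve_right two_ne_zero
    rw [eLpNorm_two_sq] at h1 ⊢
    have h2 : Measurable fun p : S × T => (ρ p.1 : ℝ≥0∞) ^ 2 * (θ p.2 : ℝ≥0∞) ^ 2 := by fun_prop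
    rw [prod_withDensity (hρ.coe_nnreal_ennreal.pow_const 2) (hθ.coe_nnreal_ennreal.pow_const 2),
      lintegral_withDensity_eq_lintegral_mul₀ h2.aemeasurable (hm.enorm.pow_const 2)]
    refine lt_of_eq_of_lt (lintegral_congr fun p => ?_) h1
    simp only [Pi.mul_apply, enorm_mul, mul_pow]
    rw [mul_comm]
    simp [enorm]
  generalize (μ.withDensity fun s => (ρ s : ℝ≥0∞) ^ 2) = m at *
  generalize (ν.withDensity fun t => (θ t : ℝ≥0∞) ^ 2) = n at *
  obtain ⟨X, Y, hX, hY, hXY⟩ := hgrid.exists_bilinear_factorization (hΦ2.integrable one_le_two)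
  obtain ⟨φ, ψ, hexp⟩ := exists_boundedExpansion_of_factorization hΦ2 hX hY hXY
  exact ⟨φ, ψ, fun k => memLp_top_of_absolutelyContinuous hμ (hexp.left_memLp k),
    fun k => memLp_top_of_absolutelyContinuous hν (hexp.right_memLp k),
    (hμ.prod hν).ae_le hexp.hasSum, hμ.ae_le hexp.left_le, hν.ae_le hexp.right_le⟩

end Expansion

/-! ### Hilbert space valued and Haagerup representations, and the norms. -/

section Representations

variable {S : Type u} {T : Type v} [MeasurableSpace S] [MeasurableSpace T]
  {μ : Measure S} {ν : Measure T} [SigmaFinite μ] [SigmaFinite ν]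

lemma ENNReal.rpow_half_sq (a : ℝ≥0∞) : (a ^ (1 / 2 : ℝ)) ^ 2 = a := by
  rw [← ENNReal.rpow_natCast, ← ENNReal.rpow_mul]
  norm_num

lemma IsBoundedExpansion.of_hasSum {Φ : S × T → ℂ} {φ : ℕ → S → ℂ} {ψ : ℕ → T → ℂ} {C : ℝ≥0}
    (hφm : ∀ k, AEStronglyMeasurable (φ k) μ) (hψm : ∀ k, AEStronglyMeasurable (ψ k) ν)
    (hsum : ∀ᵐ p ∂(μ.prod ν), HasSum (fun k => φ k p.1 * ψ k p.2) (Φ p))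
    (hφ : ∀ᵐ s ∂μ, ∑' k, ‖φ k s‖ₑ ^ 2 ≤ C) (hψ : ∀ᵐ t ∂ν, ∑' k, ‖ψ k t‖ₑ ^ 2 ≤ C) :
    IsBoundedExpansion μ ν Φ C φ ψ :=
  have h := IsBoundedExpansion.of_ae_le hφm hψm hφ hψ
  ⟨h.left_memLp, h.right_memLp, hsum, hφ, hψ⟩

/-- Balancing the two factors of an expansion. -/
lemma exists_boundedExpansion_of_mul_le {Φ : S × T → ℂ} {φ : ℕ → S → ℂ} {ψ : ℕ → T → ℂ}
    {a b : ℝ≥0∞} {C : ℝ≥0} (hC : 0 < C) (ha : a ≠ ∞) (hb : b ≠ ∞) (hab : a * b ≤ C)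
    (hφm : ∀ k, AEStronglyMeasurable (φ k) μ) (hψm : ∀ k, AEStronglyMeasurable (ψ k) ν)
    (hsum : ∀ᵐ p ∂(μ.prod ν), HasSum (fun k => φ k p.1 * ψ k p.2) (Φ p))
    (hφ : ∀ᵐ s ∂μ, ∑' k, ‖φ k s‖ₑ ^ 2 ≤ a ^ 2) (hψ : ∀ᵐ t ∂ν, ∑' k, ‖ψ k t‖ₑ ^ 2 ≤ b ^ 2) :
    ∃ φ' ψ', IsBoundedExpansion μ ν Φ C φ' ψ' := by
  lift a to ℝ≥0 using ha
  lift b to ℝ≥0 using hb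
  -- When `a = 0` no scalar can balance the factors, but then `Φ` vanishes almost everywhere and the
  -- zero expansion works.
  by_cases ha0 : a = 0
  · refine ⟨fun _ _ => 0, fun _ _ => 0, .of_hasSum (fun _ => aestronglyMeasurable_const)
      (fun _ => aestronglyMeasurable_const) ?_ (by simp) (by simp)⟩
    filter_upwards [hsum, Measure.quasiMeasurePreserving_fst.ae hφ] with p h1 h2
    have h3 : ∀ k, φ k p.1 = 0 := fun k => by
      have h4 := (ENNReal.le_tsum k).trans h2
      simpa [ha0] using h4
    simpa only [h3, zero_mul] using h1
  have ha0' : 0 < a := pos_iff_ne_zero.2 ha0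
  -- Scaling by `t` raises the left square sum to `t² a² = C`; the right one becomes `(a b)² / C ≤
  -- C`.
  set t : ℝ≥0 := NNReal.sqrt C / a with ht
  have ht0 : t ≠ 0 := (div_pos (NNReal.sqrt_pos.2 hC) ha0').ne'
  have hta : t ^ 2 * a ^ 2 = C := by
    rw [← mul_pow, ht, div_mul_cancel₀ _ ha0, NNReal.sq_sqrt]
  have htb : (t⁻¹) ^ 2 * b ^ 2 ≤ C := by
    have hab' : a * b ≤ C := by exact_mod_cast hab
    have h1 : (t⁻¹) ^ 2 * b ^ 2 = (a * b) ^ 2 / C := by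
      rw [ht, inv_div, div_pow, NNReal.sq_sqrt]
      ring
    rw [h1, div_le_iff₀ hC, ← sq]
    exact pow_le_pow_left' hab' 2
  have hscale : ∀ (r c : ℝ≥0) (z : ℕ → ℂ), ∑' k, ‖z k‖ₑ ^ 2 ≤ (c : ℝ≥0∞) ^ 2 →
      r ^ 2 * c ^ 2 ≤ C → ∑' k, ‖((r : ℝ) : ℂ) * z k‖ₑ ^ 2 ≤ (C : ℝ≥0∞) := by
    intro r c z hz hrc
    have hr : ‖((r : ℝ) : ℂ)‖ₑ = r := by simp [enorm]
    simp only [enorm_mul, mul_pow, hr]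
    rw [ENNReal.tsum_mul_left]
    exact (mul_le_mul_right hz _).trans (by exact_mod_cast hrc)
  refine ⟨fun k s => ((t : ℝ) : ℂ) * φ k s, fun k y => (((t⁻¹ : ℝ≥0) : ℝ) : ℂ) * ψ k y,
    .of_hasSum (fun k => (hφm k).const_mul _) (fun k => (hψm k).const_mul _) ?_
    (hφ.mono fun s hs => hscale _ _ _ hs hta.le) (hψ.mono fun y hy => hscale _ _ _ hy htb)⟩
  filter_upwards [hsum] with p hp
  refine hp.congr_fun fun k => ?_
  have ht0' : (t : ℂ) ≠ 0 := by exact_mod_cast ht0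
  push_cast
  field_simp

/-- A Hilbert space valued representation gives an expansion. -/
lemma exists_boundedExpansion_of_inner {H : Type*} [NormedAddCommGroup H]
    [InnerProductSpace ℂ H] [CompleteSpace H] {Φ : S × T → ℂ} {C : ℝ≥0} (hC : 0 < C) {x : S → H}
    {y : T → H} (hx : MemLp x ∞ μ) (hy : MemLp y ∞ ν)
    (hxy : ∀ᵐ p ∂(μ.prod ν), Φ p = inner ℂ (y p.2) (x p.1))
    (hle : eLpNorm x ∞ μ * eLpNorm y ∞ ν ≤ C) :
    ∃ φ ψ, IsBoundedExpansion μ ν Φ C φ ψ := by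
  obtain ⟨c, hc, hcl⟩ := hx.1.stronglyMeasurable_mk.isSeparable_range
  -- Strong measurability makes the essential range of `x` separable. The range of `y` is not
  -- needed, since Parseval requires only `x` in the closed span.
  obtain ⟨u, horth, hnorm, hu⟩ := exists_orthogonal_sequence hc
  have hbound : ∀ {a : H} {r : ℝ≥0∞}, ‖a‖ₑ ≤ r → ∑' k, ‖inner ℂ (u k) a‖ₑ ^ 2 ≤ r ^ 2 :=
    fun h => (tsum_enorm_inner_sq_le horth hnorm _).trans (pow_le_pow_left' h 2)
  refine exists_boundedExpansion_of_mul_le (φ := fun k s => inner ℂ (u k) (x s))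
    (ψ := fun k t => inner ℂ (y t) (u k)) hC hx.2.ne hy.2.ne hle
    (fun k => aestronglyMeasurable_const.inner hx.1)
    (fun k => hy.1.inner aestronglyMeasurable_const) ?_ ?_ ?_
  · filter_upwards [hxy, Measure.quasiMeasurePreserving_fst.ae hx.1.ae_eq_mk] with p h1 h2
    have hmem : x p.1 ∈ (Submodule.span ℂ c).topologicalClosure := by
      rw [h2]
      exact closure_mono Submodule.subset_span (hcl ⟨p.1, rfl⟩)
    have h3 := Complex.hasSum_conj'.2 (hu _ hmem (y p.2))
    rw [inner_conj_symm, ← h1] at h3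
    refine h3.congr_fun fun k => ?_
    rw [map_mul, inner_conj_symm, inner_conj_symm]
  · filter_upwards [enorm_ae_le_eLpNormEssSup x μ] with s hs
    rw [eLpNorm_exponent_top]
    exact hbound hs
  · filter_upwards [enorm_ae_le_eLpNormEssSup y ν] with t ht
    rw [eLpNorm_exponent_top]
    have h1 : ∀ k, ‖inner ℂ (y t) (u k)‖ₑ = ‖inner ℂ (u k) (y t)‖ₑ := fun k => by
      rw [← inner_conj_symm, RCLike.enorm_conj]
    simp only [h1]
    exact hbound ht

/-- A square summable sequence of functions as a strongly measurable `ℓ²`-valued function. -/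
lemma exists_ellTwo_valued {α : Type*} [MeasurableSpace α] {m : Measure α} {φ : ℕ → α → ℂ}
    {C : ℝ≥0} (hφm : ∀ k, AEStronglyMeasurable (φ k) m)
    (hφ : ∀ᵐ a ∂m, ∑' k, ‖φ k a‖ₑ ^ 2 ≤ C) :
    ∃ x : α → lp (fun _ : ULift.{w} ℕ => ℂ) 2, AEStronglyMeasurable x m ∧
      ∀ᵐ a ∂m, (∀ k, x a k = φ k.down a) ∧ ‖x a‖ₑ ^ 2 ≤ C := by
  classical
  have hmem : ∀ a, ∑' k, ‖φ k a‖ₑ ^ 2 ≤ C →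
      Memℓp (fun k : ULift.{w} ℕ => φ k.down a) 2 := by
    intro a ha
    refine memℓp_gen ?_
    have h1 : Summable fun k => ‖φ k a‖ ^ 2 := by
      have h2 := ENNReal.summable_toReal (ne_top_of_le_ne_top ENNReal.coe_ne_top ha)
      simpa using h2
    have h2 := (Equiv.ulift.{w} (α := ℕ)).summable_iff.2 h1
    simpa [Function.comp_def] using h2
  -- `x` is set to zero on the null set where the square sum exceeds `C`. Indexing `ℓ²` by `ULift ℕ`
  -- places the Hilbert space in an arbitrary universe.
  let x : α → lp (fun _ : ULift.{w} ℕ => ℂ) 2 := fun a =>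
    if ha : ∑' k, ‖φ k a‖ₑ ^ 2 ≤ C then ⟨_, hmem a ha⟩ else 0
  have hx : ∀ᵐ a ∂m, ∀ k, x a k = φ k.down a := by
    filter_upwards [hφ] with a ha k
    simp only [x, dif_pos ha]
  refine ⟨x, ?_, ?_⟩
  · refine aestronglyMeasurable_of_tendsto_ae (u := (Filter.atTop : Filter (Finset (ULift.{w} ℕ))))
      (f := fun F a => ∑ k ∈ F, φ k.down a • lp.single 2 k (1 : ℂ)) (fun F => ?_) ?_
    · exact Finset.aestronglyMeasurable_fun_sum _ fun k _ => (hφm k.down).smul_const _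
    · filter_upwards [hx] with a ha
      have h1 := lp.hasSum_single (by simp : (2 : ℝ≥0∞) ≠ ∞) (x a)
      refine h1.congr fun F => Finset.sum_congr rfl fun k _ => ?_
      rw [← lp.single_smul, smul_eq_mul, mul_one, ← ha]
  · filter_upwards [hx, hφ] with a ha hle
    refine ⟨ha, ?_⟩
    refine le_trans (le_of_eq ?_) hle
    have h1 := lp.hasSum_norm (p := 2) (by simp) (x a)
    simp only [ENNReal.toReal_ofNat, Real.rpow_ofNat, ha] at h1
    have h2 := (Equiv.ulift.{w} (α := ℕ)).hasSum_iff (f := fun k => ‖φ k a‖ ^ 2) |>.1 h1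
    simp only [← ofReal_norm, ← ENNReal.ofReal_pow (norm_nonneg _)]
    rw [← ENNReal.ofReal_tsum_of_nonneg (fun _ => sq_nonneg _) h2.summable, h2.tsum_eq]

/-- An expansion gives a representation with values in `ℓ²`. -/
lemma IsBoundedExpansion.exists_inner {Φ : S × T → ℂ} {C : ℝ≥0} {φ : ℕ → S → ℂ}
    {ψ : ℕ → T → ℂ} (h : IsBoundedExpansion μ ν Φ C φ ψ) :
    ∃ (x : S → lp (fun _ : ULift.{w} ℕ => ℂ) 2) (y : T → lp (fun _ : ULift.{w} ℕ => ℂ) 2),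
      MemLp x ∞ μ ∧ MemLp y ∞ ν ∧ (∀ᵐ p ∂(μ.prod ν), Φ p = inner ℂ (y p.2) (x p.1)) ∧
      eLpNorm x ∞ μ * eLpNorm y ∞ ν ≤ C := by
  have hC : (C : ℝ≥0∞) = ((NNReal.sqrt C : ℝ≥0) : ℝ≥0∞) ^ 2 := by
    rw [← ENNReal.coe_pow, NNReal.sq_sqrt]
  obtain ⟨x, hxm, hx⟩ := exists_ellTwo_valued.{w} (fun k => (h.left_memLp k).1) h.left_le
  obtain ⟨y, hym, hy⟩ := exists_ellTwo_valued.{w}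
    (φ := fun k t => starRingEnd ℂ (ψ k t)) (fun k => (h.right_memLp k).conj.1)
    (by simpa only [RCLike.enorm_conj] using h.right_le)
  have hnorm : ∀ {α : Type _} [MeasurableSpace α] {m : Measure α}
      {z : α → lp (fun _ : ULift.{w} ℕ => ℂ) 2}, (∀ᵐ a ∂m, ‖z a‖ₑ ^ 2 ≤ C) →
      eLpNorm z ∞ m ≤ (NNReal.sqrt C : ℝ≥0) := by
    intro α _ m z hz
    rw [eLpNorm_exponent_top]
    refine essSup_le_of_ae_le _ (hz.mono fun a ha => ?_)
    rwa [hC, ENNReal.pow_le_pow_left_iff two_ne_zero] at ha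
  have hxn := hnorm (hx.mono fun _ h => h.2)
  have hyn : eLpNorm y ∞ ν ≤ (NNReal.sqrt C : ℝ≥0) := by
    rw [eLpNorm_exponent_top]
    refine essSup_le_of_ae_le _ (hy.mono fun a ha => ?_)
    have ha := ha.2
    rwa [hC, ENNReal.pow_le_pow_left_iff two_ne_zero] at ha
  refine ⟨x, y, ⟨hxm, hxn.trans_lt ENNReal.coe_lt_top⟩, ⟨hym, hyn.trans_lt ENNReal.coe_lt_top⟩,
    ?_, (mul_le_mul' hxn hyn).trans_eq (by rw [← sq, ← hC])⟩
  filter_upwards [h.hasSum, Measure.quasiMeasurePreserving_fst.ae hx,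
    Measure.quasiMeasurePreserving_snd.ae hy] with p h1 h2 h3
  have h4 := lp.hasSum_inner (𝕜 := ℂ) (y p.2) (x p.1)
  refine ((Equiv.ulift.{w} (α := ℕ)).hasSum_iff.2 h1).unique (h4.congr_fun fun k => ?_)
  rw [h2.1, h3.1, RCLike.inner_apply, RCLike.conj_conj]
  rfl

lemma IsHaagerupRepresentation.exists_boundedExpansion {Φ : S × T → ℂ} {φ : ℕ → S → ℂ}
    {ψ : ℕ → T → ℂ} (h : IsHaagerupRepresentation μ ν Φ φ ψ) {C : ℝ≥0} (hC : 0 < C)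
    (hle : normLinftyEllTwo μ φ * normLinftyEllTwo ν ψ ≤ C) :
    ∃ φ' ψ', IsBoundedExpansion μ ν Φ C φ' ψ' := by
  refine exists_boundedExpansion_of_mul_le hC h.left_finite.ne h.right_finite.ne hle
    (fun k => (h.left_memLp k).1) (fun k => (h.right_memLp k).1) h.hasSum ?_ ?_
  · rw [normLinftyEllTwo, ENNReal.rpow_half_sq]
    exact ae_le_essSup
  · rw [normLinftyEllTwo, ENNReal.rpow_half_sq]
    exact ae_le_essSup

lemma normLinftyEllTwo_le {α : Type*} [MeasurableSpace α] {m : Measure α} {φ : ℕ → α → ℂ}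
    {C : ℝ≥0∞} (h : ∀ᵐ a ∂m, ∑' k, ‖φ k a‖ₑ ^ 2 ≤ C) : normLinftyEllTwo m φ ≤ C ^ (1 / 2 : ℝ) :=
  ENNReal.rpow_le_rpow (essSup_le_of_ae_le _ h) (by norm_num)

lemma IsBoundedExpansion.isHaagerupRepresentation {Φ : S × T → ℂ} {C : ℝ≥0} {φ : ℕ → S → ℂ}
    {ψ : ℕ → T → ℂ} (h : IsBoundedExpansion μ ν Φ C φ ψ) :
    IsHaagerupRepresentation μ ν Φ φ ψ :=
  have hfin : (C : ℝ≥0∞) ^ (1 / 2 : ℝ) < ∞ :=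
    ENNReal.rpow_lt_top_of_nonneg (by norm_num) ENNReal.coe_ne_top
  ⟨h.left_memLp, h.right_memLp, (normLinftyEllTwo_le h.left_le).trans_lt hfin,
    (normLinftyEllTwo_le h.right_le).trans_lt hfin, h.hasSum⟩

lemma IsBoundedExpansion.haagerupNorm_le {Φ : S × T → ℂ} {C : ℝ≥0} {φ : ℕ → S → ℂ}
    {ψ : ℕ → T → ℂ} (h : IsBoundedExpansion μ ν Φ C φ ψ) : haagerupNorm μ ν Φ ≤ C := by
  have hle : haagerupNorm μ ν Φ ≤ normLinftyEllTwo μ φ * normLinftyEllTwo ν ψ :=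
    iInf_le_of_le φ (iInf_le_of_le ψ (iInf_le_of_le h.isHaagerupRepresentation le_rfl))
  refine hle.trans ((mul_le_mul' (normLinftyEllTwo_le h.left_le)
    (normLinftyEllTwo_le h.right_le)).trans_eq ?_)
  rw [← sq, ENNReal.rpow_half_sq]

lemma schurNorm_le_of_isSchurBound {Φ : S × T → ℂ} {C : ℝ≥0} (h : IsSchurBound μ ν Φ C) :
    schurNorm μ ν Φ ≤ C := iInf₂_le C h

/-- It is not needed that the infimum defining the Schur norm be attained: a failure of the bound
for some `a`, `c`, `b` would already contradict an admissible constant slightly above the infimum.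
-/
lemma IsSchurMultiplier.hasBilinearBound_of_schurNorm_le {Φ : S × T → ℂ} {C : ℝ≥0}
    (h : IsSchurMultiplier μ ν Φ) (hC : schurNorm μ ν Φ ≤ C) : HasBilinearBound μ ν Φ C := by
  intro a c ha hc
  refine ⟨(h.memLp_mul_prod ha hc).1, fun b hb => ?_⟩
  by_contra! hlt
  have hK : eLpNorm a 2 μ * eLpNorm c 2 ν ≠ ∞ := ENNReal.mul_ne_top ha.2.ne hc.2.ne
  rw [← ENNReal.lt_div_iff_mul_lt (.inr ENNReal.coe_ne_top) (.inl hK)] at hlt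
  obtain ⟨c', hc'⟩ := iInf_lt_iff.1 (hC.trans_lt hlt)
  obtain ⟨hbd, hc'⟩ := iInf_lt_iff.1 hc'
  rw [ENNReal.lt_div_iff_mul_lt (.inr ENNReal.coe_ne_top) (.inl hK)] at hc'
  exact hc'.not_ge ((hbd.hasBilinearBound a c ha hc).2 b hb)

lemma isSchurMultiplier_iff_memHaagerup {Φ : S × T → ℂ} :
    IsSchurMultiplier μ ν Φ ↔ MemHaagerup μ ν Φ := by
  constructor
  · intro h
    obtain ⟨C, hC⟩ := h.exists_hasBilinearBound
    obtain ⟨φ, ψ, hexp⟩ := hC.exists_boundedExpansion h.1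
    exact ⟨φ, ψ, hexp.isHaagerupRepresentation⟩
  · rintro ⟨φ, ψ, h⟩
    have hfin := (ENNReal.mul_lt_top h.left_finite h.right_finite).ne
    -- Balancing requires a positive constant, and the product of the norms may be zero; hence the
    -- added `1`.
    obtain ⟨φ', ψ', hexp⟩ := h.exists_boundedExpansion
      (C := (normLinftyEllTwo μ φ * normLinftyEllTwo ν ψ).toNNReal + 1) (by positivity) (by
        push_cast
        rw [ENNReal.coe_toNNReal hfin]
        exact le_self_add)
    exact hexp.isSchurMultiplier

lemma IsSchurMultiplier.schurNorm_eq_haagerupNorm {Φ : S × T → ℂ} (h : IsSchurMultiplier μ ν Φ) :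
    schurNorm μ ν Φ = haagerupNorm μ ν Φ := by
  refine le_antisymm ?_ ?_
  · refine le_iInf fun φ => le_iInf fun ψ => le_iInf fun hrep => ?_
    have hfin := (ENNReal.mul_lt_top hrep.left_finite hrep.right_finite).ne
    refine ENNReal.le_of_forall_pos_le_add fun ε hε _ => ?_
    -- The `ε` keeps the constant positive when the product of the norms is zero.
    obtain ⟨φ', ψ', hexp⟩ := hrep.exists_boundedExpansion
      (C := (normLinftyEllTwo μ φ * normLinftyEllTwo ν ψ).toNNReal + ε) (by positivity) (by
        push_cast
        rw [ENNReal.coe_toNNReal hfin]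
        exact le_self_add)
    refine (schurNorm_le_of_isSchurBound hexp.isSchurBound).trans_eq ?_
    push_cast
    rw [ENNReal.coe_toNNReal hfin]
  · refine le_iInf₂ fun c hc => ?_
    obtain ⟨φ, ψ, hexp⟩ := hc.hasBilinearBound.exists_boundedExpansion h.1
    exact hexp.haagerupNorm_le

end Representations

theorem mainTheorem1 {S : Type u} {T : Type v} [MeasurableSpace S] [MeasurableSpace T]
    (μ : Measure S) (ν : Measure T) [SigmaFinite μ] [SigmaFinite ν] :
    (∀ (Φ : S × T → ℂ), MemLp Φ ∞ (μ.prod ν) → ∀ (C : ℝ), 0 < C →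
      List.TFAE [
        IsSchurMultiplier μ ν Φ ∧ schurNorm μ ν Φ ≤ ENNReal.ofReal C,
        ∃ (H : Type w) (_ : NormedAddCommGroup H) (_ : InnerProductSpace ℂ H)
          (_ : CompleteSpace H) (x : S → H) (y : T → H),
          MemLp x ∞ μ ∧ MemLp y ∞ ν ∧
          (∀ᵐ p ∂(μ.prod ν), Φ p = inner ℂ (y p.2) (x p.1)) ∧
          eLpNorm x ∞ μ * eLpNorm y ∞ ν ≤ ENNReal.ofReal C,
        ∃ (φ : ℕ → S → ℂ) (ψ : ℕ → T → ℂ),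
          (∀ n, MemLp (φ n) ∞ μ) ∧ (∀ n, MemLp (ψ n) ∞ ν) ∧
          (∀ᵐ p ∂(μ.prod ν), HasSum (fun n => φ n p.1 * ψ n p.2) (Φ p)) ∧
          (∀ᵐ s ∂μ, ∑' n, ‖φ n s‖ₑ ^ 2 ≤ ENNReal.ofReal C) ∧
          (∀ᵐ t ∂ν, ∑' n, ‖ψ n t‖ₑ ^ 2 ≤ ENNReal.ofReal C)]) ∧
    (∀ (Φ : S × T → ℂ),
      (IsSchurMultiplier μ ν Φ ↔ MemHaagerup μ ν Φ) ∧
      (IsSchurMultiplier μ ν Φ → schurNorm μ ν Φ = haagerupNorm μ ν Φ)) := by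
  refine ⟨fun Φ hΦ C hC => ?_, fun Φ => ⟨isSchurMultiplier_iff_memHaagerup,
    IsSchurMultiplier.schurNorm_eq_haagerupNorm⟩⟩
  have hC' : 0 < C.toNNReal := Real.toNNReal_pos.2 hC
  tfae_have 1 → 3 := by
    rintro ⟨h1, h2⟩
    obtain ⟨φ, ψ, h⟩ := (h1.hasBilinearBound_of_schurNorm_le h2).exists_boundedExpansion h1.1
    exact ⟨φ, ψ, h.left_memLp, h.right_memLp, h.hasSum, h.left_le, h.right_le⟩
  tfae_have 3 → 1 := by
    rintro ⟨φ, ψ, h1, h2, h3, h4, h5⟩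
    -- `ENNReal.ofReal C` unfolds to the coercion of `C.toNNReal`, so the hypotheses fit without
    -- conversion.
    have h : IsBoundedExpansion μ ν Φ C.toNNReal φ ψ := ⟨h1, h2, h3, h4, h5⟩
    exact ⟨h.isSchurMultiplier, schurNorm_le_of_isSchurBound h.isSchurBound⟩
  tfae_have 3 → 2 := by
    rintro ⟨φ, ψ, h1, h2, h3, h4, h5⟩
    have h : IsBoundedExpansion μ ν Φ C.toNNReal φ ψ := ⟨h1, h2, h3, h4, h5⟩
    obtain ⟨x, y, hx, hy, hxy, hle⟩ := IsBoundedExpansion.exists_inner.{u, v, w} h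
    exact ⟨_, _, _, inferInstance, x, y, hx, hy, hxy, hle⟩
  tfae_have 2 → 3 := by
    rintro ⟨H, _, _, _, x, y, hx, hy, hxy, hle⟩
    obtain ⟨φ, ψ, h⟩ := exists_boundedExpansion_of_inner hC' hx hy hxy hle
    exact ⟨φ, ψ, h.left_memLp, h.right_memLp, h.hasSum, h.left_le, h.right_le⟩
  tfae_finish
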